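/- Let $N\ge 1$ and let $H=(h_{\ell k})_{1\le \ell,k\le N}$ be a Wigner matrix of one of the following two kinds, where $\nu,\widetilde\nu$ are centered probability measures on $\mathbb R$. (Symmetric case) $H$ is real symmetric, $h_{\ell k}=N^{-1/2}x_{\ell k}$, where the $x_{\ell k}$, $\ell\le k$, are independent real random variables, $x_{\ell k}$ has law $\nu$ with variance $1$ for $\ell<k$, and $x_{\ell\ell}$ has law $\widetilde\nu$ with variance $2$. (Hermitian case) $H$ is complex hermitian, $h_{\ell k}=N^{-1/2}(x_{\ell k}+iy_{\ell k})$ for $\ell<k$ and $h_{\ell\ell}=N^{-1/2}x_{\ell\ell}$, where the $x_{\ell k}$ ($\ell\le k$) and $y_{\ell k}$ ($\ell<k$) are independent real random variables, $x_{\ell k},y_{\ell k}$ have law $\nu$ with variance $\frac12$ for $\ell<k$, and $x_{\ell\ell}$ has law $\widetilde\nu$ with variance $1$. Assume Gaussian decay: for some $\delta_0>0$, $\int e^{\delta_0x^2}\,d\nu(x)<\infty$ and $\int e^{\delta_0x^2}\,d\widetilde\nu(x)<\infty$. For $I\subset\mathbb R$ let $\mathcal N_I$ be the number of eigenvalues of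 $H$ in $I$, counted with multiplicity, and let $\varrho_{sc}(x)=\frac1{2\pi}\sqrt{(4-x^2)_+}$. Then there is a universal constant $c_1>0$, and for every $\kappa>0$ there are constants $C,c>0$ depending only on $\kappa$, such that the following holds in both cases. For every pair $\nu,\widetilde\nu$ as above and every $0<\delta\le c_1\kappa$ there is $K>0$, depending only on $\delta$, $\kappa$, $\nu$ and $\widetilde\nu$, such that for every $E\in[-2+\kappa,2-\kappa]$, every $N\ge1$ and every $\eta$ with $K/N\le\eta\le 1/K$, with $I=[E-\frac\eta2,E+\frac\eta2]$, $$\mathbb P\Big\{\Big|\frac{\mathcal N_I}{N\eta}-\varrho_{sc}(E)\Big|\ge\delta\Big\}\le C e^{-c\delta^2\sqrt{N\eta}} .$$ -/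

import Mathlib

open MeasureTheory ProbabilityTheory

/-- The density of the semicircle law, `ϱ_sc(x) = (1 / 2π) √((4 - x²)₊)`. -/
noncomputable def semicircleDensity (x : ℝ) : ℝ :=
  1 / (2 * Real.pi) * Real.sqrt (max (4 - x ^ 2) 0)

/-- `ν` is a probability distribution on `ℝ` with zero expectation and variance `v`. -/
structure IsCenteredWithVariance (ν : Measure ℝ) (v : ℝ) : Prop where
  isProbabilityMeasure : IsProbabilityMeasure ν
  memLp : MemLp (fun x : ℝ => x) 2 ν
  mean_eq : ∫ x, x ∂ν = 0
  variance_eq : ∫ x, x ^ 2 ∂ν = v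

/-- Gaussian decay of a pair of single-site distributions: `∫ exp(δ₀ x²)` is finite
for both of them, for some `δ₀ > 0`. -/
def HasGaussianDecay (ν ν' : Measure ℝ) : Prop :=
  ∃ δ₀ : ℝ, 0 < δ₀ ∧
    Integrable (fun x : ℝ => Real.exp (δ₀ * x ^ 2)) ν ∧
    Integrable (fun x : ℝ => Real.exp (δ₀ * x ^ 2)) ν'

/-- `H` is a random real symmetric `N × N` matrix with entries `h_{ℓk} = N^{-1/2} x_{ℓk}`,
where the `x_{ℓk}`, `ℓ ≤ k`, are independent, with distribution `ν` for `ℓ < k` and `ν'`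
for `ℓ = k`. -/
structure IsSymmetricWigner {Ω : Type*} [MeasurableSpace Ω] (P : Measure Ω)
    (ν ν' : Measure ℝ) {N : ℕ} (H : Ω → Matrix (Fin N) (Fin N) ℝ) : Prop where
  isHermitian : ∀ ω, (H ω).IsHermitian
  law_offDiag : ∀ l k : Fin N, l < k →
    HasLaw (fun ω => Real.sqrt N * H ω l k) ν P
  law_diag : ∀ l : Fin N, HasLaw (fun ω => Real.sqrt N * H ω l l) ν' P
  indep : iIndepFun (fun (p : {p : Fin N × Fin N // p.1 ≤ p.2}) ω => H ω p.1.1 p.1.2) P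

/-- `H` is a random complex hermitian `N × N` matrix with entries
`h_{ℓk} = N^{-1/2} (x_{ℓk} + i y_{ℓk})` for `ℓ < k` and `h_{ℓℓ} = N^{-1/2} x_{ℓℓ}`, where
the real variables `x_{ℓk}` (`ℓ ≤ k`) and `y_{ℓk}` (`ℓ < k`) are all independent, with
distribution `ν` for `ℓ < k` and `ν'` for `ℓ = k`. -/
structure IsHermitianWigner {Ω : Type*} [MeasurableSpace Ω] (P : Measure Ω)
    (ν ν' : Measure ℝ) {N : ℕ} (H : Ω → Matrix (Fin N) (Fin N) ℂ) : Prop where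
  isHermitian : ∀ ω, (H ω).IsHermitian
  law_re : ∀ l k : Fin N, l < k → HasLaw (fun ω => Real.sqrt N * (H ω l k).re) ν P
  law_im : ∀ l k : Fin N, l < k → HasLaw (fun ω => Real.sqrt N * (H ω l k).im) ν P
  law_diag : ∀ l : Fin N, HasLaw (fun ω => Real.sqrt N * (H ω l l).re) ν' P
  indep : iIndepFun
    (Sum.elim
      (fun (p : {p : Fin N × Fin N // p.1 ≤ p.2}) ω => (H ω p.1.1 p.1.2).re)
      (fun (p : {p : Fin N × Fin N // p.1 < p.2}) ω => (H ω p.1.1 p.1.2).im)) P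

/-- The number of eigenvalues of a hermitian matrix, counted with multiplicity, in `I`. -/
noncomputable def eigenvalueCount {𝕜 : Type*} [RCLike 𝕜] {N : ℕ}
    {A : Matrix (Fin N) (Fin N) 𝕜} (hA : A.IsHermitian) (I : Set ℝ) : ℕ :=
  {α : Fin N | hA.eigenvalues α ∈ I}.ncard

/-!
For `z` in the upper half plane let `m(z)` be the normalized trace of the resolvent
`G(z) = (H - z)⁻¹`. Its imaginary part averages Poisson kernels over the eigenvalues, so that the
eigenvalue count of an interval of length `η` can be read off from `m` at finitely many points of
imaginary part of order `η` (`abs_card_div_sub_le_of_halfPlaneKernel`). The core of the argument is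
that, in the bulk, `m(z) ^ 2 + z * m(z) + 1` is small outside of an event whose probability is
exponentially small in `N * Im z` (`exists_local_law`). The roots of `m ^ 2 + E * m + 1` are complex
conjugates, one of them has imaginary part `π` times the semicircle density at `E`, and the other one
lies in the lower half plane, where `m` cannot be; hence `Im m` is close to `π` times the semicircle
density (`abs_im_sub_pi_mul_semicircleDensity_le`).

Schur's formula (`resolv_diag_mul_schur`) gives `G_kk = 1 / (h_kk - z - a* Ĝ a)`, where `Ĝ` is the
resolvent of the minor without the index `k` and `a` is the remaining part of the column `k`, which
is independent of `Ĝ`. As long as `m` is bounded, the quadratic form `a* Ĝ a` is within a small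
constant `t` of the normalized trace of `Ĝ`, and thus of `m`, outside of a bad event
(`exists_measure_badEvent_le`). This is the Hanson–Wright inequality (`exists_hansonWright`), which
applies because the form has operator norm at most `1 / (N * Im z)` and squared Hilbert–Schmidt norm
of the same order. It is proved here by decoupling and comparison with Gaussian vectors.

A union bound over the `N` indices would cost a logarithm of `N`. Instead, a small fraction of bad
indices is tolerated. The spectral parameter is moved from imaginary part of order one down to `η`
along the scales `2 ^ l * η`, and an index bad at scale `l` is charged the weight `3 ^ (l + 1)`. This
weight pays for the growth of `G_kk` between that scale and `η`, and it is beaten by the probability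
`exp (-θ * 2 ^ l * N * η)` of the bad event, so that Markov's inequality bounds the probability of a
total weight exceeding a small multiple of `N`. Off that event the self-consistent equation propagates
from one scale to the next (`approx_selfConsistent_of_bootstrap`).

Both symmetry classes are treated at once in a coordinate model (`wignerMatrix`, `wignerLaw`), in
which the symmetric case has imaginary parts with law the Dirac mass at zero. The resulting tail
`exp (-θ * N * η)` is stronger than the one of the theorem when `N * η` is large enough.
-/

open scoped ENNReal

/-! ### Exponential moments of a single variable -/

/-- The exponential of a real number, as an extended nonnegative real. Exponential moments are
expressed as lower Lebesgue integrals of it, so that no integrability has to be carried along. -/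
noncomputable def expE (r : ℝ) : ℝ≥0∞ := ENNReal.ofReal (Real.exp r)

lemma expE_add (a b : ℝ) : expE (a + b) = expE a * expE b := by
  rw [expE, Real.exp_add, ENNReal.ofReal_mul (Real.exp_pos _).le]; rfl

lemma expE_sum {ι : Type*} (s : Finset ι) (f : ι → ℝ) :
    expE (∑ i ∈ s, f i) = ∏ i ∈ s, expE (f i) := by
  rw [expE, Real.exp_sum, ENNReal.ofReal_prod_of_nonneg fun i _ => (Real.exp_pos _).le]; rfl

lemma expE_le_expE {a b : ℝ} (h : a ≤ b) : expE a ≤ expE b :=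
  ENNReal.ofReal_le_ofReal (Real.exp_le_exp.2 h)

lemma expE_neg_mul_self (a : ℝ) : expE (-a) * expE a = 1 := by
  rw [← expE_add]; simp [expE]

@[fun_prop] lemma measurable_expE : Measurable expE :=
  ENNReal.measurable_ofReal.comp Real.measurable_exp

/-- `μ` is subgaussian with variance proxy `2 * L`. -/
def SubGaussian (L : ℝ) (μ : Measure ℝ) : Prop :=
  ∀ s : ℝ, ∫⁻ x, expE (s * x) ∂μ ≤ expE (L * s ^ 2)

/-- The square of a variable with law `μ`, centered by `v`, is subexponential: its moment generating
function has a Gaussian bound near zero. A single constant `L` bounds both the exponent and, through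
`1 / L`, the range of `s`. -/
def SubExpSquare (L : ℝ) (μ : Measure ℝ) (v : ℝ) : Prop :=
  ∀ s : ℝ, |s| * L ≤ 1 → ∫⁻ x, expE (s * (x ^ 2 - v)) ∂μ ≤ expE (L * s ^ 2)

lemma SubGaussian.mono {L L' : ℝ} {μ : Measure ℝ} (h : SubGaussian L μ) (hL : L ≤ L') :
    SubGaussian L' μ := fun s =>
  (h s).trans (expE_le_expE (mul_le_mul_of_nonneg_right hL (sq_nonneg _)))

lemma SubExpSquare.mono {L L' : ℝ} {μ : Measure ℝ} {v : ℝ} (h : SubExpSquare L μ v)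
    (hL : L ≤ L') : SubExpSquare L' μ v := fun s hs =>
  (h s ((mul_le_mul_of_nonneg_left hL (abs_nonneg _)).trans hs)).trans
    (expE_le_expE (mul_le_mul_of_nonneg_right hL (sq_nonneg _)))

lemma exp_le_one_add_add_sq_mul_exp_abs (v : ℝ) :
    Real.exp v ≤ 1 + v + v ^ 2 * Real.exp |v| := by
  have h2 : (1:ℝ) ≤ Real.exp |v| := Real.one_le_exp (abs_nonneg v)
  rcases le_or_gt |v| 1 with h | h
  · have := Real.abs_exp_sub_one_sub_id_le h
    have h1 := (abs_le.1 this).2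
    nlinarith [sq_nonneg v]
  · have h3 : Real.exp v ≤ Real.exp |v| := Real.exp_le_exp.2 (le_abs_self v)
    rcases le_or_gt 0 v with h0 | h0
    · rw [abs_of_nonneg h0] at *
      nlinarith [mul_nonneg (show 0 ≤ v ^ 2 - 1 by nlinarith) (zero_le_one.trans h2)]
    · rw [abs_of_neg h0] at *
      have : Real.exp v ≤ 1 := Real.exp_le_one_iff.2 h0.le
      nlinarith [mul_nonneg (sq_nonneg v) (sub_nonneg.2 h2)]

lemma lintegral_expE_le {Ω : Type*} [MeasurableSpace Ω] {μ : Measure Ω} {f : Ω → ℝ} {b : ℝ}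
    (hi : Integrable (fun x => Real.exp (f x)) μ) (hb : ∫ x, Real.exp (f x) ∂μ ≤ Real.exp b) :
    ∫⁻ x, expE (f x) ∂μ ≤ expE b := by
  unfold expE
  rw [← ofReal_integral_eq_lintegral_ofReal hi (ae_of_all _ fun x => (Real.exp_pos _).le)]
  exact ENNReal.ofReal_le_ofReal hb

/-- A centered variable with some exponential moment has a moment generating function bounded by
a Gaussian one near the origin. -/
lemma exists_lintegral_expE_le_of_centered {μ : Measure ℝ} [IsProbabilityMeasure μ]
    {Y : ℝ → ℝ} (hY : Measurable Y) {a : ℝ} (ha : 0 < a)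
    (hint : Integrable (fun x => Real.exp (a * |Y x|)) μ) (hc : ∫ x, Y x ∂μ = 0) :
    ∃ L : ℝ, 0 < L ∧ ∀ s : ℝ, |s| ≤ a / 2 → ∫⁻ x, expE (s * Y x) ∂μ ≤ expE (L * s ^ 2) := by
  have hYint : Integrable Y μ := by
    refine (hint.const_mul (1 / a)).mono' hY.aestronglyMeasurable (ae_of_all _ fun x => ?_)
    have h1 : a * |Y x| ≤ Real.exp (a * |Y x|) := by
      linarith [Real.add_one_le_exp (a * |Y x|)]
    rw [Real.norm_eq_abs, one_div, ← div_eq_inv_mul, le_div_iff₀ ha]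
    linarith
  set M := ∫ x, Real.exp (a * |Y x|) ∂μ with hM
  have hM0 : 0 ≤ M := integral_nonneg fun x => (Real.exp_pos _).le
  refine ⟨8 / a ^ 2 * M + 1, by positivity, fun s hs => ?_⟩
  have key : ∀ x, Real.exp (s * Y x) ≤
      1 + s * Y x + s ^ 2 * (8 / a ^ 2) * Real.exp (a * |Y x|) := fun x => by
    have h1 := exp_le_one_add_add_sq_mul_exp_abs (s * Y x)
    have h2 : |s * Y x| ≤ a * |Y x| / 2 := by
      rw [abs_mul]; nlinarith [abs_nonneg (Y x)]
    have h3 : Real.exp |s * Y x| ≤ Real.exp (a * |Y x| / 2) := Real.exp_le_exp.2 h2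
    have h4 : (a * |Y x| / 2) ^ 2 / 2 ≤ Real.exp (a * |Y x| / 2) := by
      have h0 : 0 ≤ a * |Y x| / 2 := by positivity
      have := Real.quadratic_le_exp_of_nonneg h0
      linarith
    have h5 : Real.exp (a * |Y x|) = Real.exp (a * |Y x| / 2) * Real.exp (a * |Y x| / 2) := by
      rw [← Real.exp_add]; ring_nf
    have h6 : (Y x) ^ 2 ≤ 8 / a ^ 2 * Real.exp (a * |Y x| / 2) := by
      rw [div_mul_eq_mul_div, le_div_iff₀ (by positivity)]
      have : (a * |Y x| / 2) ^ 2 = a ^ 2 * (Y x) ^ 2 / 4 := by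
        rw [div_pow, mul_pow, sq_abs]; norm_num
      rw [this] at h4; linarith
    calc _ ≤ 1 + s * Y x + (s * Y x) ^ 2 * Real.exp |s * Y x| := h1
      _ ≤ 1 + s * Y x + s ^ 2 * ((8 / a ^ 2 * Real.exp (a * |Y x| / 2)) *
          Real.exp (a * |Y x| / 2)) := by
          rw [mul_pow, mul_assoc]
          gcongr
      _ = _ := by rw [h5]; ring
  have hexpi : Integrable (fun x => Real.exp (s * Y x)) μ := by
    refine hint.mono' (by fun_prop) (ae_of_all _ fun x => ?_)
    rw [Real.norm_eq_abs, abs_of_pos (Real.exp_pos _)]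
    refine Real.exp_le_exp.2 ((le_abs_self _).trans ?_)
    rw [abs_mul]; nlinarith [abs_nonneg (Y x)]
  refine lintegral_expE_le hexpi ?_
  have i1 : Integrable (fun x => 1 + s * Y x) μ := (integrable_const _).add (hYint.const_mul s)
  calc ∫ x, Real.exp (s * Y x) ∂μ
      ≤ ∫ x, (1 + s * Y x + s ^ 2 * (8 / a ^ 2) * Real.exp (a * |Y x|)) ∂μ :=
        integral_mono hexpi (i1.add (hint.const_mul _)) key
    _ = 1 + s ^ 2 * (8 / a ^ 2) * M := by
        rw [integral_add i1 (hint.const_mul _), integral_add (integrable_const _)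
          (hYint.const_mul s), integral_const_mul, integral_const_mul, hc]
        simp [hM]
    _ ≤ Real.exp (s ^ 2 * (8 / a ^ 2) * M) := by
        linarith [Real.add_one_le_exp (s ^ 2 * (8 / a ^ 2) * M)]
    _ ≤ _ := by
        apply Real.exp_le_exp.2
        nlinarith [sq_nonneg s]

/-- A centered law with a Gaussian moment is subgaussian: near the origin because it is centered, and
for `|s| > 1` by `s * x ≤ δ * x ^ 2 + s ^ 2 / (4 * δ)`. -/
lemma exists_subGaussian {μ : Measure ℝ} [IsProbabilityMeasure μ] (hc : ∫ x, x ∂μ = 0)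
    {δ : ℝ} (hδ : 0 < δ) (hint : Integrable (fun x : ℝ => Real.exp (δ * x ^ 2)) μ) :
    ∃ L : ℝ, 0 < L ∧ SubGaussian L μ := by
  have hlin : ∀ s x : ℝ, s * x ≤ δ * x ^ 2 + s ^ 2 / (4 * δ) := fun s x => by
    have h := div_nonneg (sq_nonneg (2 * δ * x - s)) (by positivity : 0 ≤ 4 * δ)
    have : (2 * δ * x - s) ^ 2 / (4 * δ) = δ * x ^ 2 + s ^ 2 / (4 * δ) - s * x := by
      field_simp; ring
    linarith
  obtain ⟨L, hL, h⟩ := exists_lintegral_expE_le_of_centered (μ := μ) (Y := fun x => x)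
    measurable_id (a := 2) (by norm_num) (by
      refine (hint.const_mul (Real.exp (2 ^ 2 / (4 * δ)))).mono' (by fun_prop)
        (ae_of_all _ fun x => ?_)
      rw [Real.norm_eq_abs, abs_of_pos (Real.exp_pos _), ← Real.exp_add]
      refine Real.exp_le_exp.2 ?_
      have := hlin 2 |x|
      rw [sq_abs] at this; linarith) hc
  set M := ∫ x, Real.exp (δ * x ^ 2) ∂μ with hM
  have hM1 : 1 ≤ M := by
    have : ∫ x, (1:ℝ) ∂μ ≤ M :=
      integral_mono (integrable_const _) hint fun x => Real.one_le_exp (by positivity)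
    simpa using this
  refine ⟨L + 1 / (4 * δ) + M, by positivity, fun s => ?_⟩
  rcases le_or_gt |s| 1 with hs | hs
  · refine (h s (by linarith)).trans (expE_le_expE ?_)
    have : 0 ≤ 1 / (4 * δ) + M := by positivity
    nlinarith [sq_nonneg s]
  · have hs2 : 1 ≤ s ^ 2 := by rw [← sq_abs]; nlinarith
    refine lintegral_expE_le ?_ ?_
    · refine (hint.const_mul (Real.exp (s ^ 2 / (4 * δ)))).mono' (by fun_prop)
        (ae_of_all _ fun x => ?_)
      rw [Real.norm_eq_abs, abs_of_pos (Real.exp_pos _), ← Real.exp_add]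
      exact Real.exp_le_exp.2 (by linarith [hlin s x])
    · calc ∫ x, Real.exp (s * x) ∂μ
          ≤ ∫ x, Real.exp (s ^ 2 / (4 * δ)) * Real.exp (δ * x ^ 2) ∂μ := by
            refine integral_mono_of_nonneg (ae_of_all _ fun x => (Real.exp_pos _).le)
              (hint.const_mul _) (ae_of_all _ fun x => ?_)
            simp only
            rw [← Real.exp_add]
            exact Real.exp_le_exp.2 (by linarith [hlin s x])
        _ = Real.exp (s ^ 2 / (4 * δ)) * M := by rw [integral_const_mul]
        _ ≤ Real.exp (s ^ 2 / (4 * δ)) * Real.exp M := by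
            gcongr; linarith [Real.add_one_le_exp M]
        _ ≤ _ := by
            rw [← Real.exp_add]
            refine Real.exp_le_exp.2 ?_
            have : s ^ 2 / (4 * δ) = 1 / (4 * δ) * s ^ 2 := by ring
            rw [this]
            nlinarith

lemma exists_subExpSquare {μ : Measure ℝ} [IsProbabilityMeasure μ] {v : ℝ}
    (h2 : Integrable (fun x : ℝ => x ^ 2) μ) (hv : ∫ x, x ^ 2 ∂μ = v)
    {δ : ℝ} (hδ : 0 < δ) (hint : Integrable (fun x : ℝ => Real.exp (δ * x ^ 2)) μ) :
    ∃ L : ℝ, 0 < L ∧ SubExpSquare L μ v := by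
  have hv0 : 0 ≤ v := hv ▸ integral_nonneg fun x => sq_nonneg x
  obtain ⟨L, hL, h⟩ := exists_lintegral_expE_le_of_centered (μ := μ) (Y := fun x => x ^ 2 - v)
    (by fun_prop) hδ (by
      refine (hint.const_mul (Real.exp (δ * v))).mono' (by fun_prop)
        (ae_of_all _ fun x => ?_)
      rw [Real.norm_eq_abs, abs_of_pos (Real.exp_pos _), ← Real.exp_add]
      refine Real.exp_le_exp.2 ?_
      have : |x ^ 2 - v| ≤ v + x ^ 2 := abs_le.2 ⟨by nlinarith, by nlinarith⟩
      nlinarith) (by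
      rw [integral_sub h2 (integrable_const _), hv]; simp)
  refine ⟨L + 2 / δ, by positivity, fun s hs => (h s ?_).trans (expE_le_expE ?_)⟩
  · have h3 : |s| * (2 / δ) ≤ 1 := by nlinarith [abs_nonneg s]
    rw [mul_div_assoc', div_le_one hδ] at h3
    linarith
  · have : 0 ≤ 2 / δ := by positivity
    nlinarith [sq_nonneg s]

/-! ### Product measures -/

section Product

variable {ι : Type*} [Fintype ι]

/-- Replacing the coordinates in `S` of a vector with independent coordinates by those of an
independent copy does not change its law. -/
lemma lintegral_pi_resample (μ : ι → Measure ℝ) [∀ i, IsProbabilityMeasure (μ i)] (S : Set ι)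
    [DecidablePred (· ∈ S)] {f : (ι → ℝ) → ℝ≥0∞} (hf : Measurable f) :
    ∫⁻ x, f x ∂Measure.pi μ =
      ∫⁻ y, ∫⁻ x, f (fun i => if i ∈ S then x i else y i) ∂Measure.pi μ ∂Measure.pi μ := by
  have hm : Measurable (fun p : (ι → ℝ) × (ι → ℝ) => fun i => if i ∈ S then p.2 i else p.1 i) := by
    refine measurable_pi_lambda _ fun i => ?_
    by_cases h : i ∈ S
    · simp only [h, if_true]; fun_prop
    · simp only [h, if_false]; fun_prop
  have key : Measure.pi μ = ((Measure.pi μ).prod (Measure.pi μ)).map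
      (fun p : (ι → ℝ) × (ι → ℝ) => fun i => if i ∈ S then p.2 i else p.1 i) := by
    refine Measure.pi_eq fun s hs => ?_
    rw [Measure.map_apply hm (MeasurableSet.univ_pi hs)]
    have : (fun p : (ι → ℝ) × (ι → ℝ) => fun i => if i ∈ S then p.2 i else p.1 i) ⁻¹'
        (Set.univ.pi s) = (Set.univ.pi fun i => if i ∈ S then Set.univ else s i) ×ˢ
          (Set.univ.pi fun i => if i ∈ S then s i else Set.univ) := by
      ext p
      simp only [Set.mem_preimage, Set.mem_pi, Set.mem_univ, forall_true_left, Set.mem_prod]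
      rw [← forall_and]
      refine forall_congr' fun i => ?_
      by_cases h : i ∈ S <;> simp [h]
    rw [this, Measure.prod_prod, Measure.pi_pi, Measure.pi_pi, ← Finset.prod_mul_distrib]
    refine Finset.prod_congr rfl fun i _ => ?_
    by_cases h : i ∈ S <;> simp [h]
  conv_lhs => rw [key]
  rw [lintegral_map hf hm]
  exact lintegral_prod _ (hf.comp hm).aemeasurable

lemma lintegral_pi_prod (μ : ι → Measure ℝ) [∀ i, IsProbabilityMeasure (μ i)]
    {f : ι → ℝ → ℝ≥0∞} (hf : ∀ i, Measurable (f i)) :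
    ∫⁻ x, ∏ i, f i (x i) ∂Measure.pi μ = ∏ i, ∫⁻ x, f i x ∂μ i := by
  have hi : iIndepFun (fun i (x : ι → ℝ) => f i (x i)) (Measure.pi μ) :=
    iIndepFun_pi (X := fun i => f i) fun i => (hf i).aemeasurable
  rw [lintegral_prod_eq_prod_lintegral_of_indepFun Finset.univ _ hi
    fun i => (hf i).comp (measurable_pi_apply i)]
  refine Finset.prod_congr rfl fun i _ => ?_
  exact (measurePreserving_eval μ i).lintegral_comp (hf i)

lemma lintegral_pi_expE_sum_le (μ : ι → Measure ℝ) [∀ i, IsProbabilityMeasure (μ i)]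
    {f : ι → ℝ → ℝ} (hf : ∀ i, Measurable (f i)) {b : ι → ℝ}
    (h : ∀ i, ∫⁻ x, expE (f i x) ∂μ i ≤ expE (b i)) :
    ∫⁻ x, expE (∑ i, f i (x i)) ∂Measure.pi μ ≤ expE (∑ i, b i) := by
  simp_rw [expE_sum]
  rw [lintegral_pi_prod μ (f := fun i x => expE (f i x)) fun i => measurable_expE.comp (hf i)]
  exact Finset.prod_le_prod' fun i _ => h i

/-- Chernoff's bound. -/
lemma measure_le_expE_of_lintegral_le {Ω : Type*} [MeasurableSpace Ω] {μ : Measure Ω} {f : Ω → ℝ}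
    (hf : Measurable f) {s a b : ℝ} (hs : 0 < s) (h : ∫⁻ x, expE (s * f x) ∂μ ≤ expE b) :
    μ {x | a ≤ f x} ≤ expE (b - s * a) := by
  have h1 : {x | a ≤ f x} ⊆ {x | expE (s * a) ≤ expE (s * f x)} := fun x hx =>
    expE_le_expE (mul_le_mul_of_nonneg_left hx hs.le)
  have h2 := mul_meas_ge_le_lintegral (μ := μ) (f := fun x => expE (s * f x)) (by fun_prop)
    (expE (s * a))
  calc μ {x | a ≤ f x} = expE (-(s * a)) * (expE (s * a) * μ {x | a ≤ f x}) := by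
        rw [← mul_assoc, expE_neg_mul_self, one_mul]
    _ ≤ expE (-(s * a)) * expE b := by
        gcongr
        exact (mul_le_mul_right (measure_mono h1) _).trans (h2.trans h)
    _ = expE (b - s * a) := by rw [← expE_add]; ring_nf

end Product

/-! ### Concentration of quadratic forms -/

section Gaussian

lemma lintegral_gaussian_expE_mul (s : ℝ) :
    ∫⁻ x, expE (s * x) ∂gaussianReal 0 1 = expE (s ^ 2 / 2) := by
  unfold expE
  rw [← ofReal_integral_eq_lintegral_ofReal (integrable_exp_mul_gaussianReal s)
    (ae_of_all _ fun x => (Real.exp_pos _).le)]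
  have := congrFun (mgf_fun_id_gaussianReal (μ := 0) (v := 1)) s
  simp only [mgf] at this
  rw [this]; simp

/-- The exact value is `(1 - 2 * u) ^ (-1 / 2)`, which is at most `exp (2 * u)` for `u ≤ 1 / 4`. -/
lemma lintegral_gaussian_expE_sq {u : ℝ} (hu : 0 ≤ u) (hu' : u ≤ 1 / 4) :
    ∫⁻ x, expE (u * x ^ 2) ∂gaussianReal 0 1 ≤ expE (2 * u) := by
  have hint : Integrable (fun x : ℝ => Real.exp (-(1 / 2 - u) * x ^ 2)) :=
    integrable_exp_neg_mul_sq (by linarith)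
  have hpdf : ∀ x : ℝ, gaussianPDFReal 0 1 x * Real.exp (u * x ^ 2) =
      (Real.sqrt (2 * Real.pi))⁻¹ * Real.exp (-(1 / 2 - u) * x ^ 2) := fun x => by
    simp only [gaussianPDFReal, NNReal.coe_one, mul_one, sub_zero]
    rw [mul_assoc, ← Real.exp_add]; congr 2; ring
  rw [gaussianReal_of_var_ne_zero _ (by norm_num), lintegral_withDensity_eq_lintegral_mul _
    (measurable_gaussianPDF 0 1) (by fun_prop)]
  have : ∀ x : ℝ, (gaussianPDF 0 1 * fun x => expE (u * x ^ 2)) x = ENNReal.ofReal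
      ((Real.sqrt (2 * Real.pi))⁻¹ * Real.exp (-(1 / 2 - u) * x ^ 2)) := fun x => by
    rw [← hpdf, ENNReal.ofReal_mul (gaussianPDFReal_nonneg 0 1 x)]; rfl
  simp_rw [this]
  rw [← ofReal_integral_eq_lintegral_ofReal (hint.const_mul _)
    (ae_of_all _ fun x => by positivity), integral_const_mul, integral_gaussian]
  refine ENNReal.ofReal_le_ofReal ?_
  rw [← Real.sqrt_inv, ← Real.sqrt_mul (by positivity)]
  have e : (2 * Real.pi)⁻¹ * (Real.pi / (1 / 2 - u)) = 1 / (1 - 2 * u) := by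
    have : (1:ℝ) / 2 - u ≠ 0 := by linarith
    have : (1:ℝ) - 2 * u ≠ 0 := by linarith
    have : (1:ℝ) - u * 2 ≠ 0 := by linarith
    field_simp
  rw [e]
  have h1 : Real.exp (2 * u) = Real.sqrt (Real.exp (4 * u)) := by
    rw [Real.sqrt_eq_rpow, ← Real.exp_mul]; congr 1; ring
  rw [h1]
  refine Real.sqrt_le_sqrt ?_
  rw [div_le_iff₀ (by linarith)]
  nlinarith [Real.add_one_le_exp (4 * u)]

end Gaussian

section HansonWright

variable {ι : Type*} [Fintype ι]

open WithLp in
/-- Exponential moment of the squared length of a linear image of a standard Gaussian vector. By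
rotation invariance the quadratic form may be diagonalized. -/
lemma lintegral_gaussian_expE_quadratic [DecidableEq ι] (T : Matrix ι ι ℝ) {u β : ℝ} (hu : 0 ≤ u)
    (hT : ∀ g : ι → ℝ, ∑ i, (∑ j, T i j * g j) ^ 2 ≤ β * ∑ j, g j ^ 2) (huβ : u * β ≤ 1 / 4) :
    ∫⁻ g, expE (u * ∑ i, (∑ j, T i j * g j) ^ 2) ∂Measure.pi (fun _ : ι => gaussianReal 0 1) ≤
      expE (2 * u * ∑ i, ∑ j, T i j ^ 2) := by
  have hM : (T.transpose * T).IsHermitian := by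
    rw [← Matrix.conjTranspose_eq_transpose_of_trivial]
    exact Matrix.isHermitian_conjTranspose_mul_self T
  set b := hM.eigenvectorBasis
  set τ := hM.eigenvalues
  have hq : ∀ g : ι → ℝ, ∑ i, (∑ j, T i j * g j) ^ 2 = g ⬝ᵥ ((T.transpose * T).mulVec g) := by
    intro g
    rw [← Matrix.mulVec_mulVec, Matrix.dotProduct_mulVec, Matrix.vecMul_transpose]
    simp [dotProduct, Matrix.mulVec, sq]
  have hτ : ∀ k, τ k = ∑ i, (∑ j, T i j * b k j) ^ 2 := by
    intro k
    rw [hq]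
    simpa [b] using hM.eigenvalues_eq k
  -- in the eigenbasis of `Tᵀ * T` the coordinates of the Gaussian vector decouple
  have hb1 : ∀ k, ∑ j, (b k j) ^ 2 = 1 := by
    intro k
    have := b.orthonormal.1 k
    rw [EuclideanSpace.norm_eq, Real.sqrt_eq_one] at this
    simpa using this
  have hτ0 : ∀ k, 0 ≤ τ k := fun k => by rw [hτ]; positivity
  have hτβ : ∀ k, τ k ≤ β := fun k => by
    have := hT (b k); rw [hb1, mul_one] at this; rwa [hτ]
  have htr : ∑ k, τ k = ∑ i, ∑ j, T i j ^ 2 := by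
    have := hM.trace_eq_sum_eigenvalues
    simp only [RCLike.ofReal_real_eq_id, id] at this
    rw [← this, Matrix.trace, Finset.sum_comm]
    simp [Matrix.mul_apply, sq]
  set F : EuclideanSpace ℝ ι → ℝ≥0∞ := fun g => expE (u * ∑ i, (∑ j, T i j * g j) ^ 2) with hF
  have hFm : Measurable F := by fun_prop
  have hdiag : ∀ x : ι → ℝ, F (∑ k, x k • b k) = expE (∑ k, u * τ k * x k ^ 2) := by
    intro x
    have hmul : (T.transpose * T).mulVec (ofLp (∑ k, x k • b k)) =
        ofLp (∑ k, (τ k * x k) • b k) := by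
      simp only [ofLp_sum, ofLp_smul, Matrix.mulVec_sum, Matrix.mulVec_smul]
      refine Finset.sum_congr rfl fun k _ => ?_
      rw [hM.mulVec_eigenvectorBasis k, smul_smul, mul_comm]
    have hin : (ofLp (∑ k, x k • b k)) ⬝ᵥ ofLp (∑ k, (τ k * x k) • b k) =
        ∑ k, x k * (τ k * x k) := by
      have := b.orthonormal.inner_sum x (fun k => τ k * x k) Finset.univ
      rw [EuclideanSpace.inner_eq_star_dotProduct, dotProduct_comm] at this
      simpa using this
    simp only [hF]
    rw [hq, hmul, hin, Finset.mul_sum]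
    congr 1
    exact Finset.sum_congr rfl fun k _ => by ring
  calc ∫⁻ g, expE (u * ∑ i, (∑ j, T i j * g j) ^ 2) ∂Measure.pi (fun _ : ι => gaussianReal 0 1)
      = ∫⁻ g, F g ∂((Measure.pi (fun _ : ι => gaussianReal 0 1)).map (toLp 2)) := by
        rw [lintegral_map hFm (by fun_prop)]
    _ = ∫⁻ x, F (∑ k, x k • b k) ∂Measure.pi (fun _ : ι => gaussianReal 0 1) := by
        rw [map_pi_eq_stdGaussian, stdGaussian_eq_map_pi_orthonormalBasis b,
          lintegral_map hFm (Finset.measurable_sum _ (by fun_prop))]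
    _ ≤ expE (∑ k, 2 * (u * τ k)) := by
        simp_rw [hdiag]
        refine lintegral_pi_expE_sum_le (fun _ => gaussianReal 0 1)
          (f := fun k y => u * τ k * y ^ 2) (fun k => by fun_prop) fun k => ?_
        exact lintegral_gaussian_expE_sq (mul_nonneg hu (hτ0 k))
          ((mul_le_mul_of_nonneg_left (hτβ k) hu).trans huβ)
    _ = _ := by
        rw [← htr, Finset.mul_sum]
        congr 1
        exact Finset.sum_congr rfl fun k _ => by ring

lemma lintegral_pi_expE_linear_le {μ : ι → Measure ℝ} [∀ i, IsProbabilityMeasure (μ i)] {L : ℝ}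
    (hμ : ∀ i, SubGaussian L (μ i)) (c : ι → ℝ) :
    ∫⁻ x, expE (∑ i, c i * x i) ∂Measure.pi μ ≤ expE (L * ∑ i, c i ^ 2) := by
  rw [Finset.mul_sum]
  exact lintegral_pi_expE_sum_le μ (f := fun i y => c i * y) (fun i => by fun_prop)
    fun i => hμ i (c i)

/-- Exponential moment of a bilinear form in two independent vectors with subgaussian coordinates.
The first vector is integrated out directly; the resulting squared length of a linear image of the
second one is linearized by a Gaussian vector, to which the second vector is then transferred. -/
lemma lintegral_expE_bilinear_le [DecidableEq ι] {μ : ι → Measure ℝ}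
    [∀ i, IsProbabilityMeasure (μ i)] {L : ℝ} (hL : 0 ≤ L) (hμ : ∀ i, SubGaussian L (μ i))
    (T : Matrix ι ι ℝ) {s β : ℝ}
    (hT : ∀ g : ι → ℝ, ∑ j, (∑ i, T i j * g i) ^ 2 ≤ β * ∑ i, g i ^ 2)
    (hs : 2 * L ^ 2 * s ^ 2 * β ≤ 1 / 4) :
    ∫⁻ y, ∫⁻ x, expE (s * ∑ i, ∑ j, T i j * x i * y j) ∂Measure.pi μ ∂Measure.pi μ ≤
      expE (4 * L ^ 2 * s ^ 2 * ∑ i, ∑ j, T i j ^ 2) := by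
  set γ := Measure.pi (fun _ : ι => gaussianReal 0 1) with hγ
  have h1 : ∀ y : ι → ℝ, ∫⁻ x, expE (s * ∑ i, ∑ j, T i j * x i * y j) ∂Measure.pi μ ≤
      ∫⁻ g, expE (∑ i, (Real.sqrt (2 * L) * s * ∑ j, T i j * y j) * g i) ∂γ := by
    intro y
    have e : ∀ x : ι → ℝ, s * ∑ i, ∑ j, T i j * x i * y j =
        ∑ i, (s * ∑ j, T i j * y j) * x i := fun x => by
      simp only [Finset.mul_sum, Finset.sum_mul]
      exact Finset.sum_congr rfl fun i _ => Finset.sum_congr rfl fun j _ => by ring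
    simp_rw [e]
    refine (lintegral_pi_expE_linear_le hμ _).trans (le_of_eq ?_)
    simp_rw [expE_sum]
    rw [hγ, lintegral_pi_prod (fun _ : ι => gaussianReal 0 1)
      (f := fun i y' => expE ((Real.sqrt (2 * L) * s * ∑ j, T i j * y j) * y'))
      (fun i => by fun_prop)]
    simp_rw [lintegral_gaussian_expE_mul]
    rw [← expE_sum, Finset.mul_sum]
    congr 1
    refine Finset.sum_congr rfl fun i _ => ?_
    rw [mul_pow, mul_pow, mul_pow, Real.sq_sqrt (by positivity)]; ring
  calc _ ≤ ∫⁻ y, ∫⁻ g, expE (∑ i, (Real.sqrt (2 * L) * s * ∑ j, T i j * y j) * g i) ∂γ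
        ∂Measure.pi μ := lintegral_mono h1
    _ = ∫⁻ g, ∫⁻ y, expE (∑ i, (Real.sqrt (2 * L) * s * ∑ j, T i j * y j) * g i)
        ∂Measure.pi μ ∂γ := by
        refine lintegral_lintegral_swap ?_
        refine Measurable.aemeasurable ?_
        unfold Function.uncurry
        fun_prop
    _ ≤ ∫⁻ g, expE (2 * L ^ 2 * s ^ 2 * ∑ j, (∑ i, T.transpose j i * g i) ^ 2) ∂γ := by
        refine lintegral_mono fun g => ?_
        have e : ∀ y : ι → ℝ, ∑ i, (Real.sqrt (2 * L) * s * ∑ j, T i j * y j) * g i =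
            ∑ j, (Real.sqrt (2 * L) * s * ∑ i, T i j * g i) * y j := fun y => by
          simp only [Finset.mul_sum, Finset.sum_mul]
          rw [Finset.sum_comm]
          exact Finset.sum_congr rfl fun i _ => Finset.sum_congr rfl fun j _ => by ring
        simp_rw [e]
        refine (lintegral_pi_expE_linear_le hμ _).trans (expE_le_expE (le_of_eq ?_))
        rw [Finset.mul_sum, Finset.mul_sum]
        refine Finset.sum_congr rfl fun i _ => ?_
        rw [mul_pow, mul_pow, Real.sq_sqrt (by positivity)]
        simp only [Matrix.transpose_apply]; ring
    _ ≤ _ := by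
        refine (lintegral_gaussian_expE_quadratic T.transpose (by positivity) hT hs).trans
          (expE_le_expE (le_of_eq ?_))
        rw [Finset.sum_comm]
        simp only [Matrix.transpose_apply]; ring

/-- Among all subsets of `ι`, a quarter contain `i` and not `j`. -/
lemma sum_bool_indicator [DecidableEq ι] {i j : ι} (hij : i ≠ j) :
    ∑ S : ι → Bool, (if S i then (1:ℝ) else 0) * (if S j then (0:ℝ) else 1) =
      2 ^ Fintype.card ι / 4 := by
  have hinv : ∀ k : ι, Function.Involutive
      (fun S : ι → Bool => Function.update S k (!S k)) := fun k S => by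
    ext l
    by_cases h : l = k
    · subst h; simp
    · simp [h]
  set c : (ι → Bool) → ℝ :=
    fun S => (if S i then (1:ℝ) else 0) * (if S j then (0:ℝ) else 1) with hc
  set e := fun k => (hinv k).toPerm with he
  have h1 : ∑ S, c S = ∑ S, c (e i S) := (Equiv.sum_comp (e i) c).symm
  have h2 : ∑ S, c S = ∑ S, c (e j S) := (Equiv.sum_comp (e j) c).symm
  have h3 : ∑ S, c S = ∑ S, c (e i (e j S)) := by
    rw [h1]; exact (Equiv.sum_comp (e j) (fun S => c (e i S))).symm
  have h4 : ∑ S : ι → Bool, (c S + c (e i S) + c (e j S) + c (e i (e j S))) =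
      ∑ S : ι → Bool, (1:ℝ) := by
    refine Finset.sum_congr rfl fun S _ => ?_
    simp only [hc, he, Function.Involutive.coe_toPerm]
    cases h5 : S i <;> cases h6 : S j <;> simp [hij, hij.symm, h5, h6]
  rw [Finset.sum_add_distrib, Finset.sum_add_distrib, Finset.sum_add_distrib, ← h1, ← h2, ← h3]
    at h4
  simp at h4
  linarith

/-- Exponential moment of an off-diagonal quadratic form, by decoupling: the form is an average of
bilinear forms in the coordinates inside and outside of a random subset. -/
lemma lintegral_expE_offDiag_le [DecidableEq ι] {μ : ι → Measure ℝ}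
    [∀ i, IsProbabilityMeasure (μ i)] {L : ℝ} (hL : 0 ≤ L) (hμ : ∀ i, SubGaussian L (μ i))
    (b : ι → ι → ℝ) {s β : ℝ} (hβ : 0 ≤ β)
    (hb : ∀ g h : ι → ℝ, (∑ i, ∑ j, b i j * g i * h j) ^ 2 ≤
      β * (∑ i, g i ^ 2) * ∑ j, h j ^ 2)
    (hs : 128 * L ^ 2 * s ^ 2 * β ≤ 1) :
    ∫⁻ x, expE (s * ∑ i, ∑ j, if i = j then 0 else b i j * x i * x j) ∂Measure.pi μ ≤
      expE (64 * L ^ 2 * s ^ 2 * ∑ i, ∑ j, b i j ^ 2) := by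
  set n := Fintype.card ι
  set Q : (ι → Bool) → (ι → ℝ) → (ι → ℝ) → ℝ := fun S x y =>
    ∑ i, ∑ j, (if S i then (1:ℝ) else 0) * (if S j then (0:ℝ) else 1) * b i j * x i * y j with hQ
  have hw : (2:ℝ) ^ n ≠ 0 := by positivity
  have havg : ∀ x : ι → ℝ, s * ∑ i, ∑ j, (if i = j then 0 else b i j * x i * x j) =
      ∑ S : ι → Bool, (1 / 2 ^ n : ℝ) • (4 * s * Q S x x) := by
    intro x
    simp only [hQ, smul_eq_mul, Finset.mul_sum]
    symm
    rw [Finset.sum_comm]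
    refine Finset.sum_congr rfl fun i _ => ?_
    rw [Finset.sum_comm]
    refine Finset.sum_congr rfl fun j _ => ?_
    symm
    by_cases hij : i = j
    · subst hij
      simp only [if_true, mul_zero]
      refine (Finset.sum_eq_zero fun S _ => ?_).symm
      cases S i <;> simp
    · rw [if_neg hij]
      have := sum_bool_indicator hij
      calc s * (b i j * x i * x j) = 1 / 2 ^ n * (4 * s * ((2 ^ n / 4) * (b i j * x i * x j))) := by
            field_simp
        _ = _ := by
            rw [← this, Finset.sum_mul, Finset.mul_sum, Finset.mul_sum]
            exact Finset.sum_congr rfl fun S _ => by ring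
  -- Jensen's inequality for the average over subsets
  have hconv : ∀ x : ι → ℝ,
      expE (s * ∑ i, ∑ j, if i = j then 0 else b i j * x i * x j) ≤
      ∑ S : ι → Bool, ENNReal.ofReal (1 / 2 ^ n) * expE (4 * s * Q S x x) := by
    intro x
    rw [havg, expE]
    refine (ENNReal.ofReal_le_ofReal (convexOn_exp.map_sum_le (fun _ _ => by positivity) ?_
      fun _ _ => Set.mem_univ _)).trans (le_of_eq ?_)
    · simp [n]
    · rw [ENNReal.ofReal_sum_of_nonneg fun S _ => by positivity]
      refine Finset.sum_congr rfl fun S _ => ?_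
      rw [smul_eq_mul, ENNReal.ofReal_mul (by positivity)]; rfl
  have hS : ∀ S : ι → Bool, ∫⁻ x, expE (4 * s * Q S x x) ∂Measure.pi μ ≤
      expE (64 * L ^ 2 * s ^ 2 * ∑ i, ∑ j, b i j ^ 2) := by
    intro S
    -- the coordinates inside and outside of `S` are replaced by two independent vectors
    have hr := lintegral_pi_resample μ {i | S i = true} (f := fun x => expE (4 * s * Q S x x))
      (by simp only [hQ]; fun_prop)
    rw [hr]
    set T : Matrix ι ι ℝ := Matrix.of fun i j =>
      (if S i then (1:ℝ) else 0) * (if S j then (0:ℝ) else 1) * b i j with hTdef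
    have e : ∀ x y : ι → ℝ, Q S (fun i => if i ∈ {i | S i = true} then x i else y i)
        (fun i => if i ∈ {i | S i = true} then x i else y i) =
        ∑ i, ∑ j, T i j * x i * y j := by
      intro x y
      refine Finset.sum_congr rfl fun i _ => Finset.sum_congr rfl fun j _ => ?_
      simp only [hTdef, Matrix.of_apply, Set.mem_ofPred_eq]
      by_cases h1 : S i = true <;> by_cases h2 : S j = true <;> simp [h1, h2]
    simp_rw [e]
    refine (lintegral_expE_bilinear_le hL hμ T (β := β) ?_ ?_).trans (expE_le_expE ?_)
    · intro g
      set w := ∑ j, (∑ i, T i j * g i) ^ 2 with hw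
      have hw0 : 0 ≤ w := by positivity
      have h1 := hb (fun i => (if S i then (1:ℝ) else 0) * g i)
        (fun j => (if S j then (0:ℝ) else 1) * ∑ i, T i j * g i)
      have h2 : ∑ i, ∑ j, b i j * ((if S i then (1:ℝ) else 0) * g i) *
          ((if S j then (0:ℝ) else 1) * ∑ i, T i j * g i) = w := by
        rw [hw, Finset.sum_comm]
        refine Finset.sum_congr rfl fun j _ => ?_
        rw [sq, Finset.sum_mul]
        refine Finset.sum_congr rfl fun i _ => ?_
        simp only [hTdef, Matrix.of_apply]; ring
      have h3 : ∑ i, ((if S i then (1:ℝ) else 0) * g i) ^ 2 ≤ ∑ i, g i ^ 2 := by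
        refine Finset.sum_le_sum fun i _ => ?_
        cases S i <;> simp [sq_nonneg]
      have h4 : ∑ j, ((if S j then (0:ℝ) else 1) * ∑ i, T i j * g i) ^ 2 ≤ w := by
        refine Finset.sum_le_sum fun i _ => ?_
        cases S i <;> simp [sq_nonneg]
      rw [h2] at h1
      have h5 : w ^ 2 ≤ β * (∑ i, g i ^ 2) * w :=
        h1.trans (by gcongr)
      rcases hw0.eq_or_lt with h0 | h0
      · rw [← h0]; positivity
      · rw [sq] at h5; exact le_of_mul_le_mul_right h5 h0
    · linarith
    · have : ∑ i, ∑ j, T i j ^ 2 ≤ ∑ i, ∑ j, b i j ^ 2 := by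
        refine Finset.sum_le_sum fun i _ => Finset.sum_le_sum fun j _ => ?_
        simp only [hTdef, Matrix.of_apply]
        cases S i <;> cases S j <;> simp [sq_nonneg]
      calc 4 * L ^ 2 * (4 * s) ^ 2 * ∑ i, ∑ j, T i j ^ 2
          = 64 * L ^ 2 * s ^ 2 * ∑ i, ∑ j, T i j ^ 2 := by ring
        _ ≤ _ := by gcongr
  calc _ ≤ ∫⁻ x, ∑ S : ι → Bool, ENNReal.ofReal (1 / 2 ^ n) * expE (4 * s * Q S x x)
        ∂Measure.pi μ := lintegral_mono hconv
    _ = ∑ S : ι → Bool, ENNReal.ofReal (1 / 2 ^ n) * ∫⁻ x, expE (4 * s * Q S x x)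
        ∂Measure.pi μ := by
        rw [lintegral_finsetSum _ (fun S _ => by simp only [hQ]; fun_prop)]
        refine Finset.sum_congr rfl fun S _ => ?_
        rw [lintegral_const_mul _ (by simp only [hQ]; fun_prop)]
    _ ≤ ∑ S : ι → Bool, ENNReal.ofReal (1 / 2 ^ n) *
        expE (64 * L ^ 2 * s ^ 2 * ∑ i, ∑ j, b i j ^ 2) := by
        gcongr with S; exact hS S
    _ = _ := by
        rw [← Finset.sum_mul, ← ENNReal.ofReal_sum_of_nonneg fun S _ => by positivity]
        simp [n]

/-- **Hanson–Wright inequality**, for a form with operator norm at most `1 / A` and squared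
Hilbert–Schmidt norm at most `B / A`: deviations of a fixed size `t` are exponentially unlikely
in `A`. -/
lemma exists_hansonWright {L B t : ℝ} (hL : 0 < L) (hB : 0 < B) (ht : 0 < t) :
    ∃ θ : ℝ, 0 < θ ∧ ∀ {ι : Type} [Fintype ι] (μ : ι → Measure ℝ)
      [∀ i, IsProbabilityMeasure (μ i)] (v : ι → ℝ), (∀ i, SubGaussian L (μ i)) →
      (∀ i, SubExpSquare L (μ i) (v i)) → ∀ (b : ι → ι → ℝ) (A : ℝ), 0 < A →
      (∀ g h : ι → ℝ, (∑ i, ∑ j, b i j * g i * h j) ^ 2 ≤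
        (1 / A) ^ 2 * (∑ i, g i ^ 2) * ∑ j, h j ^ 2) →
      ∑ i, ∑ j, b i j ^ 2 ≤ B / A →
      Measure.pi μ {x | t ≤ |∑ i, ∑ j, b i j * x i * x j - ∑ i, b i i * v i|} ≤
        4 * expE (-(θ * A)) := by
  -- the exponential moments are taken at `q * A`, with `q` small enough for both parts of the form
  obtain ⟨q, hq, hq1, hq2, hq3, hq4⟩ : ∃ q : ℝ, 0 < q ∧ 128 * L ^ 2 * q ^ 2 ≤ 1 ∧ q * L ≤ 1 ∧
      256 * L ^ 2 * B * q ≤ t ∧ 4 * L * B * q ≤ t := by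
    refine ⟨min (1 / (12 * L)) (min (t / (256 * L ^ 2 * B)) (t / (4 * L * B))),
      by positivity, ?_, ?_, ?_, ?_⟩
    · have h0 : 0 ≤ min (1 / (12 * L)) (min (t / (256 * L ^ 2 * B)) (t / (4 * L * B))) := by
        positivity
      have h1 := min_le_left (1 / (12 * L)) (min (t / (256 * L ^ 2 * B)) (t / (4 * L * B)))
      rw [le_div_iff₀ (by positivity)] at h1
      nlinarith [mul_nonneg h0 hL.le]
    · have h1 := min_le_left (1 / (12 * L)) (min (t / (256 * L ^ 2 * B)) (t / (4 * L * B)))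
      rw [le_div_iff₀ (by positivity)] at h1
      nlinarith
    · have h1 := (min_le_right (1 / (12 * L)) _).trans
        (min_le_left (t / (256 * L ^ 2 * B)) (t / (4 * L * B)))
      rw [le_div_iff₀ (by positivity)] at h1
      linarith
    · have h1 := (min_le_right (1 / (12 * L)) _).trans
        (min_le_right (t / (256 * L ^ 2 * B)) (t / (4 * L * B)))
      rw [le_div_iff₀ (by positivity)] at h1
      linarith
  refine ⟨q * t / 4, by positivity, ?_⟩
  intro ι _ μ _ v hμ hv b A hA hb hF
  classical
  have hbd : ∀ i, |b i i| ≤ 1 / A := fun i => by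
    have := hb (Pi.single i 1) (Pi.single i 1)
    have e : ∑ i', ∑ j', b i' j' * (Pi.single i (1:ℝ) : ι → ℝ) i' * (Pi.single i (1:ℝ) : ι → ℝ) j'
        = b i i := by
      rw [Finset.sum_eq_single i, Finset.sum_eq_single i] <;> simp +contextual [Pi.single_apply]
    have e2 : ∑ i', (Pi.single i (1:ℝ) : ι → ℝ) i' ^ 2 = 1 := by
      rw [Finset.sum_eq_single i] <;> simp +contextual
    rw [e, e2, mul_one, mul_one] at this
    exact abs_le_of_sq_le_sq this (by positivity)
  have hF0 : 0 ≤ ∑ i, ∑ j, b i j ^ 2 := by positivity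
  have hFd : ∑ i, b i i ^ 2 ≤ ∑ i, ∑ j, b i j ^ 2 :=
    Finset.sum_le_sum fun i _ =>
      Finset.single_le_sum (f := fun j => b i j ^ 2) (fun j _ => sq_nonneg _) (Finset.mem_univ i)
  set off : (ι → ℝ) → ℝ := fun x => ∑ i, ∑ j, if i = j then 0 else b i j * x i * x j with hoff
  set dg : (ι → ℝ) → ℝ := fun x => ∑ i, b i i * (x i ^ 2 - v i) with hdg
  have hsplit : ∀ x : ι → ℝ, ∑ i, ∑ j, b i j * x i * x j - ∑ i, b i i * v i = off x + dg x := by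
    intro x
    have h1 : ∀ i, ∑ j, b i j * x i * x j =
        (∑ j, if i = j then 0 else b i j * x i * x j) + b i i * x i ^ 2 := fun i => by
      rw [← Finset.add_sum_erase _ _ (Finset.mem_univ i),
        ← Finset.add_sum_erase Finset.univ (fun j => if i = j then 0 else b i j * x i * x j)
          (Finset.mem_univ i)]
      simp only [if_true, zero_add]
      rw [add_comm]
      congr 1
      · refine Finset.sum_congr rfl fun j hj => ?_
        rw [if_neg (Finset.ne_of_mem_erase hj).symm]
      · ring
    simp only [hoff, hdg, h1, mul_sub, Finset.sum_add_distrib, Finset.sum_sub_distrib]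
    ring
  have hoffm : Measurable off := by
    simp only [hoff]
    refine Finset.measurable_sum _ fun i _ => Finset.measurable_sum _ fun j _ => ?_
    by_cases h : i = j <;> simp only [h, if_true, if_false] <;> fun_prop
  have hdgm : Measurable dg := by fun_prop
  have hAinv : q * A * (1 / A) = q := by field_simp
  have hoffE : ∀ s : ℝ, s ^ 2 = (q * A) ^ 2 →
      ∫⁻ x, expE (s * off x) ∂Measure.pi μ ≤ expE (q * A * (t / 4)) := by
    intro s hs
    refine (lintegral_expE_offDiag_le hL.le hμ b (by positivity) hb ?_).trans (expE_le_expE ?_)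
    · rw [hs]
      calc 128 * L ^ 2 * (q * A) ^ 2 * (1 / A) ^ 2
          = 128 * L ^ 2 * (q * A * (1 / A)) ^ 2 := by ring
        _ ≤ 1 := by rw [hAinv]; exact hq1
    · rw [hs]
      calc 64 * L ^ 2 * (q * A) ^ 2 * ∑ i, ∑ j, b i j ^ 2
          ≤ 64 * L ^ 2 * (q * A) ^ 2 * (B / A) := by gcongr
        _ = q * A * (256 * L ^ 2 * B * q) / 4 := by field_simp; ring
        _ ≤ q * A * t / 4 := by gcongr
        _ = _ := by ring
  have hdgE : ∀ s : ℝ, |s| = q * A →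
      ∫⁻ x, expE (s * dg x) ∂Measure.pi μ ≤ expE (q * A * (t / 4)) := by
    intro s hs
    have e : ∀ x : ι → ℝ, s * dg x = ∑ i, s * b i i * (x i ^ 2 - v i) := fun x => by
      simp only [hdg, Finset.mul_sum, mul_assoc]
    simp_rw [e]
    refine (lintegral_pi_expE_sum_le μ (f := fun i y => s * b i i * (y ^ 2 - v i))
      (fun i => by fun_prop) (b := fun i => L * (s * b i i) ^ 2) fun i => hv i _ ?_).trans
      (expE_le_expE ?_)
    · rw [abs_mul, hs]
      calc q * A * |b i i| * L ≤ q * A * (1 / A) * L := by gcongr; exact hbd i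
        _ ≤ 1 := by rw [hAinv]; exact hq2
    · calc ∑ i, L * (s * b i i) ^ 2 = L * |s| ^ 2 * ∑ i, b i i ^ 2 := by
            rw [sq_abs, Finset.mul_sum]
            exact Finset.sum_congr rfl fun i _ => by ring
        _ ≤ L * (q * A) ^ 2 * (B / A) := by rw [hs]; gcongr; exact hFd.trans hF
        _ = q * A * (4 * L * B * q) / 4 := by field_simp
        _ ≤ q * A * t / 4 := by gcongr
        _ = _ := by ring
  have hqA : 0 < q * A := by positivity
  have tail : ∀ f : (ι → ℝ) → ℝ, Measurable f →
      ∫⁻ x, expE (q * A * f x) ∂Measure.pi μ ≤ expE (q * A * (t / 4)) →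
      Measure.pi μ {x | t / 2 ≤ f x} ≤ expE (-(q * t / 4 * A)) := fun f hf h => by
    refine (measure_le_expE_of_lintegral_le hf hqA h).trans (expE_le_expE ?_)
    linarith
  have hsub : {x | t ≤ |∑ i, ∑ j, b i j * x i * x j - ∑ i, b i i * v i|} ⊆
      ({x | t / 2 ≤ off x} ∪ {x | t / 2 ≤ -off x}) ∪
        ({x | t / 2 ≤ dg x} ∪ {x | t / 2 ≤ -dg x}) := by
    intro x hx
    simp only [Set.mem_ofPred_eq, hsplit] at hx
    simp only [Set.mem_union, Set.mem_ofPred_eq]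
    by_contra! h
    have : |off x + dg x| < t := abs_lt.2 ⟨by linarith, by linarith⟩
    linarith
  refine (measure_mono hsub).trans ((measure_union_le _ _).trans ?_)
  have h1 := tail off hoffm (hoffE _ rfl)
  have h2 := tail (fun x => -off x) hoffm.neg (by
    simpa only [mul_neg, neg_mul] using hoffE (-(q * A)) (by ring))
  have h3 := tail dg hdgm (hdgE _ (abs_of_pos hqA))
  have h4 := tail (fun x => -dg x) hdgm.neg (by
    simpa only [mul_neg, neg_mul] using hdgE (-(q * A)) (by rw [abs_neg, abs_of_pos hqA]))
  calc _ ≤ (expE (-(q * t / 4 * A)) + expE (-(q * t / 4 * A))) +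
        (expE (-(q * t / 4 * A)) + expE (-(q * t / 4 * A))) :=
        add_le_add ((measure_union_le _ _).trans (add_le_add h1 h2))
          ((measure_union_le _ _).trans (add_le_add h3 h4))
    _ = _ := by ring

end HansonWright

/-! ### The resolvent of a Hermitian matrix -/

section Resolvent

variable {n : Type*} [Fintype n]

lemma star_dotProduct_self_eq (v : n → ℂ) : star v ⬝ᵥ v = ((∑ i, ‖v i‖ ^ 2 : ℝ) : ℂ) := by
  simp [dotProduct, Complex.conj_mul', Complex.ofReal_sum]

lemma star_dotProduct_conjTranspose_mulVec (M : Matrix n n ℂ) (a : n → ℂ) :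
    star a ⬝ᵥ (M.conjTranspose.mulVec a) = star (star a ⬝ᵥ (M.mulVec a)) := by
  rw [Matrix.dotProduct_mulVec, ← Matrix.star_mulVec, Matrix.star_dotProduct]

lemma norm_dotProduct_sq_le (v w : n → ℂ) :
    ‖v ⬝ᵥ w‖ ^ 2 ≤ (∑ i, ‖v i‖ ^ 2) * ∑ i, ‖w i‖ ^ 2 := by
  have h1 : ‖v ⬝ᵥ w‖ ≤ ∑ i, ‖v i‖ * ‖w i‖ :=
    (norm_sum_le _ _).trans (le_of_eq (Finset.sum_congr rfl fun i _ => norm_mul _ _))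
  exact (pow_le_pow_left₀ (norm_nonneg _) h1 2).trans (Finset.sum_mul_sq_le_sq_mul_sq _ _ _)

variable [DecidableEq n]

/-- The resolvent `(A - z)⁻¹`. The inverse is a genuine one when `A` is hermitian and `z` is in the
upper half plane, by `det_sub_smul_ne_zero`. -/
noncomputable def resolv (A : Matrix n n ℂ) (z : ℂ) : Matrix n n ℂ := (A - z • 1)⁻¹

lemma det_sub_smul_ne_zero {A : Matrix n n ℂ} (hA : A.IsHermitian) {z : ℂ} (hz : 0 < z.im) :
    (A - z • 1).det ≠ 0 := by
  intro h
  have h1 : A.charpoly.eval z = 0 := by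
    rw [Matrix.eval_charpoly, ← neg_sub, Matrix.det_neg, Matrix.scalar_apply,
      ← Matrix.smul_one_eq_diagonal, h, mul_zero]
  rw [hA.charpoly_eq, Polynomial.eval_prod, Finset.prod_eq_zero_iff] at h1
  obtain ⟨i, -, hi⟩ := h1
  simp only [Polynomial.eval_sub, Polynomial.eval_X, Polynomial.eval_C, sub_eq_zero] at hi
  rw [hi] at hz
  simp at hz

lemma sub_mul_resolv {A : Matrix n n ℂ} (hA : A.IsHermitian) {z : ℂ} (hz : 0 < z.im) :
    (A - z • 1) * resolv A z = 1 :=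
  Matrix.mul_nonsing_inv _ (isUnit_iff_ne_zero.2 (det_sub_smul_ne_zero hA hz))

lemma resolv_mul_sub {A : Matrix n n ℂ} (hA : A.IsHermitian) {z : ℂ} (hz : 0 < z.im) :
    resolv A z * (A - z • 1) = 1 :=
  Matrix.nonsing_inv_mul _ (isUnit_iff_ne_zero.2 (det_sub_smul_ne_zero hA hz))

lemma resolv_eq_of_sub_mul_eq_one {A : Matrix n n ℂ} {z : ℂ} {X : Matrix n n ℂ}
    (h : (A - z • 1) * X = 1) : resolv A z = X :=
  Matrix.inv_eq_right_inv h

/-- The resolvent identity for `z` and its conjugate, from which the Ward identities follow. -/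
lemma resolv_sub_conjTranspose {A : Matrix n n ℂ} (hA : A.IsHermitian) {z : ℂ} (hz : 0 < z.im) :
    resolv A z - (resolv A z).conjTranspose =
      (2 * z.im * Complex.I) • ((resolv A z).conjTranspose * resolv A z) := by
  have hc : (resolv A z).conjTranspose * (A - (star z) • 1) = 1 := by
    have := congrArg Matrix.conjTranspose (sub_mul_resolv hA hz)
    simpa [hA.eq] using this
  have e : (2 * z.im * Complex.I : ℂ) = z - star z := by
    rw [Complex.star_def, Complex.sub_conj]; push_cast; ring
  calc resolv A z - (resolv A z).conjTranspose
      = (resolv A z).conjTranspose * (A - (star z) • 1) * resolv A z -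
        (resolv A z).conjTranspose * ((A - z • 1) * resolv A z) := by
        rw [hc, sub_mul_resolv hA hz, one_mul, mul_one]
    _ = (resolv A z).conjTranspose * ((z - star z) • 1) * resolv A z := by
        rw [← mul_assoc, ← sub_mul, ← mul_sub, sub_smul]; congr 2; abel
    _ = _ := by rw [e]; simp

lemma resolv_sub_conjTranspose' {A : Matrix n n ℂ} (hA : A.IsHermitian) {z : ℂ} (hz : 0 < z.im) :
    resolv A z - (resolv A z).conjTranspose =
      (2 * z.im * Complex.I) • (resolv A z * (resolv A z).conjTranspose) := by
  have hc : (A - (star z) • 1) * (resolv A z).conjTranspose = 1 := by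
    have := congrArg Matrix.conjTranspose (resolv_mul_sub hA hz)
    simpa [hA.eq] using this
  have e : (2 * z.im * Complex.I : ℂ) = z - star z := by
    rw [Complex.star_def, Complex.sub_conj]; push_cast; ring
  calc resolv A z - (resolv A z).conjTranspose
      = resolv A z * ((A - (star z) • 1) * (resolv A z).conjTranspose) -
        resolv A z * (A - z • 1) * (resolv A z).conjTranspose := by
        rw [hc, resolv_mul_sub hA hz, one_mul, mul_one]
    _ = resolv A z * ((z - star z) • 1) * (resolv A z).conjTranspose := by
        rw [← mul_assoc, ← sub_mul, ← mul_sub, sub_smul]; congr 2; abel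
    _ = _ := by rw [e]; simp

/-- **Ward identity** for the quadratic form of the resolvent. -/
lemma im_mul_sum_norm_sq_mulVec_resolv {A : Matrix n n ℂ} (hA : A.IsHermitian) {z : ℂ}
    (hz : 0 < z.im) (a : n → ℂ) :
    z.im * ∑ i, ‖((resolv A z).mulVec a) i‖ ^ 2 = (star a ⬝ᵥ (resolv A z).mulVec a).im := by
  have h := congrArg (fun M : Matrix n n ℂ => star a ⬝ᵥ (M.mulVec a))
    (resolv_sub_conjTranspose hA hz)
  have e1 : star a ⬝ᵥ ((resolv A z).conjTranspose * resolv A z).mulVec a =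
      ((∑ i, ‖((resolv A z).mulVec a) i‖ ^ 2 : ℝ) : ℂ) := by
    rw [← Matrix.mulVec_mulVec, Matrix.dotProduct_mulVec, ← Matrix.star_mulVec,
      star_dotProduct_self_eq]
  simp only [Matrix.sub_mulVec, dotProduct_sub, star_dotProduct_conjTranspose_mulVec,
    Matrix.smul_mulVec, dotProduct_smul, e1] at h
  generalize ∑ i, ‖((resolv A z).mulVec a) i‖ ^ 2 = r at h ⊢
  have := congrArg Complex.im h
  simp [Complex.mul_re] at this
  linarith

lemma im_mul_sum_norm_sq_vecMul_resolv {A : Matrix n n ℂ} (hA : A.IsHermitian) {z : ℂ}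
    (hz : 0 < z.im) (a : n → ℂ) :
    z.im * ∑ i, ‖(Matrix.vecMul (star a) (resolv A z)) i‖ ^ 2 =
      (star a ⬝ᵥ (resolv A z).mulVec a).im := by
  have h := congrArg (fun M : Matrix n n ℂ => star a ⬝ᵥ (M.mulVec a))
    (resolv_sub_conjTranspose' hA hz)
  have e : (resolv A z).conjTranspose.mulVec a = star (Matrix.vecMul (star a) (resolv A z)) := by
    rw [Matrix.star_vecMul, star_star]
  have e1 : star a ⬝ᵥ (resolv A z * (resolv A z).conjTranspose).mulVec a =
      ((∑ i, ‖(Matrix.vecMul (star a) (resolv A z)) i‖ ^ 2 : ℝ) : ℂ) := by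
    rw [← Matrix.mulVec_mulVec, Matrix.dotProduct_mulVec, e, dotProduct_comm,
      star_dotProduct_self_eq]
  simp only [Matrix.sub_mulVec, dotProduct_sub, star_dotProduct_conjTranspose_mulVec,
    Matrix.smul_mulVec, dotProduct_smul, e1] at h
  generalize ∑ i, ‖(Matrix.vecMul (star a) (resolv A z)) i‖ ^ 2 = r at h ⊢
  have := congrArg Complex.im h
  simp [Complex.mul_re] at this
  linarith

/-- The operator norm of the resolvent is at most `1 / Im z`. -/
lemma sum_norm_sq_mulVec_resolv_le {A : Matrix n n ℂ} (hA : A.IsHermitian) {z : ℂ}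
    (hz : 0 < z.im) (a : n → ℂ) :
    ∑ i, ‖((resolv A z).mulVec a) i‖ ^ 2 ≤ (1 / z.im) ^ 2 * ∑ i, ‖a i‖ ^ 2 := by
  set w := ∑ i, ‖((resolv A z).mulVec a) i‖ ^ 2 with hw
  have hw0 : 0 ≤ w := by positivity
  have h1 := im_mul_sum_norm_sq_mulVec_resolv hA hz a
  have h2 := norm_dotProduct_sq_le (star a) ((resolv A z).mulVec a)
  simp only [Pi.star_apply, norm_star] at h2
  have h3 : (z.im * w) ^ 2 ≤ (∑ i, ‖a i‖ ^ 2) * w := by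
    rw [h1]
    refine le_trans ?_ h2
    rw [← sq_abs]
    exact pow_le_pow_left₀ (abs_nonneg _) (Complex.abs_im_le_norm _) 2
  rcases hw0.eq_or_lt with h0 | h0
  · rw [← h0]; positivity
  · have h4 : z.im ^ 2 * w ≤ ∑ i, ‖a i‖ ^ 2 :=
      le_of_mul_le_mul_right (by nlinarith) h0
    rw [one_div, inv_pow, ← div_eq_inv_mul, le_div_iff₀ (by positivity)]
    linarith

/-- Operator norm bound for the resolvent in bilinear form. -/
lemma norm_star_dotProduct_resolv_sq_le {A : Matrix n n ℂ} (hA : A.IsHermitian) {z : ℂ}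
    (hz : 0 < z.im) (a b : n → ℂ) :
    ‖star a ⬝ᵥ (resolv A z).mulVec b‖ ^ 2 ≤
      (1 / z.im) ^ 2 * (∑ i, ‖a i‖ ^ 2) * ∑ i, ‖b i‖ ^ 2 := by
  have h2 := norm_dotProduct_sq_le (star a) ((resolv A z).mulVec b)
  simp only [Pi.star_apply, norm_star] at h2
  refine h2.trans ?_
  calc _ ≤ (∑ i, ‖a i‖ ^ 2) * ((1 / z.im) ^ 2 * ∑ i, ‖b i‖ ^ 2) := by
        gcongr; exact sum_norm_sq_mulVec_resolv_le hA hz b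
    _ = _ := by ring

lemma im_mul_sum_norm_sq_col {A : Matrix n n ℂ} (hA : A.IsHermitian) {z : ℂ}
    (hz : 0 < z.im) (k : n) :
    z.im * ∑ i, ‖resolv A z i k‖ ^ 2 = (resolv A z k k).im := by
  have := im_mul_sum_norm_sq_mulVec_resolv hA hz (Pi.single k 1)
  simpa [Matrix.mulVec_single_one, ← Pi.single_star] using this

lemma im_mul_sum_norm_sq_row {A : Matrix n n ℂ} (hA : A.IsHermitian) {z : ℂ}
    (hz : 0 < z.im) (k : n) :
    z.im * ∑ i, ‖resolv A z k i‖ ^ 2 = (resolv A z k k).im := by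
  have := im_mul_sum_norm_sq_vecMul_resolv hA hz (Pi.single k 1)
  simpa [Matrix.mulVec_single_one, ← Pi.single_star] using this

lemma im_resolv_diag_nonneg {A : Matrix n n ℂ} (hA : A.IsHermitian) {z : ℂ}
    (hz : 0 < z.im) (k : n) : 0 ≤ (resolv A z k k).im := by
  rw [← im_mul_sum_norm_sq_col hA hz]; positivity

/-- The Hilbert–Schmidt norm of the resolvent. -/
lemma im_mul_sum_sum_norm_sq_resolv {A : Matrix n n ℂ} (hA : A.IsHermitian) {z : ℂ}
    (hz : 0 < z.im) :
    z.im * ∑ i, ∑ j, ‖resolv A z i j‖ ^ 2 = (resolv A z).trace.im := by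
  rw [Finset.mul_sum, Matrix.trace, Complex.im_sum]
  exact Finset.sum_congr rfl fun i _ => im_mul_sum_norm_sq_row hA hz i

lemma norm_resolv_diag_le {A : Matrix n n ℂ} (hA : A.IsHermitian) {z : ℂ}
    (hz : 0 < z.im) (k : n) : ‖resolv A z k k‖ ≤ 1 / z.im := by
  have h1 := im_mul_sum_norm_sq_col hA hz k
  have h2 : ‖resolv A z k k‖ ^ 2 ≤ ∑ i, ‖resolv A z i k‖ ^ 2 :=
    Finset.single_le_sum (f := fun i => ‖resolv A z i k‖ ^ 2) (fun i _ => sq_nonneg _)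
      (Finset.mem_univ k)
  have h3 := (le_abs_self _).trans (Complex.abs_im_le_norm (resolv A z k k))
  rw [le_div_iff₀ hz]
  rcases (norm_nonneg (resolv A z k k)).eq_or_lt with h0 | h0
  · rw [← h0]; simp
  · have : z.im * ‖resolv A z k k‖ ^ 2 ≤ ‖resolv A z k k‖ :=
      (mul_le_mul_of_nonneg_left h2 hz.le).trans (h1.le.trans h3)
    exact le_of_mul_le_mul_right (by linarith) h0

lemma resolv_sub_resolv {A : Matrix n n ℂ} (hA : A.IsHermitian) {z w : ℂ} (hz : 0 < z.im)
    (hw : 0 < w.im) : resolv A z - resolv A w = (z - w) • (resolv A z * resolv A w) := by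
  calc resolv A z - resolv A w
      = resolv A z * ((A - w • 1) * resolv A w) - resolv A z * (A - z • 1) * resolv A w := by
        rw [sub_mul_resolv hA hw, resolv_mul_sub hA hz, one_mul, mul_one]
    _ = resolv A z * ((z - w) • 1) * resolv A w := by
        rw [← mul_assoc, ← sub_mul, ← mul_sub, sub_smul]; congr 2; abel
    _ = _ := by simp

/-- Halving the imaginary part of the spectral parameter changes a diagonal entry of the resolvent
by a controlled amount. -/
lemma norm_resolv_diag_sub_le {A : Matrix n n ℂ} (hA : A.IsHermitian) {E η : ℝ} (hη : 0 < η)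
    (k : n) :
    ‖resolv A ⟨E, η⟩ k k - resolv A ⟨E, 2 * η⟩ k k‖ ≤
      (resolv A ⟨E, η⟩ k k).im / 2 + (resolv A ⟨E, 2 * η⟩ k k).im / 4 := by
  have hz : 0 < (⟨E, η⟩ : ℂ).im := hη
  have hw : 0 < (⟨E, 2 * η⟩ : ℂ).im := by simpa using hη
  set z : ℂ := ⟨E, η⟩
  set w : ℂ := ⟨E, 2 * η⟩
  have h := congrFun (congrFun (resolv_sub_resolv hA hz hw) k) k
  rw [Matrix.sub_apply, Matrix.smul_apply, smul_eq_mul] at h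
  have h1 := im_mul_sum_norm_sq_row hA hz k
  have h2 := im_mul_sum_norm_sq_col hA hw k
  have h3 := norm_dotProduct_sq_le (fun l => resolv A z k l) (fun l => resolv A w l k)
  have h4 : ‖z - w‖ = η := by
    have : z - w = -(η * Complex.I) := by
      apply Complex.ext <;> simp [z, w]
      ring
    rw [this, norm_neg, norm_mul, Complex.norm_I, mul_one, Complex.norm_real, Real.norm_eq_abs,
      abs_of_pos hη]
  rw [h, norm_mul, h4]
  have e : (resolv A z * resolv A w) k k = (fun l => resolv A z k l) ⬝ᵥ fun l => resolv A w l k :=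
    rfl
  rw [e, ← h1, ← h2]
  have hz' : z.im = η := rfl
  have hw' : w.im = 2 * η := rfl
  rw [hz', hw']
  set p := ∑ l, ‖resolv A z k l‖ ^ 2
  set q := ∑ l, ‖resolv A w l k‖ ^ 2
  have hp : 0 ≤ p := by positivity
  have hq : 0 ≤ q := by positivity
  have : ‖(fun l => resolv A z k l) ⬝ᵥ fun l => resolv A w l k‖ ≤ p / 2 + q / 2 := by
    refine abs_le_of_sq_le_sq' (h3.trans ?_) (by positivity) |>.2
    nlinarith [sq_nonneg (p - q)]
  nlinarith

end Resolvent

/-! ### Schur's complement formula -/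

section Schur

variable {n : Type*} [DecidableEq n]

/-- The matrix `A` with its row and column of index `k` replaced by zero. It plays the role of the
minor of `A`, without a change of index type. -/
def zeroOut (A : Matrix n n ℂ) (k : n) : Matrix n n ℂ :=
  Matrix.of fun i j => if i = k ∨ j = k then 0 else A i j

/-- The column of index `k` of `A`, with its diagonal entry replaced by zero. -/
def offDiagCol (A : Matrix n n ℂ) (k : n) : n → ℂ := fun i => if i = k then 0 else A i k

lemma isHermitian_zeroOut {A : Matrix n n ℂ} (hA : A.IsHermitian) (k : n) :
    (zeroOut A k).IsHermitian := by
  ext i j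
  simp only [zeroOut, Matrix.conjTranspose_apply, Matrix.of_apply]
  by_cases h1 : i = k <;> by_cases h2 : j = k <;> simp [h1, h2]
  simpa using hA.apply i j

lemma sub_zeroOut_row (A : Matrix n n ℂ) (z : ℂ) (k j : n) :
    (zeroOut A k - z • 1) k j = if k = j then -z else 0 := by
  by_cases h : k = j <;> simp [zeroOut, h]

lemma sub_zeroOut_col (A : Matrix n n ℂ) (z : ℂ) (k i : n) :
    (zeroOut A k - z • 1) i k = if i = k then -z else 0 := by
  by_cases h : i = k <;> simp [zeroOut, h]

variable [Fintype n]

lemma resolv_zeroOut_row {A : Matrix n n ℂ} (hA : A.IsHermitian) {z : ℂ} (hz : 0 < z.im)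
    (k j : n) : resolv (zeroOut A k) z k j = if k = j then -1 / z else 0 := by
  have hz0 : z ≠ 0 := by rintro rfl; simp at hz
  have h := congrFun (congrFun (sub_mul_resolv (isHermitian_zeroOut hA k) hz) k) j
  rw [Matrix.mul_apply] at h
  simp only [sub_zeroOut_row, ite_mul, zero_mul, Finset.sum_ite_eq, Finset.mem_univ, if_true,
    Matrix.one_apply] at h
  by_cases hkj : k = j
  · simp only [hkj, if_true] at h ⊢
    rw [eq_div_iff hz0]; linear_combination -h
  · simp only [hkj, if_false] at h ⊢
    simpa [hz0] using h

lemma resolv_zeroOut_col {A : Matrix n n ℂ} (hA : A.IsHermitian) {z : ℂ} (hz : 0 < z.im)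
    (k i : n) : resolv (zeroOut A k) z i k = if i = k then -1 / z else 0 := by
  have hz0 : z ≠ 0 := by rintro rfl; simp at hz
  have h := congrFun (congrFun (resolv_mul_sub (isHermitian_zeroOut hA k) hz) i) k
  rw [Matrix.mul_apply] at h
  simp only [sub_zeroOut_col, mul_ite, mul_zero, Finset.sum_ite_eq', Finset.mem_univ, if_true,
    Matrix.one_apply] at h
  by_cases hik : i = k
  · simp only [hik, if_true] at h ⊢
    rw [eq_div_iff hz0]; linear_combination -h
  · simp only [hik, if_false] at h ⊢
    simpa [hz0] using h

/-- The quadratic form of the resolvent of the minor in the off-diagonal column. -/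
noncomputable def schurForm (A : Matrix n n ℂ) (z : ℂ) (k : n) : ℂ :=
  star (offDiagCol A k) ⬝ᵥ (resolv (zeroOut A k) z).mulVec (offDiagCol A k)

/-- The vector `e_k - (Â - z)⁻¹ a`, proportional to the column of index `k` of the resolvent. -/
noncomputable def schurCol (A : Matrix n n ℂ) (z : ℂ) (k : n) : n → ℂ :=
  Pi.single k 1 - (resolv (zeroOut A k) z).mulVec (offDiagCol A k)

/-- The row vector `e_k - a* (Â - z)⁻¹`, proportional to the row of index `k` of the resolvent. -/
noncomputable def schurRow (A : Matrix n n ℂ) (z : ℂ) (k : n) : n → ℂ :=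
  Pi.single k 1 - Matrix.vecMul (star (offDiagCol A k)) (resolv (zeroOut A k) z)

lemma mulVec_resolv_zeroOut_self {A : Matrix n n ℂ} (hA : A.IsHermitian) {z : ℂ} (hz : 0 < z.im)
    (k : n) : (resolv (zeroOut A k) z).mulVec (offDiagCol A k) k = 0 := by
  rw [Matrix.mulVec, dotProduct]
  refine Finset.sum_eq_zero fun j _ => ?_
  rw [resolv_zeroOut_row hA hz]
  by_cases h : k = j <;> simp [h, offDiagCol]

lemma vecMul_resolv_zeroOut_self {A : Matrix n n ℂ} (hA : A.IsHermitian) {z : ℂ} (hz : 0 < z.im)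
    (k : n) : Matrix.vecMul (star (offDiagCol A k)) (resolv (zeroOut A k) z) k = 0 := by
  rw [Matrix.vecMul, dotProduct]
  refine Finset.sum_eq_zero fun j _ => ?_
  rw [resolv_zeroOut_col hA hz]
  by_cases h : j = k <;> simp [h, offDiagCol]

/-- Off the row `k`, the matrix `A` acts on vectors vanishing at `k` as the minor. -/
lemma sub_mulVec_apply_of_ne (A : Matrix n n ℂ) (z : ℂ) {k i : n} (hik : i ≠ k) {y : n → ℂ}
    (hy : y k = 0) : (A - z • 1).mulVec y i = (zeroOut A k - z • 1).mulVec y i := by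
  rw [Matrix.mulVec, Matrix.mulVec, dotProduct, dotProduct]
  refine Finset.sum_congr rfl fun j _ => ?_
  by_cases hj : j = k
  · rw [hj, hy]; simp
  · simp [zeroOut, hik, hj]

/-- The row `k` of `A` acts on vectors vanishing at `k` as the off-diagonal column. -/
lemma sub_mulVec_apply_self {A : Matrix n n ℂ} (hA : A.IsHermitian) (z : ℂ) {k : n} {y : n → ℂ}
    (hy : y k = 0) : (A - z • 1).mulVec y k = star (offDiagCol A k) ⬝ᵥ y := by
  rw [Matrix.mulVec, dotProduct, dotProduct]
  refine Finset.sum_congr rfl fun j _ => ?_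
  by_cases hj : j = k
  · rw [hj, hy]; simp
  · have : A k j = star (A j k) := (hA.apply k j).symm
    simp [offDiagCol, hj, this, Ne.symm hj]

lemma sub_mulVec_schurCol {A : Matrix n n ℂ} (hA : A.IsHermitian) {z : ℂ} (hz : 0 < z.im)
    (k : n) : (A - z • 1).mulVec (schurCol A z k) = Pi.single k (A k k - z - schurForm A z k) := by
  have h0 := mulVec_resolv_zeroOut_self hA hz k
  ext i
  rw [schurCol, Matrix.mulVec_sub, Pi.sub_apply, Matrix.mulVec_single_one, Matrix.col_apply]
  by_cases hi : i = k
  · subst hi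
    rw [sub_mulVec_apply_self hA z h0]
    simp [schurForm]
  · rw [sub_mulVec_apply_of_ne A z hi h0, Matrix.mulVec_mulVec,
      sub_mul_resolv (isHermitian_zeroOut hA k) hz]
    simp [offDiagCol, hi]

/-- Schur's complement formula for the diagonal entries of the resolvent. -/
lemma resolv_diag_mul_schur {A : Matrix n n ℂ} (hA : A.IsHermitian) {z : ℂ} (hz : 0 < z.im)
    (k : n) : resolv A z k k * (A k k - z - schurForm A z k) = 1 := by
  have h := congrArg (fun v => (resolv A z).mulVec v k) (sub_mulVec_schurCol hA hz k)
  simp only [Matrix.mulVec_mulVec, resolv_mul_sub hA hz, Matrix.one_mulVec] at h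
  rw [schurCol, Pi.sub_apply, mulVec_resolv_zeroOut_self hA hz] at h
  simpa [Matrix.mulVec_single, mul_comm] using h.symm

/-- The resolvent is a rank one perturbation of the resolvent of the minor. -/
lemma resolv_apply_eq_add_schur {A : Matrix n n ℂ} (hA : A.IsHermitian) {z : ℂ} (hz : 0 < z.im)
    (k i j : n) :
    resolv A z i j = (if j = k then 0 else resolv (zeroOut A k) z i j) +
      resolv A z k k * schurCol A z k i * schurRow A z k j := by
  set X : Matrix n n ℂ := Matrix.of fun i j => (if j = k then 0 else resolv (zeroOut A k) z i j) +
      resolv A z k k * schurCol A z k i * schurRow A z k j with hX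
  have key : (A - z • 1) * X = 1 := by
    ext i j
    set y : n → ℂ := fun l => if j = k then 0 else resolv (zeroOut A k) z l j with hy
    have hcol : (fun l => X l j) = y + (resolv A z k k * schurRow A z k j) • schurCol A z k := by
      ext l
      simp only [hX, hy, Matrix.of_apply, Pi.add_apply, Pi.smul_apply, smul_eq_mul]
      ring
    have h1 : ((A - z • 1) * X) i j = (A - z • 1).mulVec (fun l => X l j) i := rfl
    rw [h1, hcol, Matrix.mulVec_add, Matrix.mulVec_smul, sub_mulVec_schurCol hA hz, Pi.add_apply,
      Pi.smul_apply, smul_eq_mul]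
    have hs := resolv_diag_mul_schur hA hz k
    have hyk : y k = 0 := by
      simp only [hy]
      by_cases hj : j = k
      · simp [hj]
      · rw [if_neg hj, resolv_zeroOut_row hA hz, if_neg (Ne.symm hj)]
    have hw : schurRow A z k j = if j = k then 1 else
        -(star (offDiagCol A k) ⬝ᵥ fun l => resolv (zeroOut A k) z l j) := by
      rw [schurRow, Pi.sub_apply]
      by_cases hj : j = k
      · rw [hj, vecMul_resolv_zeroOut_self hA hz]; simp
      · simp [hj, Matrix.vecMul]
    by_cases hi : i = k
    · subst hi
      rw [sub_mulVec_apply_self hA z hyk, Pi.single_eq_same]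
      rw [mul_right_comm, hs, one_mul, hw]
      by_cases hj : j = i
      · subst hj; simp [hy, dotProduct]
      · simp [hy, hj, Ne.symm hj]
    · rw [sub_mulVec_apply_of_ne A z hi hyk, Pi.single_eq_of_ne hi, mul_zero, add_zero]
      by_cases hj : j = k
      · have : y = 0 := by ext l; simp [hy, hj]
        rw [this, hj]; simp [hi]
      · have : y = fun l => resolv (zeroOut A k) z l j := by ext l; simp [hy, hj]
        rw [this]
        exact congrFun (congrFun (sub_mul_resolv (isHermitian_zeroOut hA k) hz) i) j
  exact congrFun (congrFun (resolv_eq_of_sub_mul_eq_one key) i) j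

/-- Removing a row and a column changes the trace of the resolvent by at most `1 / Im z`. -/
lemma norm_trace_resolv_sub_le {A : Matrix n n ℂ} (hA : A.IsHermitian) {z : ℂ} (hz : 0 < z.im)
    (k : n) :
    ‖(resolv A z).trace - ∑ i, (if i = k then 0 else resolv (zeroOut A k) z i i)‖ ≤ 1 / z.im := by
  have h1 : (resolv A z).trace - ∑ i, (if i = k then 0 else resolv (zeroOut A k) z i i) =
      resolv A z k k * (schurCol A z k ⬝ᵥ schurRow A z k) := by
    rw [Matrix.trace, dotProduct, Finset.mul_sum, ← Finset.sum_sub_distrib]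
    refine Finset.sum_congr rfl fun i _ => ?_
    rw [Matrix.diag_apply, resolv_apply_eq_add_schur hA hz k i i]; ring
  have hÂ := isHermitian_zeroOut hA k
  -- by the Ward identities, both vectors have squared length `-s.im / z.im`
  set s := A k k - z - schurForm A z k with hs
  have hsim : s.im = -z.im - (schurForm A z k).im := by
    have : (A k k).im = 0 := by
      have := congrArg Complex.im (hA.apply k k)
      simp at this; linarith
    rw [hs, Complex.sub_im, Complex.sub_im, this]; ring
  have hpyth : ∀ y : n → ℂ, y k = 0 → ∑ i, ‖((Pi.single k 1 : n → ℂ) - y) i‖ ^ 2 =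
      1 + ∑ i, ‖y i‖ ^ 2 := by
    intro y hy
    have : ∀ i, ‖((Pi.single k 1 : n → ℂ) - y) i‖ ^ 2 =
        (if i = k then 1 else 0) + ‖y i‖ ^ 2 := by
      intro i
      by_cases hi : i = k
      · subst hi; simp [hy]
      · simp [hi]
    simp_rw [this, Finset.sum_add_distrib]
    simp
  have hv : z.im * ∑ i, ‖schurCol A z k i‖ ^ 2 = -s.im := by
    rw [schurCol, hpyth _ (mulVec_resolv_zeroOut_self hA hz k), mul_add,
      im_mul_sum_norm_sq_mulVec_resolv hÂ hz, hsim, schurForm]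
    ring
  have hw : z.im * ∑ i, ‖schurRow A z k i‖ ^ 2 = -s.im := by
    rw [schurRow, hpyth _ (vecMul_resolv_zeroOut_self hA hz k), mul_add,
      im_mul_sum_norm_sq_vecMul_resolv hÂ hz, hsim, schurForm]
    ring
  have hnorm : ‖resolv A z k k‖ * ‖s‖ = 1 := by
    rw [← norm_mul, resolv_diag_mul_schur hA hz, norm_one]
  have hdot : ‖schurCol A z k ⬝ᵥ schurRow A z k‖ ≤ ‖s‖ / z.im := by
    have h2 := norm_dotProduct_sq_le (schurCol A z k) (schurRow A z k)
    have h3 : -s.im ≤ ‖s‖ := (neg_le_abs _).trans (Complex.abs_im_le_norm s)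
    have hv' : ∑ i, ‖schurCol A z k i‖ ^ 2 ≤ ‖s‖ / z.im := by
      rw [le_div_iff₀ hz]; linarith
    have hw' : ∑ i, ‖schurRow A z k i‖ ^ 2 ≤ ‖s‖ / z.im := by
      rw [le_div_iff₀ hz]; linarith
    refine (abs_le_of_sq_le_sq' (h2.trans ?_) (by positivity)).2
    rw [sq]
    gcongr
  rw [h1, norm_mul]
  calc _ ≤ ‖resolv A z k k‖ * (‖s‖ / z.im) := by gcongr
    _ = _ := by rw [← mul_div_assoc, hnorm]

end Schur

/-! ### Stability of the self-consistent equation -/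

/-- An approximate solution of `m² + z m + 1 = 0` in the closed upper half plane stays away from
the real axis, when the real part of `z` is in the bulk of the spectrum: multiplying the equation by
the conjugate of `m` bounds `|Re m|` by about `(1 - κ / 2) * ‖m‖`. -/
lemma bounds_of_approx_selfConsistent {κ : ℝ} (hκ : 0 < κ) {z m : ℂ} (hre : |z.re| ≤ 2 - κ)
    (him : 0 < z.im) (him2 : z.im ≤ 2) (hm : 0 ≤ m.im) (hR : ‖m ^ 2 + z * m + 1‖ ≤ κ / 40) :
    κ / 30 ≤ m.im ∧ ‖m‖ ≤ 5 := by
  have hκ2 : κ ≤ 2 := by linarith [abs_nonneg z.re]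
  set R := m ^ 2 + z * m + 1 with hRdef
  set r := ‖m‖ with hr
  have hr0 : 0 ≤ r := norm_nonneg _
  have hz : ‖z‖ ≤ 4 := (Complex.norm_le_abs_re_add_abs_im z).trans (by
    rw [abs_of_pos him]; linarith)
  have hzm : ‖z * m‖ ≤ 4 * r := by rw [norm_mul]; gcongr
  have hr5 : r ≤ 5 := by
    have : r ^ 2 ≤ ‖R‖ + ‖z * m‖ + 1 := by
      have e : m ^ 2 = R - z * m - 1 := by rw [hRdef]; ring
      rw [hr, ← norm_pow, e]
      refine (norm_sub_le _ _).trans ?_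
      rw [norm_one]; gcongr; exact norm_sub_le _ _
    nlinarith
  have hr1 : 1 / 5 ≤ r := by
    have : 1 ≤ ‖R‖ + r ^ 2 + ‖z * m‖ := by
      have e : (1:ℂ) = R - m ^ 2 - z * m := by rw [hRdef]; ring
      rw [hr, ← norm_pow]
      calc (1:ℝ) = ‖R - m ^ 2 - z * m‖ := by rw [← e, norm_one]
        _ ≤ _ := (norm_sub_le _ _).trans (by gcongr; exact norm_sub_le _ _)
    by_contra! h
    nlinarith
  refine ⟨?_, hr5⟩
  -- multiply the equation by the conjugate of `m` and take real parts
  have hre2 : m.re * (r ^ 2 + 1) = -(z.re * r ^ 2) + (R * star m).re := by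
    have h1 : r ^ 2 = m.re ^ 2 + m.im ^ 2 := by
      rw [hr, Complex.sq_norm, Complex.normSq_apply]; ring
    rw [h1, hRdef]
    simp [sq]
    ring
  have h2 : |(R * star m).re| ≤ κ / 40 * r := by
    refine (Complex.abs_re_le_norm _).trans ?_
    rw [norm_mul, norm_star]; gcongr
  have h3 : |m.re| * (r ^ 2 + 1) ≤ (2 - κ) * r ^ 2 + κ / 40 * r := by
    have : |m.re| * (r ^ 2 + 1) = |m.re * (r ^ 2 + 1)| := by
      rw [abs_mul, abs_of_nonneg (by positivity : 0 ≤ r ^ 2 + 1)]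
    rw [this, hre2]
    refine (abs_add_le _ _).trans (add_le_add ?_ h2)
    rw [abs_neg, abs_mul, abs_of_nonneg (sq_nonneg r)]
    gcongr
  have h4 : r ≤ |m.re| + m.im := by
    have := Complex.norm_le_abs_re_add_abs_im m
    rwa [abs_of_nonneg hm] at this
  have h5 : κ * r ^ 2 - κ / 40 * r ≤ m.im * (r ^ 2 + 1) := by
    nlinarith [mul_nonneg hr0 (sq_nonneg (r - 1)), mul_le_mul_of_nonneg_right h4
      (by positivity : 0 ≤ r ^ 2 + 1)]
  by_contra! h
  have h6 : m.im * (r ^ 2 + 1) ≤ κ / 30 * (r ^ 2 + 1) := by gcongr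
  have h7 : κ * (r ^ 2 - r / 40) ≤ κ * ((r ^ 2 + 1) / 30) := by linarith
  have h8 := le_of_mul_le_mul_left h7 hκ
  nlinarith

lemma le_sqrt_four_sub_sq {κ E : ℝ} (hκ : 0 < κ) (hE : |E| ≤ 2 - κ) :
    κ ≤ Real.sqrt (4 - E ^ 2) := by
  refine Real.le_sqrt_of_sq_le ?_
  have h1 := abs_le.1 hE
  have h2 : 0 ≤ (2 - κ - E) * (2 - κ + E) := mul_nonneg (by linarith) (by linarith)
  nlinarith [abs_nonneg E]

/-- An approximate solution of `m² + E m + 1 = 0` in the closed upper half plane is close to the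
solution whose imaginary part is `π` times the semicircle density; the other solution is the
conjugate one, and is far away. -/
lemma abs_im_sub_pi_mul_semicircleDensity_le {κ E ρ : ℝ} (hκ : 0 < κ) (hE : |E| ≤ 2 - κ) {m : ℂ}
    (hm : 0 ≤ m.im) (hR : ‖m ^ 2 + E * m + 1‖ ≤ ρ) :
    |m.im - Real.pi * semicircleDensity E| ≤ 2 * ρ / κ := by
  have hs := le_sqrt_four_sub_sq hκ hE
  have h4 : 0 ≤ 4 - E ^ 2 := by
    have := abs_le.1 hE
    nlinarith
  set s := Real.sqrt (4 - E ^ 2) with hsdef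
  have hsq : s ^ 2 = 4 - E ^ 2 := Real.sq_sqrt h4
  have hdens : Real.pi * semicircleDensity E = s / 2 := by
    rw [semicircleDensity, max_eq_left h4, ← hsdef]
    field_simp
  rw [hdens]
  set a : ℂ := ⟨-E / 2, s / 2⟩ with ha
  have hfac : (m - a) * (m - star a) = m ^ 2 + E * m + 1 := by
    have h1 : a + star a = -E := by
      rw [ha]; apply Complex.ext <;> simp
    have h2 : a * star a = 1 := by
      rw [ha]; apply Complex.ext
      · simp; nlinarith
      · simp; ring
    linear_combination (-m) * h1 + h2
  have h1 : κ / 2 ≤ ‖m - star a‖ := by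
    have : (m - star a).im = m.im + s / 2 := by simp [ha]
    have h2 := (le_abs_self _).trans (Complex.abs_im_le_norm (m - star a))
    linarith
  have h2 : |m.im - s / 2| ≤ ‖m - a‖ := by
    have : (m - a).im = m.im - s / 2 := by simp [ha]
    rw [← this]; exact Complex.abs_im_le_norm _
  refine h2.trans ?_
  rw [le_div_iff₀ hκ]
  have h3 : ‖m - a‖ * ‖m - star a‖ ≤ ρ := by rw [← norm_mul, hfac]; exact hR
  nlinarith [mul_le_mul_of_nonneg_left h1 (norm_nonneg (m - a))]

/-- One scale of the bootstrap. Averaging `g_k (z + m + ε_k) = -1`, with errors `ε_k` that are small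
except for the indices in `bad`, yields an approximate self-consistent equation. The contribution of
a bad index `k` is controlled by its weight `T k`. -/
lemma approx_selfConsistent_of_scale {N : ℕ} (hN : 0 < N) {g : Fin N → ℂ} {z : ℂ} {c t C s : ℝ}
    {bad : Fin N → Prop} {T : Fin N → ℝ} (hc : 0 < c) (ht : 0 < t) (htc : 6 * t ≤ c)
    (hC : C = 2 / c) (hz : c ≤ ‖z + (∑ k, g k) / N‖) (hz2 : ‖z + (∑ k, g k) / N‖ ≤ 17)
    (hgood : ∀ k, ¬ bad k → ∃ ε : ℂ, ‖ε‖ ≤ 3 * t ∧ g k * (z + (∑ k, g k) / N + ε) = -1)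
    (hbad : ∀ k, bad k → ‖g k‖ ≤ C * T k ∧ 1 ≤ T k) (hT : ∀ k, 0 ≤ T k)
    (hs : ∑ k, T k ≤ N * s) :
    (∀ k, ¬ bad k → ‖g k‖ ≤ C) ∧
      ‖((∑ k, g k) / N) ^ 2 + z * ((∑ k, g k) / N) + 1‖ ≤ 3 * C * t + (1 + 17 * C) * s := by
  set m := (∑ k, g k) / N with hm
  have hC0 : 0 < C := by rw [hC]; positivity
  have hN0 : (0:ℝ) < N := by exact_mod_cast hN
  have hNc : (N:ℂ) ≠ 0 := by exact_mod_cast hN.ne'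
  have h1 : ∀ k, ¬ bad k → ‖g k‖ ≤ C := by
    intro k hk
    obtain ⟨ε, hε, hg⟩ := hgood k hk
    have h2 : c / 2 ≤ ‖z + m + ε‖ := by
      have : ‖z + m‖ ≤ ‖z + m + ε‖ + ‖ε‖ := by
        have := norm_sub_le (z + m + ε) ε
        rwa [add_sub_cancel_right] at this
      linarith
    have h3 : ‖g k‖ * ‖z + m + ε‖ = 1 := by rw [← norm_mul, hg, norm_neg, norm_one]
    rw [hC, le_div_iff₀ hc]
    nlinarith [mul_le_mul_of_nonneg_left h2 (norm_nonneg (g k))]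
  refine ⟨h1, ?_⟩
  have h2 : ∀ k, ‖g k * (z + m) + 1‖ ≤ 3 * C * t + (1 + 17 * C) * T k := by
    intro k
    by_cases hk : bad k
    · obtain ⟨h3, h4⟩ := hbad k hk
      calc ‖g k * (z + m) + 1‖ ≤ ‖g k‖ * ‖z + m‖ + 1 := by
            refine (norm_add_le _ _).trans ?_
            rw [norm_mul, norm_one]
        _ ≤ (C * T k) * 17 + T k := by gcongr
        _ ≤ _ := by nlinarith [mul_pos hC0 ht]
    · obtain ⟨ε, hε, hg⟩ := hgood k hk
      have e : g k * (z + m) + 1 = -(g k * ε) := by linear_combination hg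
      rw [e, norm_neg, norm_mul]
      calc ‖g k‖ * ‖ε‖ ≤ C * (3 * t) := by gcongr; exact h1 k hk
        _ ≤ _ := by nlinarith [mul_nonneg (by positivity : 0 ≤ 1 + 17 * C) (hT k)]
  have h3 : m ^ 2 + z * m + 1 = (∑ k, (g k * (z + m) + 1)) / N := by
    rw [Finset.sum_add_distrib, ← Finset.sum_mul]
    have : ∑ k, g k = N * m := by rw [hm]; field_simp
    rw [this]; simp; field_simp; ring
  rw [h3, norm_div, Complex.norm_natCast, div_le_iff₀ hN0]
  calc ‖∑ k, (g k * (z + m) + 1)‖ ≤ ∑ k, (3 * C * t + (1 + 17 * C) * T k) :=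
        (norm_sum_le _ _).trans (Finset.sum_le_sum fun k _ => h2 k)
    _ = N * (3 * C * t) + (1 + 17 * C) * ∑ k, T k := by
        rw [Finset.sum_add_distrib, Finset.mul_sum, Finset.sum_const, nsmul_eq_mul]; simp
    _ ≤ N * (3 * C * t) + (1 + 17 * C) * (N * s) := by gcongr
    _ = _ := by ring

open Classical in
/-- The bootstrap over the dyadic scales `2 ^ l * η`, `l ≤ L`, from scale of order one down to `η`.
An index which fails at scale `l` is charged the weight `3 ^ (l + 1)`, which pays for the growth of
its resolvent entry over the scales below the last one where it was good. -/
lemma approx_selfConsistent_of_bootstrap {N : ℕ} (hN : 0 < N) {κ E η t s : ℝ} {L : ℕ}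
    (hκ : 0 < κ) (hE : |E| ≤ 2 - κ) (hη : 0 < η) (hL1 : 1 ≤ 2 ^ L * η) (hL2 : 2 ^ L * η ≤ 2)
    (ht : 0 < t) (htκ : 360 * t ≤ κ)
    (hts : 360 / κ * t + (1 + 4080 / κ) * s ≤ κ / 40)
    {g : Fin N → ℕ → ℂ} {bad : Fin N → ℕ → Prop}
    (hg1 : ∀ k, ‖g k L‖ ≤ 1) (hg2 : ∀ k l, 0 ≤ (g k l).im)
    (hg3 : ∀ k l, ‖g k l - g k (l + 1)‖ ≤ (g k l).im / 2 + (g k (l + 1)).im / 4)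
    (hg4 : ∀ l ≤ L, ((∑ k, g k l) / N).im ≤ 13 → ∀ k, ¬ bad k l →
      ∃ ε : ℂ, ‖ε‖ ≤ 3 * t ∧ g k l * (⟨E, 2 ^ l * η⟩ + (∑ k, g k l) / N + ε) = -1)
    (hs : ∑ k, ∑ l ∈ Finset.range (L + 1), (if bad k l then (3:ℝ) ^ (l + 1) else 0) ≤ N * s) :
    ∀ l ≤ L, ‖((∑ k, g k l) / N) ^ 2 + ⟨E, 2 ^ l * η⟩ * ((∑ k, g k l) / N) + 1‖ ≤
      360 / κ * t + (1 + 4080 / κ) * s := by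
  have hκ2 : κ ≤ 2 := by linarith [abs_nonneg E]
  have hN0 : (0:ℝ) < N := by exact_mod_cast hN
  set m : ℕ → ℂ := fun l => (∑ k, g k l) / N with hm
  set C : ℝ := 2 / (κ / 60) with hC
  have hC120 : C = 120 / κ := by rw [hC]; field_simp; norm_num
  have hC1 : 1 ≤ C := by rw [hC120, le_div_iff₀ hκ]; linarith
  set T : Fin N → ℕ → ℝ := fun k l =>
    ∑ l' ∈ Finset.Ico l (L + 1), (if bad k l' then (3:ℝ) ^ (l' + 1) else 0) with hT
  have hT0 : ∀ k l, 0 ≤ T k l := fun k l =>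
    Finset.sum_nonneg fun l' _ => by split_ifs <;> positivity
  have hTle : ∀ k l, T k l ≤
      ∑ l' ∈ Finset.range (L + 1), (if bad k l' then (3:ℝ) ^ (l' + 1) else 0) := fun k l => by
    refine Finset.sum_le_sum_of_subset_of_nonneg (fun x hx => ?_)
      fun l' _ _ => by split_ifs <;> positivity
    simp only [Finset.mem_Ico, Finset.mem_range] at hx ⊢
    exact hx.2
  have hTsucc : ∀ k l, l ≤ L → bad k l → T k l = 3 ^ (l + 1) + T k (l + 1) := fun k l hl hb => by
    simp only [hT]
    rw [Finset.sum_eq_sum_Ico_succ_bot (by omega), if_pos hb]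
  have hmim : ∀ l, 0 ≤ (m l).im := fun l => by
    simp only [hm, Complex.div_natCast_im, Complex.im_sum]
    exact div_nonneg (Finset.sum_nonneg fun k _ => hg2 k l) hN0.le
  have hmdiff : ∀ l, ‖m l - m (l + 1)‖ ≤ (m l).im / 2 + (m (l + 1)).im / 4 := fun l => by
    simp only [hm, Complex.div_natCast_im, Complex.im_sum]
    rw [← sub_div, ← Finset.sum_sub_distrib, norm_div, Complex.norm_natCast, div_le_iff₀ hN0]
    calc _ ≤ ∑ k, ((g k l).im / 2 + (g k (l + 1)).im / 4) :=
          (norm_sum_le _ _).trans (Finset.sum_le_sum fun k _ => hg3 k l)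
      _ = _ := by rw [Finset.sum_add_distrib, ← Finset.sum_div, ← Finset.sum_div]; field_simp
  -- consequences of the estimates at one scale for the next smaller scale
  have hdouble : ∀ x y : ℂ, ‖x - y‖ ≤ x.im / 2 + y.im / 4 → 0 ≤ x.im → 0 ≤ y.im →
      ‖x‖ ≤ 5 / 2 * ‖y‖ ∧ y.im / 2 ≤ x.im := fun x y h hx hy => by
    have h1 : x.im ≤ ‖x‖ := (le_abs_self _).trans (Complex.abs_im_le_norm x)
    have h2 : y.im ≤ ‖y‖ := (le_abs_self _).trans (Complex.abs_im_le_norm y)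
    have h3 : ‖x‖ ≤ ‖x - y‖ + ‖y‖ := by simpa using norm_add_le (x - y) y
    have h4 : y.im - x.im ≤ ‖x - y‖ := by
      have := (neg_le_abs _).trans (Complex.abs_im_le_norm (x - y))
      simpa using this
    constructor <;> linarith
  have step : ∀ l ≤ L, κ / 60 ≤ ‖(⟨E, 2 ^ l * η⟩ : ℂ) + m l‖ → ‖m l‖ ≤ 13 →
      (∀ k, bad k l → ‖g k l‖ * 3 ^ l ≤ C * T k l) →
      ‖(m l) ^ 2 + ⟨E, 2 ^ l * η⟩ * m l + 1‖ ≤ 360 / κ * t + (1 + 4080 / κ) * s ∧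
        κ / 30 ≤ (m l).im ∧ ‖m l‖ ≤ 5 ∧ ∀ k, ‖g k l‖ * 3 ^ l ≤ C * (3 ^ l + T k l) := by
    intro l hl h1 h2 h3
    have hpow : (2:ℝ) ^ l * η ≤ 2 := by
      refine le_trans ?_ hL2
      gcongr; norm_num
    have hpow0 : 0 < (2:ℝ) ^ l * η := by positivity
    have h3l : (1:ℝ) ≤ 3 ^ l := one_le_pow₀ (by norm_num)
    have hz : ‖(⟨E, 2 ^ l * η⟩ : ℂ)‖ ≤ 4 := (Complex.norm_le_abs_re_add_abs_im _).trans (by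
      simp only [abs_of_pos hpow0]; linarith)
    have hz2 : ‖(⟨E, 2 ^ l * η⟩ : ℂ) + m l‖ ≤ 17 := (norm_add_le _ _).trans (by linarith)
    have him : (m l).im ≤ 13 := (le_abs_self _).trans ((Complex.abs_im_le_norm _).trans h2)
    have hb : ∀ k, bad k l → ‖g k l‖ ≤ C * T k l ∧ 1 ≤ T k l := fun k hk => by
      have h6 : 1 ≤ T k l := by
        rw [hTsucc k l hl hk]
        have : (1:ℝ) ≤ 3 ^ (l + 1) := one_le_pow₀ (by norm_num)
        linarith [hT0 k (l + 1)]
      exact ⟨(le_mul_of_one_le_right (norm_nonneg _) h3l).trans (h3 k hk), h6⟩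
    obtain ⟨h4, h5⟩ := approx_selfConsistent_of_scale hN (c := κ / 60) (T := fun k => T k l) (s := s)
      (by positivity) ht (by linarith) hC h1 hz2 (hg4 l hl him) hb
      (fun k => hT0 k l) ((Finset.sum_le_sum fun k _ => hTle k l).trans hs)
    have h6 : 3 * C * t + (1 + 17 * C) * s ≤ 360 / κ * t + (1 + 4080 / κ) * s := by
      have hs0 : 0 ≤ s := by
        have : 0 ≤ N * s := le_trans (Finset.sum_nonneg fun k _ => Finset.sum_nonneg
          fun l' _ => by split_ifs <;> positivity) hs
        exact nonneg_of_mul_nonneg_right this hN0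
      rw [hC120]
      have : 0 ≤ 1 / κ * s := by positivity
      have e1 : 120 / κ = 120 * (1 / κ) := by ring
      have e2 : 360 / κ = 360 * (1 / κ) := by ring
      have e3 : 4080 / κ = 4080 * (1 / κ) := by ring
      rw [e1, e2, e3]
      nlinarith
    have h7 := h5.trans h6
    obtain ⟨h8, h9⟩ := bounds_of_approx_selfConsistent hκ (z := ⟨E, 2 ^ l * η⟩) hE hpow0 hpow
      (hmim l) (h7.trans hts)
    refine ⟨h7, h8, h9, fun k => ?_⟩
    by_cases hk : bad k l
    · refine (h3 k hk).trans ?_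
      gcongr; linarith
    · calc ‖g k l‖ * 3 ^ l ≤ C * 3 ^ l := by gcongr; exact h4 k hk
        _ ≤ _ := by gcongr; linarith [hT0 k l]
  have main : ∀ j ≤ L, ‖(m (L - j)) ^ 2 + ⟨E, 2 ^ (L - j) * η⟩ * m (L - j) + 1‖ ≤
      360 / κ * t + (1 + 4080 / κ) * s ∧ κ / 30 ≤ (m (L - j)).im ∧ ‖m (L - j)‖ ≤ 5 ∧
      ∀ k, ‖g k (L - j)‖ * 3 ^ (L - j) ≤ C * (3 ^ (L - j) + T k (L - j)) := by
    intro j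
    induction j with
    | zero =>
      intro _
      rw [Nat.sub_zero]
      have hm1 : ‖m L‖ ≤ 1 := by
        simp only [hm]
        rw [norm_div, Complex.norm_natCast, div_le_iff₀ hN0]
        calc _ ≤ ∑ k : Fin N, (1:ℝ) :=
              (norm_sum_le _ _).trans (Finset.sum_le_sum fun k _ => hg1 k)
          _ = _ := by simp
      refine step L le_rfl ?_ (by linarith) fun k hk => ?_
      · have h1 : ((⟨E, 2 ^ L * η⟩ : ℂ) + m L).im = 2 ^ L * η + (m L).im := by simp
        have h2 := (le_abs_self _).trans (Complex.abs_im_le_norm ((⟨E, 2 ^ L * η⟩ : ℂ) + m L))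
        linarith [hmim L]
      · rw [hTsucc k L le_rfl hk]
        have h3 : T k (L + 1) = 0 := by simp [hT]
        rw [h3, add_zero, pow_succ]
        have h4 : (0:ℝ) < 3 ^ L := by positivity
        calc ‖g k L‖ * 3 ^ L ≤ 1 * 3 ^ L := by gcongr; exact hg1 k
          _ ≤ C * (3 ^ L * 3) := by gcongr; linarith
    | succ j ih =>
      intro hj
      obtain ⟨-, h1, h2, h3⟩ := ih (by omega)
      obtain ⟨l, hl⟩ : ∃ l, l = L - (j + 1) := ⟨_, rfl⟩
      have hl1 : L - j = l + 1 := by omega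
      rw [hl1] at h1 h2 h3
      rw [← hl]
      obtain ⟨h4, h5⟩ := hdouble _ _ (hmdiff l) (hmim l) (hmim (l + 1))
      refine step l (by omega) ?_ (by linarith) fun k hk => ?_
      · have h6 : ((⟨E, 2 ^ l * η⟩ : ℂ) + m l).im = 2 ^ l * η + (m l).im := by simp
        have h7 := (le_abs_self _).trans (Complex.abs_im_le_norm ((⟨E, 2 ^ l * η⟩ : ℂ) + m l))
        have : 0 < (2:ℝ) ^ l * η := by positivity
        linarith
      · obtain ⟨h6, -⟩ := hdouble _ _ (hg3 k l) (hg2 k l) (hg2 k (l + 1))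
        have h7 := h3 k
        rw [hTsucc k l (by omega) hk]
        calc ‖g k l‖ * 3 ^ l ≤ (3 * ‖g k (l + 1)‖) * 3 ^ l := by
              gcongr; linarith [norm_nonneg (g k (l + 1))]
          _ = ‖g k (l + 1)‖ * 3 ^ (l + 1) := by ring
          _ ≤ _ := h7
  intro l hl
  have := (main (L - l) (by omega)).1
  rwa [show L - (L - l) = l by omega] at this

/-! ### The coordinate model of a Wigner matrix -/

section Model

variable {N : ℕ}

/-- The Wigner matrix with prescribed unnormalized entries: for `l < k` the coordinate `(l, k)` is
the real part and the coordinate `(k, l)` the imaginary part of the entry `(l, k)`. -/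
noncomputable def wignerMatrix (x : Fin N × Fin N → ℝ) : Matrix (Fin N) (Fin N) ℂ :=
  Matrix.of fun l k =>
    (if l = k then (x (l, k) : ℂ) else
      if l < k then x (l, k) + x (k, l) * Complex.I else x (k, l) - x (l, k) * Complex.I) /
        (Real.sqrt N : ℝ)

/-- The laws of the coordinates of a Wigner matrix: `νd` on the diagonal, `νr` for real parts and
`νi` for imaginary parts. A real symmetric matrix has `νi` the Dirac mass at zero. -/
noncomputable def wignerLaw (N : ℕ) (νd νr νi : Measure ℝ) : Fin N × Fin N → Measure ℝ :=
  fun p => if p.1 = p.2 then νd else if p.1 < p.2 then νr else νi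

instance isProbabilityMeasure_wignerLaw (νd νr νi : Measure ℝ) [IsProbabilityMeasure νd]
    [IsProbabilityMeasure νr] [IsProbabilityMeasure νi] (p : Fin N × Fin N) :
    IsProbabilityMeasure (wignerLaw N νd νr νi p) := by
  unfold wignerLaw; split_ifs <;> infer_instance

lemma isHermitian_wignerMatrix (x : Fin N × Fin N → ℝ) : (wignerMatrix x).IsHermitian := by
  ext i j
  simp only [wignerMatrix, Matrix.conjTranspose_apply, Matrix.of_apply]
  rcases lt_trichotomy i j with h | h | h
  · simp [h, h.ne, h.ne', h.not_gt, sub_eq_add_neg]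
  · simp [h]
  · simp [h, h.ne, h.ne', h.not_gt, sub_eq_add_neg]

lemma continuous_wignerMatrix :
    Continuous (wignerMatrix : (Fin N × Fin N → ℝ) → Matrix (Fin N) (Fin N) ℂ) := by
  refine continuous_matrix fun i j => ?_
  simp only [wignerMatrix, Matrix.of_apply]
  split_ifs <;> fun_prop

lemma continuous_zeroOut_wignerMatrix (k : Fin N) :
    Continuous (fun x : Fin N × Fin N → ℝ => zeroOut (wignerMatrix x) k) := by
  refine continuous_matrix fun i j => ?_
  simp only [zeroOut, Matrix.of_apply]
  split_ifs
  · fun_prop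
  · exact continuous_wignerMatrix.matrix_elem i j

lemma measurable_resolv_zeroOut_wignerMatrix (z : ℂ) (k i j : Fin N) :
    Measurable (fun x : Fin N × Fin N → ℝ => resolv (zeroOut (wignerMatrix x) k) z i j) := by
  have h : Continuous (fun x : Fin N × Fin N → ℝ => zeroOut (wignerMatrix x) k - z • 1) :=
    (continuous_zeroOut_wignerMatrix k).sub continuous_const
  simp only [resolv, Matrix.inv_def, Matrix.smul_apply, Ring.inverse_eq_inv', smul_eq_mul]
  exact h.matrix_det.measurable.inv.mul (h.matrix_adjugate.matrix_elem i j).measurable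

lemma measurable_offDiagCol_wignerMatrix (k i : Fin N) :
    Measurable (fun x : Fin N × Fin N → ℝ => offDiagCol (wignerMatrix x) k i) := by
  simp only [offDiagCol]
  split_ifs
  · fun_prop
  · exact (continuous_wignerMatrix.matrix_elem i k).measurable

lemma measurable_schurForm_wignerMatrix (z : ℂ) (k : Fin N) :
    Measurable (fun x : Fin N × Fin N → ℝ => schurForm (wignerMatrix x) z k) := by
  simp only [schurForm, dotProduct, Matrix.mulVec, Pi.star_apply]
  refine Finset.measurable_sum _ fun i _ => Measurable.mul
    (continuous_star.measurable.comp (measurable_offDiagCol_wignerMatrix k i)) ?_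
  exact Finset.measurable_sum _ fun j _ => (measurable_resolv_zeroOut_wignerMatrix z k i j).mul
    (measurable_offDiagCol_wignerMatrix k j)

/-- The normalized trace of the resolvent of the minor. -/
noncomputable def minorTrace (A : Matrix (Fin N) (Fin N) ℂ) (z : ℂ) (k : Fin N) : ℂ :=
  (∑ i, if i = k then 0 else resolv (zeroOut A k) z i i) / N

lemma measurable_minorTrace_wignerMatrix (z : ℂ) (k : Fin N) :
    Measurable (fun x : Fin N × Fin N → ℝ => minorTrace (wignerMatrix x) z k) := by
  simp only [minorTrace]
  refine Measurable.div_const (Finset.measurable_sum _ fun i _ => ?_) _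
  split_ifs
  · fun_prop
  · exact measurable_resolv_zeroOut_wignerMatrix z k i i

/-- The event that the diagonal entry or the fluctuation of the quadratic form in Schur's formula
exceeds `t`, while the resolvent of the minor has bounded trace. The restriction to bounded trace
makes the event unlikely without any information on the minor. -/
def badEvent (z : ℂ) (t : ℝ) (k : Fin N) : Set (Fin N × Fin N → ℝ) :=
  {x | (minorTrace (wignerMatrix x) z k).im ≤ 14 ∧ (t < ‖wignerMatrix x k k‖ ∨
    t < ‖schurForm (wignerMatrix x) z k - minorTrace (wignerMatrix x) z k‖)}

lemma measurableSet_badEvent (z : ℂ) (t : ℝ) (k : Fin N) : MeasurableSet (badEvent z t k) := by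
  have h1 := measurable_minorTrace_wignerMatrix z k
  have h2 := measurable_schurForm_wignerMatrix z k
  have h3 := (continuous_wignerMatrix.matrix_elem k k).measurable
  refine (measurableSet_le (Complex.measurable_im.comp h1) measurable_const).inter
    ((measurableSet_lt measurable_const h3.norm).union
      (measurableSet_lt measurable_const (h2.sub h1).norm))

/-- Off the bad event, the diagonal entry of the resolvent satisfies the self-consistent equation
up to a small error. -/
lemma exists_error_of_notMem_badEvent {x : Fin N × Fin N → ℝ} {z : ℂ} (hz : 0 < z.im) {t : ℝ}
    (ht : 0 < t) (hNη : 1 / t + 1 ≤ N * z.im) {k : Fin N}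
    (hm : ((∑ k, resolv (wignerMatrix x) z k k) / N).im ≤ 13) (hk : x ∉ badEvent z t k) :
    ∃ ε : ℂ, ‖ε‖ ≤ 3 * t ∧ resolv (wignerMatrix x) z k k *
      (z + (∑ k, resolv (wignerMatrix x) z k k) / N + ε) = -1 := by
  set A := wignerMatrix x
  have hA : A.IsHermitian := isHermitian_wignerMatrix x
  set m := (∑ k, resolv A z k k) / N with hmdef
  have hN : 0 < N := Fin.pos k
  have hN0 : (0:ℝ) < N := by exact_mod_cast hN
  have hd : ‖m - minorTrace A z k‖ ≤ 1 / (N * z.im) := by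
    have := norm_trace_resolv_sub_le hA hz k
    rw [hmdef, minorTrace, ← sub_div, norm_div, Complex.norm_natCast, div_le_iff₀ hN0]
    refine this.trans (le_of_eq ?_)
    field_simp
  have hNη0 : 0 < N * z.im := by positivity
  have hd1 : 1 / (N * z.im) ≤ 1 := by
    rw [div_le_one hNη0]
    have : 0 < 1 / t := by positivity
    linarith
  have hdt : 1 / (N * z.im) ≤ t := by
    rw [div_le_iff₀ hNη0]
    have h1 : t * (1 / t + 1) ≤ t * (N * z.im) := by gcongr
    have h2 : t * (1 / t + 1) = 1 + t := by field_simp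
    linarith
  have him : (minorTrace A z k).im ≤ 14 := by
    have h1 := (neg_le_abs _).trans (Complex.abs_im_le_norm (m - minorTrace A z k))
    rw [Complex.sub_im] at h1
    linarith
  have hb : ‖A k k‖ ≤ t ∧ ‖schurForm A z k - minorTrace A z k‖ ≤ t := by
    by_contra h
    refine hk ⟨him, ?_⟩
    by_contra! h'
    exact h h'
  refine ⟨-A k k + (schurForm A z k - minorTrace A z k) - (m - minorTrace A z k), ?_, ?_⟩
  · refine (norm_sub_le _ _).trans ?_
    have := norm_add_le (-A k k) (schurForm A z k - minorTrace A z k)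
    rw [norm_neg] at this
    linarith [hb.1, hb.2]
  · have := resolv_diag_mul_schur hA hz k
    linear_combination -this

end Model

/-! ### Probability of the bad event -/

section BadEvent

variable {N : ℕ}

/-- The coordinates entering the off-diagonal part of the column of index `k`. -/
def crossSet (k : Fin N) : Set (Fin N × Fin N) := {p | p.1 = k ∧ p.2 ≠ k ∨ p.1 ≠ k ∧ p.2 = k}

instance decidablePredMemCrossSet (k : Fin N) : DecidablePred (· ∈ crossSet k) := fun p =>
  inferInstanceAs (Decidable (p.1 = k ∧ p.2 ≠ k ∨ p.1 ≠ k ∧ p.2 = k))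

/-- A sum supported on the cross, with the coordinates of each entry of the column grouped. -/
lemma sum_crossSet {M : Type*} [AddCommMonoid M] (k : Fin N) (F : Fin N × Fin N → M)
    (hF : ∀ p, p ∉ crossSet k → F p = 0) :
    ∑ p, F p = ∑ i, if i = k then 0 else F (i, k) + F (k, i) := by
  have h1 : ∀ i, ∑ j, F (i, j) = if i = k then ∑ j, F (k, j) else F (i, k) := fun i => by
    by_cases hi : i = k
    · simp [hi]
    · rw [if_neg hi, Finset.sum_eq_single k]
      · intro j _ hj
        exact hF _ (by simp [crossSet, hi, hj])
      · simp
  have h2 : F (k, k) = 0 := hF _ (by simp [crossSet])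
  rw [Fintype.sum_prod_type]
  rw [Finset.sum_congr rfl fun i _ => h1 i]
  rw [← Finset.add_sum_erase _ _ (Finset.mem_univ k),
    ← Finset.add_sum_erase Finset.univ (fun i => if i = k then 0 else F (i, k) + F (k, i))
      (Finset.mem_univ k), ← Finset.add_sum_erase Finset.univ (fun j => F (k, j))
      (Finset.mem_univ k)]
  simp only [if_true, h2, zero_add]
  rw [← Finset.sum_add_distrib]
  refine Finset.sum_congr rfl fun i hi => ?_
  rw [if_neg (Finset.ne_of_mem_erase hi), if_neg (Finset.ne_of_mem_erase hi), add_comm]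

/-- The coefficient vector of a coordinate in the off-diagonal part of the column of index `k`. -/
noncomputable def crossVec (k : Fin N) (p : Fin N × Fin N) : Fin N → ℂ :=
  if p ∈ crossSet k then
    if p.2 = k then Pi.single p.1 ((if p.1 < k then 1 else -Complex.I) / (Real.sqrt N : ℝ))
    else Pi.single p.2 ((if p.2 < k then Complex.I else 1) / (Real.sqrt N : ℝ))
  else 0

lemma crossVec_of_notMem {k : Fin N} {p : Fin N × Fin N} (hp : p ∉ crossSet k) :
    crossVec k p = 0 := if_neg hp

lemma crossVec_left {k i : Fin N} (hi : i ≠ k) :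
    crossVec k (i, k) = Pi.single i ((if i < k then 1 else -Complex.I) / (Real.sqrt N : ℝ)) := by
  simp [crossVec, crossSet, hi]

lemma crossVec_right {k i : Fin N} (hi : i ≠ k) :
    crossVec k (k, i) = Pi.single i ((if i < k then Complex.I else 1) / (Real.sqrt N : ℝ)) := by
  simp [crossVec, crossSet, hi]

lemma offDiagCol_wignerMatrix (k : Fin N) (x : Fin N × Fin N → ℝ) :
    offDiagCol (wignerMatrix x) k = ∑ p, (x p : ℂ) • crossVec k p := by
  rw [sum_crossSet k _ (fun p hp => by rw [crossVec_of_notMem hp, smul_zero])]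
  ext i
  rw [Finset.sum_apply]
  have : ∀ j, (if j = k then 0 else ((x (j, k) : ℂ) • crossVec k (j, k) +
      (x (k, j) : ℂ) • crossVec k (k, j))) i =
      if j = i then offDiagCol (wignerMatrix x) k i else 0 := by
    intro j
    by_cases hj : j = k
    · by_cases hji : j = i
      · simp [hj, ← hji, offDiagCol]
      · simp [hj, hj ▸ hji]
    · rw [if_neg hj, crossVec_left hj, crossVec_right hj]
      by_cases hji : j = i
      · subst hji
        simp only [Pi.add_apply, Pi.smul_apply, Pi.single_eq_same, smul_eq_mul, if_true,
          offDiagCol, if_neg hj, wignerMatrix, Matrix.of_apply]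
        by_cases h : j < k
        · simp [h]; ring
        · simp [h]; ring
      · simp [hji, Ne.symm hji]
  rw [Finset.sum_congr rfl fun j _ => this j]
  simp

/-- The coefficients of Schur's quadratic form in the coordinates. -/
noncomputable def crossForm (M : Matrix (Fin N) (Fin N) ℂ) (k : Fin N) (p q : Fin N × Fin N) : ℂ :=
  star (crossVec k p) ⬝ᵥ M.mulVec (crossVec k q)

lemma sum_sum_crossForm (M : Matrix (Fin N) (Fin N) ℂ) (k : Fin N)
    (g h : Fin N × Fin N → ℝ) :
    ∑ p, ∑ q, crossForm M k p q * g p * h q =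
      star (offDiagCol (wignerMatrix g) k) ⬝ᵥ M.mulVec (offDiagCol (wignerMatrix h) k) := by
  simp only [offDiagCol_wignerMatrix, star_sum, Matrix.mulVec_sum, sum_dotProduct,
    dotProduct_sum, star_smul, Matrix.mulVec_smul, smul_dotProduct, dotProduct_smul, crossForm]
  rw [Finset.sum_comm]
  refine Finset.sum_congr rfl fun q _ => ?_
  rw [Finset.smul_sum]
  refine Finset.sum_congr rfl fun p _ => ?_
  simp
  ring

lemma star_single_dotProduct_mulVec_single (M : Matrix (Fin N) (Fin N) ℂ) (i j : Fin N) (a b : ℂ) :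
    star (Pi.single i a : Fin N → ℂ) ⬝ᵥ M.mulVec (Pi.single j b) = star a * M i j * b := by
  rw [← Pi.single_star, single_dotProduct, Matrix.mulVec_single]
  simp; ring

lemma crossForm_eq_zero_left (M : Matrix (Fin N) (Fin N) ℂ) {k : Fin N} {p : Fin N × Fin N}
    (hp : p ∉ crossSet k) (q : Fin N × Fin N) : crossForm M k p q = 0 := by
  simp [crossForm, crossVec_of_notMem hp]

lemma crossForm_eq_zero_right (M : Matrix (Fin N) (Fin N) ℂ) {k : Fin N} (p : Fin N × Fin N)
    {q : Fin N × Fin N} (hq : q ∉ crossSet k) : crossForm M k p q = 0 := by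
  simp [crossForm, crossVec_of_notMem hq]

lemma sqrt_natCast_mul_self (N : ℕ) : ((Real.sqrt N : ℝ) : ℂ) * (Real.sqrt N : ℝ) = N := by
  rw [← Complex.ofReal_mul, Real.mul_self_sqrt (Nat.cast_nonneg N)]; simp

/-- The diagonal part of Schur's quadratic form has the normalized trace of the resolvent of the
minor as its expectation. -/
lemma sum_crossForm_diag (M : Matrix (Fin N) (Fin N) ℂ) (k : Fin N) {v : Fin N × Fin N → ℝ}
    (hv : ∀ i, i ≠ k → v (i, k) + v (k, i) = 1) :
    ∑ p, crossForm M k p p * v p = (∑ i, if i = k then 0 else M i i) / N := by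
  have hN : 0 < N := Fin.pos k
  have hs : ((Real.sqrt N : ℝ) : ℂ) ≠ 0 := by
    rw [Complex.ofReal_ne_zero]; positivity
  have hNc : (N : ℂ) ≠ 0 := by exact_mod_cast hN.ne'
  rw [sum_crossSet k _ (fun p hp => by rw [crossForm_eq_zero_left M hp, zero_mul]),
    Finset.sum_div]
  refine Finset.sum_congr rfl fun i _ => ?_
  by_cases hi : i = k
  · simp [hi]
  · have hI : Complex.I * Complex.I = -1 := Complex.I_mul_I
    have e : ∀ c : ℂ, star c * c = 1 →
        star (c / (Real.sqrt N : ℝ)) * M i i * (c / (Real.sqrt N : ℝ)) = M i i / N := by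
      intro c hc
      rw [star_div₀, eq_div_iff hNc, ← sqrt_natCast_mul_self N]
      have : star ((Real.sqrt N : ℝ) : ℂ) = (Real.sqrt N : ℝ) := Complex.conj_ofReal _
      rw [this]
      field_simp
      linear_combination M i i * hc
    have h1 : crossForm M k (i, k) (i, k) = M i i / N := by
      rw [crossForm, crossVec_left hi, star_single_dotProduct_mulVec_single]
      refine e _ ?_
      split_ifs <;> simp
    have h2 : crossForm M k (k, i) (k, i) = M i i / N := by
      rw [crossForm, crossVec_right hi, star_single_dotProduct_mulVec_single]
      refine e _ ?_
      split_ifs <;> simp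
    rw [if_neg hi, if_neg hi, h1, h2, ← mul_add, ← Complex.ofReal_add, hv i hi]
    simp

lemma norm_crossForm_sq_le (M : Matrix (Fin N) (Fin N) ℂ) (k : Fin N) :
    ∑ p, ∑ q, ‖crossForm M k p q‖ ^ 2 ≤ 4 * (∑ i, ∑ j, ‖M i j‖ ^ 2) / N ^ 2 := by
  have hN : 0 < N := Fin.pos k
  have hN0 : (0:ℝ) < N := by exact_mod_cast hN
  have e : ∀ (c d : ℂ) (i j : Fin N), ‖c‖ = 1 → ‖d‖ = 1 →
      ‖star (Pi.single i (c / (Real.sqrt N : ℝ)) : Fin N → ℂ) ⬝ᵥ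
        M.mulVec (Pi.single j (d / (Real.sqrt N : ℝ)))‖ ^ 2 = ‖M i j‖ ^ 2 / N ^ 2 := by
    intro c d i j hc hd
    rw [star_single_dotProduct_mulVec_single, norm_mul, norm_mul, norm_star, norm_div, norm_div,
      hc, hd, Complex.norm_real, Real.norm_of_nonneg (Real.sqrt_nonneg _)]
    have h1 : Real.sqrt N ^ 2 = N := Real.sq_sqrt hN0.le
    have h2 : Real.sqrt N ≠ 0 := by positivity
    have h3 : 1 / Real.sqrt N * ‖M i j‖ * (1 / Real.sqrt N) = ‖M i j‖ / N := by
      field_simp; rw [h1]; ring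
    rw [h3, div_pow]
  have hl : ∀ i : Fin N, ‖(if i < k then 1 else -Complex.I : ℂ)‖ = 1 := fun i => by
    split_ifs <;> simp
  have hr : ∀ i : Fin N, ‖(if i < k then Complex.I else 1 : ℂ)‖ = 1 := fun i => by
    split_ifs <;> simp
  have hinner : ∀ p, ∑ q, ‖crossForm M k p q‖ ^ 2 =
      ∑ j, if j = k then 0 else ‖crossForm M k p (j, k)‖ ^ 2 + ‖crossForm M k p (k, j)‖ ^ 2 :=
    fun p => sum_crossSet k _ fun q hq => by simp [crossForm_eq_zero_right M p hq]
  rw [sum_crossSet k _ (fun p hp => by simp [crossForm_eq_zero_left M hp]), Finset.mul_sum,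
    Finset.sum_div]
  refine Finset.sum_le_sum fun i _ => ?_
  rw [Finset.mul_sum, Finset.sum_div]
  by_cases hi : i = k
  · rw [if_pos hi]; positivity
  · rw [if_neg hi, hinner, hinner, ← Finset.sum_add_distrib]
    refine Finset.sum_le_sum fun j _ => ?_
    by_cases hj : j = k
    · rw [if_pos hj, if_pos hj, add_zero]; positivity
    · rw [if_neg hj, if_neg hj]
      simp only [crossForm, crossVec_left hi, crossVec_right hi, crossVec_left hj,
        crossVec_right hj]
      rw [e _ _ _ _ (hl i) (hl j), e _ _ _ _ (hl i) (hr j), e _ _ _ _ (hr i) (hl j),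
        e _ _ _ _ (hr i) (hr j)]
      exact le_of_eq (by ring)

lemma sum_norm_offDiagCol_wignerMatrix_sq_le (k : Fin N) (g : Fin N × Fin N → ℝ) :
    ∑ i, ‖offDiagCol (wignerMatrix g) k i‖ ^ 2 ≤ (∑ p, g p ^ 2) / N := by
  have hN : 0 < N := Fin.pos k
  have hN0 : (0:ℝ) < N := by exact_mod_cast hN
  have h1 : ∑ p, (if p ∈ crossSet k then g p ^ 2 else 0) ≤ ∑ p, g p ^ 2 :=
    Finset.sum_le_sum fun p _ => by split_ifs <;> nlinarith
  refine le_trans ?_ (div_le_div_of_nonneg_right h1 hN0.le)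
  rw [sum_crossSet k _ (fun p hp => if_neg hp), Finset.sum_div]
  refine Finset.sum_le_sum fun i _ => ?_
  by_cases hi : i = k
  · simp [hi, offDiagCol]
  · have m1 : (i, k) ∈ crossSet k := by simp [crossSet, hi]
    have m2 : (k, i) ∈ crossSet k := by simp [crossSet, hi]
    rw [if_neg hi, if_pos m1, if_pos m2]
    simp only [offDiagCol, if_neg hi, wignerMatrix, Matrix.of_apply]
    rw [norm_div, div_pow, Complex.norm_real, Real.norm_of_nonneg (Real.sqrt_nonneg _),
      Real.sq_sqrt hN0.le]
    gcongr
    rw [Complex.sq_norm, Complex.normSq_apply]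
    by_cases h : i < k
    · simp [h]; nlinarith
    · simp [h]; nlinarith

/-- The minor depends only on the coordinates outside of the cross. -/
lemma zeroOut_wignerMatrix_mix (k : Fin N) (x y : Fin N × Fin N → ℝ) :
    zeroOut (wignerMatrix (fun p => if p ∈ crossSet k then x p else y p)) k =
      zeroOut (wignerMatrix y) k := by
  ext i j
  simp only [zeroOut, Matrix.of_apply]
  split_ifs with h
  · rfl
  · push Not at h
    simp [wignerMatrix, crossSet, h.1, h.2]

lemma offDiagCol_wignerMatrix_mix (k : Fin N) (x y : Fin N × Fin N → ℝ) :
    offDiagCol (wignerMatrix (fun p => if p ∈ crossSet k then x p else y p)) k =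
      offDiagCol (wignerMatrix x) k := by
  ext i
  simp only [offDiagCol]
  split_ifs with h
  · rfl
  · simp [wignerMatrix, crossSet, h]

/-- The variances of the coordinates of a Wigner matrix. -/
def wignerVar (N : ℕ) (vd vr vi : ℝ) : Fin N × Fin N → ℝ :=
  fun p => if p.1 = p.2 then vd else if p.1 < p.2 then vr else vi

/-- The bad event is exponentially unlikely in `N * Im z`. Conditionally on the minor, Schur's form is
a quadratic form in the independent coordinates of the cross, with operator norm at most
`1 / (N * Im z)`, and the bound on the trace controls its Hilbert–Schmidt norm; the Hanson–Wright
inequality applies to its real and imaginary parts. -/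
lemma exists_measure_badEvent_le {L t vd vr vi : ℝ} (hL : 0 < L) (ht : 0 < t)
    (hv : vr + vi = 1) {νd νr νi : Measure ℝ} [IsProbabilityMeasure νd]
    [IsProbabilityMeasure νr] [IsProbabilityMeasure νi]
    (hd : SubGaussian L νd) (hr : SubGaussian L νr) (hi : SubGaussian L νi)
    (hd2 : SubExpSquare L νd vd) (hr2 : SubExpSquare L νr vr) (hi2 : SubExpSquare L νi vi) :
    ∃ θ : ℝ, 0 < θ ∧ ∀ (N : ℕ) (z : ℂ), 0 < z.im → z.im ≤ 2 → 1 ≤ N * z.im → ∀ k : Fin N,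
      Measure.pi (wignerLaw N νd νr νi) (badEvent z t k) ≤ 10 * expE (-(θ * (N * z.im))) := by
  obtain ⟨θ, hθ, hHW⟩ := exists_hansonWright (L := L) (B := 60) (t := t / 2) hL (by norm_num)
    (by positivity)
  refine ⟨min θ (t ^ 2 / (8 * L)), by positivity, ?_⟩
  intro N z hz hz2 hNz k
  have hN : 0 < N := Fin.pos k
  have hN0 : (0:ℝ) < N := by exact_mod_cast hN
  set μ := wignerLaw N νd νr νi with hμdef
  have hμ : ∀ p, SubGaussian L (μ p) := fun p => by
    simp only [hμdef, wignerLaw]; split_ifs <;> assumption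
  have hμ2 : ∀ p, SubExpSquare L (μ p) (wignerVar N vd vr vi p) := fun p => by
    simp only [hμdef, wignerLaw, wignerVar]; split_ifs <;> assumption
  set A := N * z.im with hA
  have hA0 : 0 < A := by positivity
  -- the two sources of badness
  set D : Set (Fin N × Fin N → ℝ) := {x | t ≤ ‖wignerMatrix x k k‖} with hD
  set Q : Set (Fin N × Fin N → ℝ) := {x | (minorTrace (wignerMatrix x) z k).im ≤ 14 ∧
    t ≤ ‖schurForm (wignerMatrix x) z k - minorTrace (wignerMatrix x) z k‖} with hQ
  have hsub : badEvent z t k ⊆ D ∪ Q := by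
    rintro x ⟨h1, h2 | h2⟩
    · exact Or.inl h2.le
    · exact Or.inr ⟨h1, h2.le⟩
  have hDm : Measure.pi μ D ≤ 2 * expE (-(t ^ 2 / (8 * L) * A)) := by
    have hs0 : 0 < Real.sqrt N := Real.sqrt_pos.2 hN0
    set s := t * Real.sqrt N / (2 * L) with hs
    have hs1 : 0 < s := by positivity
    have hsq : Real.sqrt N ^ 2 = N := Real.sq_sqrt hN0.le
    have key : ∀ s' : ℝ, s' ^ 2 = s ^ 2 →
        ∫⁻ x, expE (s' * x (k, k)) ∂Measure.pi μ ≤ expE (L * s ^ 2) := by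
      intro s' hs'
      rw [← hs']
      have := hμ (k, k) s'
      rwa [← (measurePreserving_eval μ (k, k)).lintegral_comp
        (f := fun y => expE (s' * y)) (by fun_prop)] at this
    have tail : ∀ f : (Fin N × Fin N → ℝ) → ℝ, Measurable f →
        ∫⁻ x, expE (s * f x) ∂Measure.pi μ ≤ expE (L * s ^ 2) →
        Measure.pi μ {x | t * Real.sqrt N ≤ f x} ≤ expE (-(t ^ 2 / (8 * L) * A)) := by
      intro f hf h
      refine (measure_le_expE_of_lintegral_le hf hs1 h).trans (expE_le_expE ?_)
      have e : L * s ^ 2 - s * (t * Real.sqrt N) = -(t ^ 2 / (4 * L) * N) := by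
        rw [hs, div_pow, mul_pow, hsq]
        have : t * Real.sqrt N / (2 * L) * (t * Real.sqrt N) =
          t ^ 2 * (Real.sqrt N ^ 2) / (2 * L) := by ring
        rw [this, hsq]
        field_simp; ring
      rw [e, neg_le_neg_iff, hA]
      calc t ^ 2 / (8 * L) * (N * z.im) ≤ t ^ 2 / (8 * L) * (N * 2) := by gcongr
        _ = _ := by ring
    have hDsub : D ⊆ {x | t * Real.sqrt N ≤ x (k, k)} ∪ {x | t * Real.sqrt N ≤ -x (k, k)} := by
      intro x hx
      simp only [hD, Set.mem_ofPred_eq, wignerMatrix, Matrix.of_apply, if_true, norm_div,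
        Complex.norm_real, Real.norm_eq_abs, abs_of_pos hs0, le_div_iff₀ hs0] at hx
      exact le_abs.1 hx
    refine (measure_mono hDsub).trans ((measure_union_le _ _).trans ?_)
    rw [two_mul]
    refine add_le_add (tail _ (by fun_prop) (key s rfl)) (tail _ (by fun_prop) ?_)
    simpa only [mul_neg, neg_mul] using key (-s) (by ring)
  have hQm : Measure.pi μ Q ≤ 8 * expE (-(θ * A)) := by
    have hQmeas : MeasurableSet Q :=
      (measurableSet_le (Complex.measurable_im.comp (measurable_minorTrace_wignerMatrix z k))
        measurable_const).inter (measurableSet_le measurable_const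
        ((measurable_schurForm_wignerMatrix z k).sub
          (measurable_minorTrace_wignerMatrix z k)).norm)
    -- the coordinates outside of the cross are frozen at `y`
    have hcond : ∀ y : Fin N × Fin N → ℝ, ∫⁻ x, Q.indicator 1
        (fun p => if p ∈ crossSet k then x p else y p) ∂Measure.pi μ ≤ 8 * expE (-(θ * A)) := by
      intro y
      set M := resolv (zeroOut (wignerMatrix y) k) z with hM
      have hHerm := isHermitian_zeroOut (isHermitian_wignerMatrix y) k
      have hform : ∀ x : Fin N × Fin N → ℝ, schurForm (wignerMatrix
          (fun p => if p ∈ crossSet k then x p else y p)) z k =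
          ∑ p, ∑ q, crossForm M k p q * x p * x q := fun x => by
        rw [schurForm, zeroOut_wignerMatrix_mix, offDiagCol_wignerMatrix_mix, sum_sum_crossForm]
      have htr : ∀ x : Fin N × Fin N → ℝ, minorTrace (wignerMatrix
          (fun p => if p ∈ crossSet k then x p else y p)) z k =
          ∑ p, crossForm M k p p * wignerVar N vd vr vi p := fun x => by
        rw [minorTrace, zeroOut_wignerMatrix_mix, sum_crossForm_diag]
        intro i hik
        simp only [wignerVar]
        rcases lt_or_gt_of_ne hik with h | h
        · simp [h, h.ne, h.ne', h.not_gt, hv]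
        · simp [h, h.ne, h.ne', h.not_gt, add_comm vi, hv]
      by_cases him : (∑ p, crossForm M k p p * (wignerVar N vd vr vi p : ℂ)).im ≤ 14
      swap
      · have : ∀ x : Fin N × Fin N → ℝ, Q.indicator (1 : (Fin N × Fin N → ℝ) → ℝ≥0∞)
            (fun p => if p ∈ crossSet k then x p else y p) = 0 := fun x => by
          refine Set.indicator_of_notMem (fun h => him ?_) _
          rw [← htr x]; exact h.1
        simp [this]
      have hbil : ∀ g h : Fin N × Fin N → ℝ, ‖∑ p, ∑ q, crossForm M k p q * g p * h q‖ ^ 2 ≤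
          (1 / A) ^ 2 * (∑ p, g p ^ 2) * ∑ q, h q ^ 2 := by
        intro g h
        rw [sum_sum_crossForm]
        refine (norm_star_dotProduct_resolv_sq_le hHerm hz _ _).trans ?_
        calc _ ≤ (1 / z.im) ^ 2 * ((∑ p, g p ^ 2) / N) * ((∑ q, h q ^ 2) / N) := by
              gcongr <;> exact sum_norm_offDiagCol_wignerMatrix_sq_le k _
          _ = _ := by rw [hA]; field_simp
      have hfrob : ∑ p, ∑ q, ‖crossForm M k p q‖ ^ 2 ≤ 60 / A := by
        refine (norm_crossForm_sq_le M k).trans ?_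
        have h1 := im_mul_sum_sum_norm_sq_resolv hHerm hz
        rw [← hM] at h1
        have h2 : M.trace.im ≤ 15 * N := by
          have h3 : M.trace = M k k + ∑ i, (if i = k then 0 else M i i) := by
            rw [Matrix.trace, ← Finset.add_sum_erase _ _ (Finset.mem_univ k),
              ← Finset.add_sum_erase Finset.univ (fun i => if i = k then 0 else M i i)
                (Finset.mem_univ k), if_pos rfl, zero_add]
            congr 1
            exact Finset.sum_congr rfl fun i hi => by
              rw [if_neg (Finset.ne_of_mem_erase hi)]; rfl
          have h4 := htr y
          rw [minorTrace, zeroOut_wignerMatrix_mix, ← hM] at h4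
          rw [← h4, Complex.div_natCast_im, div_le_iff₀ hN0] at him
          have h5 : (M k k).im ≤ N := by
            refine (le_abs_self _).trans ((Complex.abs_im_le_norm _).trans
              ((norm_resolv_diag_le hHerm hz k).trans ?_))
            rw [div_le_iff₀ hz]; exact hNz
          rw [h3, Complex.add_im]; linarith
        rw [div_le_div_iff₀ (by positivity) hA0]
        have h6 : z.im * ∑ i, ∑ j, ‖M i j‖ ^ 2 ≤ 15 * N := h1.le.trans h2
        calc 4 * (∑ i, ∑ j, ‖M i j‖ ^ 2) * A = 4 * (z.im * ∑ i, ∑ j, ‖M i j‖ ^ 2) * N := by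
              rw [hA]; ring
          _ ≤ 4 * (15 * N) * N := by gcongr
          _ = _ := by ring
      have hre := hHW μ (wignerVar N vd vr vi) hμ hμ2 (fun p q => (crossForm M k p q).re) A hA0
        (fun g h => ?_) ?_
      rotate_left
      · refine le_trans ?_ (hbil g h)
        have : ∑ p, ∑ q, (crossForm M k p q).re * g p * h q =
            (∑ p, ∑ q, crossForm M k p q * g p * h q).re := by
          simp [Complex.re_sum]
        rw [this, ← sq_abs]
        exact pow_le_pow_left₀ (abs_nonneg _) (Complex.abs_re_le_norm _) 2
      · refine le_trans (Finset.sum_le_sum fun p _ => Finset.sum_le_sum fun q _ => ?_) hfrob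
        rw [← sq_abs]
        exact pow_le_pow_left₀ (abs_nonneg _) (Complex.abs_re_le_norm _) 2
      have hims := hHW μ (wignerVar N vd vr vi) hμ hμ2 (fun p q => (crossForm M k p q).im) A hA0
        (fun g h => ?_) ?_
      rotate_left
      · refine le_trans ?_ (hbil g h)
        have : ∑ p, ∑ q, (crossForm M k p q).im * g p * h q =
            (∑ p, ∑ q, crossForm M k p q * g p * h q).im := by
          simp [Complex.im_sum]
        rw [this, ← sq_abs]
        exact pow_le_pow_left₀ (abs_nonneg _) (Complex.abs_im_le_norm _) 2
      · refine le_trans (Finset.sum_le_sum fun p _ => Finset.sum_le_sum fun q _ => ?_) hfrob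
        rw [← sq_abs]
        exact pow_le_pow_left₀ (abs_nonneg _) (Complex.abs_im_le_norm _) 2
      set R1 := {x : Fin N × Fin N → ℝ | t / 2 ≤ |∑ p, ∑ q, (crossForm M k p q).re * x p * x q -
        ∑ p, (crossForm M k p p).re * wignerVar N vd vr vi p|}
      set R2 := {x : Fin N × Fin N → ℝ | t / 2 ≤ |∑ p, ∑ q, (crossForm M k p q).im * x p * x q -
        ∑ p, (crossForm M k p p).im * wignerVar N vd vr vi p|}
      have hmix : Measurable (fun x : Fin N × Fin N → ℝ =>
          fun p => if p ∈ crossSet k then x p else y p) := by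
        refine measurable_pi_lambda _ fun p => ?_
        by_cases h : p ∈ crossSet k
        · simp only [h, if_true]; fun_prop
        · simp only [h, if_false]; fun_prop
      have hint : ∫⁻ x, Q.indicator 1 (fun p => if p ∈ crossSet k then x p else y p)
          ∂Measure.pi μ = Measure.pi μ ((fun x : Fin N × Fin N → ℝ =>
          fun p => if p ∈ crossSet k then x p else y p) ⁻¹' Q) := by
        rw [← lintegral_indicator_one (hmix hQmeas)]; rfl
      rw [hint]
      have hsub2 : (fun x : Fin N × Fin N → ℝ =>
          fun p => if p ∈ crossSet k then x p else y p) ⁻¹' Q ⊆ R1 ∪ R2 := by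
        rintro x ⟨-, hx⟩
        rw [hform, htr] at hx
        set q := ∑ p, ∑ q, crossForm M k p q * x p * x q -
          ∑ p, crossForm M k p p * (wignerVar N vd vr vi p : ℂ) with hq
        have hqre : q.re = ∑ p, ∑ q, (crossForm M k p q).re * x p * x q -
            ∑ p, (crossForm M k p p).re * wignerVar N vd vr vi p := by
          simp [hq, Complex.re_sum]
        have hqim : q.im = ∑ p, ∑ q, (crossForm M k p q).im * x p * x q -
            ∑ p, (crossForm M k p p).im * wignerVar N vd vr vi p := by
          simp [hq, Complex.im_sum]
        have h3 := Complex.norm_le_abs_re_add_abs_im q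
        rcases le_or_gt (t / 2) |q.re| with h | h
        · left; rw [hqre] at h; exact h
        · right
          have h4 : t / 2 ≤ |q.im| := by linarith
          rw [hqim] at h4; exact h4
      refine (measure_mono hsub2).trans ((measure_union_le _ _).trans ?_)
      refine (add_le_add hre hims).trans (le_of_eq ?_)
      ring
    rw [← lintegral_indicator_one hQmeas, lintegral_pi_resample μ (crossSet k)
      (measurable_one.indicator hQmeas)]
    refine (lintegral_mono hcond).trans ?_
    simp
  calc Measure.pi μ (badEvent z t k) ≤ Measure.pi μ D + Measure.pi μ Q :=
        (measure_mono hsub).trans (measure_union_le _ _)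
    _ ≤ 2 * expE (-(min θ (t ^ 2 / (8 * L)) * A)) + 8 * expE (-(min θ (t ^ 2 / (8 * L)) * A)) := by
        refine add_le_add (hDm.trans ?_) (hQm.trans ?_)
        · gcongr
          refine expE_le_expE ?_
          have := min_le_right θ (t ^ 2 / (8 * L))
          nlinarith
        · gcongr
          refine expE_le_expE ?_
          have := min_le_left θ (t ^ 2 / (8 * L))
          nlinarith
    _ = _ := by ring

end BadEvent

/-! ### The local law at one spectral parameter -/

section LocalLaw

/-- The weights `3 ^ (l + 1)` of the scales are beaten by the probabilities of failure. -/
lemma three_pow_mul_exp_le {θ A : ℝ} (hθ : 0 < θ) (hA : 12 / θ ≤ A) (l : ℕ) :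
    (3:ℝ) ^ (l + 1) * Real.exp (-(θ * (2 ^ l * A))) ≤
      (1 / 2) ^ l * Real.exp (-(θ / 2 * A)) := by
  rw [div_le_iff₀ hθ] at hA
  have h2 : ((l:ℝ) + 1) ≤ 2 ^ l := by exact_mod_cast Nat.lt_two_pow_self
  have h1 : θ / 2 * A + 6 * (l + 1) ≤ θ * (2 ^ l * A) := by
    nlinarith [mul_le_mul_of_nonneg_left h2 (by linarith : (0:ℝ) ≤ A * θ - 6),
      mul_nonneg (by linarith : (0:ℝ) ≤ A * θ - 12) (Nat.cast_nonneg (α := ℝ) l)]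
  have h6 : (6:ℝ) ^ (l + 1) ≤ Real.exp (6 * (l + 1)) := by
    have : Real.exp (6 * (l + 1)) = Real.exp 6 ^ (l + 1) := by
      rw [← Real.exp_nat_mul]; push_cast; ring_nf
    rw [this]
    exact pow_le_pow_left₀ (by norm_num) (by linarith [Real.add_one_le_exp 6]) _
  have h36 : (3:ℝ) ^ (l + 1) ≤ (1 / 2) ^ l * 6 ^ (l + 1) := by
    have : (6:ℝ) ^ (l + 1) = 2 * (2 ^ l * 3 ^ (l + 1)) := by
      rw [show (6:ℝ) = 2 * 3 by norm_num, mul_pow, pow_succ 2 l]; ring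
    have e : ((1:ℝ) / 2) ^ l * 2 ^ l = 1 := by rw [← mul_pow]; norm_num
    have h3 : (0:ℝ) < 3 ^ (l + 1) := by positivity
    rw [this]
    calc (3:ℝ) ^ (l + 1) ≤ (1 / 2) ^ l * 2 ^ l * (2 * 3 ^ (l + 1)) := by rw [e]; linarith
      _ = _ := by ring
  have hexp : Real.exp (-(θ * (2 ^ l * A))) ≤
      Real.exp (-(θ / 2 * A)) * (Real.exp (6 * (l + 1)))⁻¹ := by
    rw [← Real.exp_neg, ← Real.exp_add]
    exact Real.exp_le_exp.2 (by linarith)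
  have hpos : 0 < Real.exp (6 * ((l:ℝ) + 1)) := Real.exp_pos _
  calc (3:ℝ) ^ (l + 1) * Real.exp (-(θ * (2 ^ l * A)))
      ≤ ((1 / 2) ^ l * Real.exp (6 * (l + 1))) *
        (Real.exp (-(θ / 2 * A)) * (Real.exp (6 * (l + 1)))⁻¹) := by
        gcongr
        exact h36.trans (by gcongr)
    _ = _ := by field_simp

lemma exists_scale {η : ℝ} (hη : 0 < η) (hη1 : η ≤ 1) :
    ∃ L : ℕ, 1 ≤ 2 ^ L * η ∧ 2 ^ L * η ≤ 2 := by
  obtain ⟨n, h1, h2⟩ := exists_nat_pow_near (x := 1 / η) (y := (2:ℝ))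
    (by rwa [le_div_iff₀ hη, one_mul]) (by norm_num)
  rw [le_div_iff₀ hη] at h1
  rw [div_lt_iff₀ hη] at h2
  refine ⟨n + 1, h2.le, ?_⟩
  rw [pow_succ]; linarith

open Classical in
/-- At a spectral parameter in the bulk, the Stieltjes transform of the empirical spectral measure
satisfies the self-consistent equation of the semicircle law up to a small error, outside of an
event which is exponentially unlikely in `N * Im z`. -/
lemma exists_local_law {L κ ρ vd vr vi : ℝ} (hL : 0 < L) (hκ : 0 < κ) (hρ : 0 < ρ)
    (hv : vr + vi = 1) {νd νr νi : Measure ℝ} [IsProbabilityMeasure νd]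
    [IsProbabilityMeasure νr] [IsProbabilityMeasure νi]
    (hd : SubGaussian L νd) (hr : SubGaussian L νr) (hi : SubGaussian L νi)
    (hd2 : SubExpSquare L νd vd) (hr2 : SubExpSquare L νr vr) (hi2 : SubExpSquare L νi vi) :
    ∃ K θ : ℝ, 0 < K ∧ 0 < θ ∧ ∀ (N : ℕ) (E η : ℝ), 0 < N → |E| ≤ 2 - κ → 0 < η → η ≤ 1 →
      K ≤ N * η → ∃ B : Set (Fin N × Fin N → ℝ), MeasurableSet B ∧
        Measure.pi (wignerLaw N νd νr νi) B ≤ ENNReal.ofReal K * expE (-(θ * (N * η))) ∧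
        ∀ x, x ∉ B → ‖((∑ k, resolv (wignerMatrix x) ⟨E, η⟩ k k) / N) ^ 2 +
          ⟨E, η⟩ * ((∑ k, resolv (wignerMatrix x) ⟨E, η⟩ k k) / N) + 1‖ ≤ ρ := by
  obtain ⟨ρ', hρ', hρ1, hρ2, hρ3⟩ : ∃ ρ', 0 < ρ' ∧ ρ' ≤ ρ ∧ ρ' ≤ κ / 40 ∧ ρ' ≤ 1 :=
    ⟨min (min ρ (κ / 40)) 1, by positivity, (min_le_left _ _).trans (min_le_left _ _),
      (min_le_left _ _).trans (min_le_right _ _), min_le_right _ _⟩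
  obtain ⟨t, ht, ht1, ht2⟩ : ∃ t, 0 < t ∧ 360 * t ≤ κ ∧ 360 / κ * t = ρ' / 2 :=
    ⟨ρ' * κ / 720, by positivity, by nlinarith, by field_simp; norm_num⟩
  obtain ⟨s, hs, hs1⟩ : ∃ s, 0 < s ∧ (1 + 4080 / κ) * s = ρ' / 2 :=
    ⟨ρ' / 2 / (1 + 4080 / κ), by positivity, by field_simp⟩
  obtain ⟨θ, hθ, hbad⟩ := exists_measure_badEvent_le hL ht hv hd hr hi hd2 hr2 hi2
  refine ⟨20 / s + 12 / θ + (1 / t + 1), θ / 2, by positivity, by positivity, ?_⟩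
  intro N E η hN hE hη hη1 hK
  have hN0 : (0:ℝ) < N := by exact_mod_cast hN
  have p1 : 0 < 20 / s := by positivity
  have p2 : 0 < 12 / θ := by positivity
  have p3 : 0 < 1 / t := by positivity
  obtain ⟨J, hJ1, hJ2⟩ := exists_scale hη hη1
  set μ := Measure.pi (wignerLaw N νd νr νi) with hμ
  set z : ℕ → ℂ := fun l => ⟨E, 2 ^ l * η⟩ with hz
  have hzim : ∀ l, 0 < (z l).im := fun l => by simp only [hz]; positivity
  have hpow : ∀ l : ℕ, η ≤ 2 ^ l * η := fun l =>
    le_mul_of_one_le_left hη.le (one_le_pow₀ (by norm_num))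
  have hNz : ∀ l, N * η ≤ N * (z l).im := fun l => by
    simp only [hz]; exact mul_le_mul_of_nonneg_left (hpow l) hN0.le
  set w : (Fin N × Fin N → ℝ) → ℝ := fun x => ∑ k, ∑ l ∈ Finset.range (J + 1),
    (if x ∈ badEvent (z l) t k then (3:ℝ) ^ (l + 1) else 0) with hw
  have hterm : ∀ k l, Measurable (fun x : Fin N × Fin N → ℝ =>
      if x ∈ badEvent (z l) t k then (3:ℝ) ^ (l + 1) else 0) := fun k l =>
    Measurable.ite (measurableSet_badEvent (z l) t k) measurable_const measurable_const
  have hwm : Measurable w := Finset.measurable_sum _ fun k _ =>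
    Finset.measurable_sum _ fun l _ => hterm k l
  refine ⟨{x | N * s < w x}, measurableSet_lt measurable_const hwm, ?_, ?_⟩
  · -- Markov's inequality for the total weight of the failures
    have hA : 12 / θ ≤ N * η := by linarith
    have hE1 : ∀ k : Fin N, ∀ l ∈ Finset.range (J + 1), ∫⁻ x, ENNReal.ofReal
        (if x ∈ badEvent (z l) t k then (3:ℝ) ^ (l + 1) else 0) ∂μ ≤
        ENNReal.ofReal ((1 / 2) ^ l * (10 * Real.exp (-(θ / 2 * (N * η))))) := by
      intro k l hl
      have hz2 : (z l).im ≤ 2 := by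
        refine le_trans ?_ hJ2
        simp only [hz]
        have : l ≤ J := by simpa [Nat.lt_succ_iff] using hl
        gcongr; norm_num
      have h1 := hbad N (z l) (hzim l) hz2 (by linarith [hNz l]) k
      have e : ∀ x : Fin N × Fin N → ℝ, ENNReal.ofReal
          (if x ∈ badEvent (z l) t k then (3:ℝ) ^ (l + 1) else 0) =
          (badEvent (z l) t k).indicator (fun _ => ENNReal.ofReal (3 ^ (l + 1))) x := fun x => by
        by_cases hx : x ∈ badEvent (z l) t k <;> simp [hx]
      simp_rw [e]
      rw [lintegral_indicator_const (measurableSet_badEvent (z l) t k)]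
      calc ENNReal.ofReal (3 ^ (l + 1)) * μ (badEvent (z l) t k)
          ≤ ENNReal.ofReal (3 ^ (l + 1)) * (10 * expE (-(θ * (N * (z l).im)))) := by gcongr
        _ = ENNReal.ofReal (3 ^ (l + 1) * (10 * Real.exp (-(θ * (N * (z l).im))))) := by
            rw [ENNReal.ofReal_mul (by positivity), ENNReal.ofReal_mul (by norm_num), expE]
            norm_num
        _ ≤ _ := by
            refine ENNReal.ofReal_le_ofReal ?_
            have h2 := three_pow_mul_exp_le hθ hA l
            have h3 : N * (z l).im = 2 ^ l * (N * η) := by simp only [hz]; ring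
            rw [h3]; linarith
    have hEw : ∫⁻ x, ENNReal.ofReal (w x) ∂μ ≤
        ENNReal.ofReal (N * (20 * Real.exp (-(θ / 2 * (N * η))))) := by
      have e : ∀ x, ENNReal.ofReal (w x) = ∑ k, ∑ l ∈ Finset.range (J + 1), ENNReal.ofReal
          (if x ∈ badEvent (z l) t k then (3:ℝ) ^ (l + 1) else 0) := fun x => by
        simp only [hw]
        rw [ENNReal.ofReal_sum_of_nonneg fun k _ => Finset.sum_nonneg fun l _ => by
          split_ifs <;> positivity]
        refine Finset.sum_congr rfl fun k _ => ?_
        rw [ENNReal.ofReal_sum_of_nonneg fun l _ => by split_ifs <;> positivity]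
      simp_rw [e]
      rw [lintegral_finsetSum _ fun k _ => Finset.measurable_sum _ fun l _ =>
        (hterm k l).ennreal_ofReal]
      have h1 : ∀ k : Fin N, ∫⁻ x, ∑ l ∈ Finset.range (J + 1), ENNReal.ofReal
          (if x ∈ badEvent (z l) t k then (3:ℝ) ^ (l + 1) else 0) ∂μ ≤
          ENNReal.ofReal (20 * Real.exp (-(θ / 2 * (N * η)))) := fun k => by
        rw [lintegral_finsetSum _ fun l _ => (hterm k l).ennreal_ofReal]
        refine (Finset.sum_le_sum (hE1 k)).trans ?_
        rw [← ENNReal.ofReal_sum_of_nonneg fun l _ => by positivity, ← Finset.sum_mul]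
        refine ENNReal.ofReal_le_ofReal ?_
        have h2 := sum_geometric_two_le (J + 1)
        calc _ ≤ 2 * (10 * Real.exp (-(θ / 2 * (N * η)))) := by gcongr
          _ = _ := by ring
      refine (Finset.sum_le_sum fun k _ => h1 k).trans (le_of_eq ?_)
      rw [Finset.sum_const, Finset.card_univ, Fintype.card_fin, nsmul_eq_mul,
        ENNReal.ofReal_mul hN0.le, ENNReal.ofReal_natCast]
    have hNs : 0 < N * s := by positivity
    have hmark := mul_meas_ge_le_lintegral (μ := μ) hwm.ennreal_ofReal (ENNReal.ofReal (N * s))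
    have hsub : {x | N * s < w x} ⊆ {x | ENNReal.ofReal (N * s) ≤ ENNReal.ofReal (w x)} :=
      fun x hx => ENNReal.ofReal_le_ofReal (le_of_lt hx)
    calc μ {x | N * s < w x} = ENNReal.ofReal (1 / (N * s)) *
          (ENNReal.ofReal (N * s) * μ {x | N * s < w x}) := by
          rw [← mul_assoc, ← ENNReal.ofReal_mul (by positivity), one_div,
            inv_mul_cancel₀ hNs.ne', ENNReal.ofReal_one, one_mul]
      _ ≤ ENNReal.ofReal (1 / (N * s)) *
          ENNReal.ofReal (N * (20 * Real.exp (-(θ / 2 * (N * η))))) := by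
          gcongr
          exact (mul_le_mul_right (measure_mono hsub) _).trans (hmark.trans hEw)
      _ = ENNReal.ofReal (20 / s) * expE (-(θ / 2 * (N * η))) := by
          rw [expE, ← ENNReal.ofReal_mul (by positivity), ← ENNReal.ofReal_mul (by positivity)]
          congr 1
          field_simp
      _ ≤ _ := by
          gcongr
          linarith
  · intro x hx
    have hx' : w x ≤ N * s := not_lt.1 hx
    have hA := isHermitian_wignerMatrix x
    have := approx_selfConsistent_of_bootstrap hN (κ := κ) (E := E) (η := η) (t := t) (s := s)
      (L := J) hκ hE hη hJ1 hJ2 ht ht1 (by rw [ht2, hs1]; linarith)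
      (g := fun k l => resolv (wignerMatrix x) (z l) k k)
      (bad := fun k l => x ∈ badEvent (z l) t k)
      (fun k => (norm_resolv_diag_le hA (hzim J) k).trans
        (by rw [div_le_one (hzim J)]; exact hJ1))
      (fun k l => im_resolv_diag_nonneg hA (hzim l) k)
      (fun k l => ?_)
      (fun l _ hm k hk => exists_error_of_notMem_badEvent (hzim l) ht
        (by linarith [hNz l]) hm hk)
      hx' 0 (Nat.zero_le _)
    · rw [ht2, hs1] at this
      simp only [hz, pow_zero, one_mul] at this
      linarith
    · have := norm_resolv_diag_sub_le hA (E := E) (η := 2 ^ l * η) (by positivity) k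
      simp only [hz]
      have e : (2:ℝ) ^ (l + 1) * η = 2 * (2 ^ l * η) := by ring
      rw [e]; exact this

end LocalLaw

/-! ### Counting by Poisson kernels -/

section Counting

/-- The Poisson kernel of the upper half plane at height `h`, centered at `x`. -/
noncomputable def halfPlaneKernel (h x lam : ℝ) : ℝ := h / ((lam - x) ^ 2 + h ^ 2)

lemma halfPlaneKernel_pos {h : ℝ} (hh : 0 < h) (x lam : ℝ) : 0 < halfPlaneKernel h x lam := by
  unfold halfPlaneKernel; positivity

/-- Harnack's inequality for the Poisson kernel. -/
lemma halfPlaneKernel_le_of_abs_sub_le {h d x y lam : ℝ} (hh : 0 < h) (hdh : d ≤ h)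
    (hxy : |x - y| ≤ d) : halfPlaneKernel h x lam ≤ (1 + 2 * (d / h)) * halfPlaneKernel h y lam := by
  have hd : 0 ≤ d := (abs_nonneg _).trans hxy
  unfold halfPlaneKernel
  rw [mul_div_assoc', div_le_div_iff₀ (by positivity) (by positivity)]
  have h1 : (lam - y) ^ 2 + h ^ 2 ≤ (1 + 2 * (d / h)) * ((lam - x) ^ 2 + h ^ 2) := by
    have h2 : |lam - y| ≤ |lam - x| + d := by
      have := abs_add_le (lam - x) (x - y)
      rw [sub_add_sub_cancel] at this
      linarith
    have h3 : (lam - y) ^ 2 ≤ (|lam - x| + d) ^ 2 := by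
      rw [← sq_abs (lam - y)]; exact pow_le_pow_left₀ (abs_nonneg _) h2 2
    have h4 : (|lam - x| + d) ^ 2 = (lam - x) ^ 2 + 2 * |lam - x| * d + d ^ 2 := by
      rw [add_sq, sq_abs]
    have h5 : 2 * |lam - x| * d ≤ d / h * ((lam - x) ^ 2 + h ^ 2) := by
      have e : d / h * ((lam - x) ^ 2 + h ^ 2) - 2 * |lam - x| * d =
          d / h * (|lam - x| - h) ^ 2 := by
        rw [sub_sq |lam - x|, sq_abs]; field_simp; ring
      have : 0 ≤ d / h * (|lam - x| - h) ^ 2 := by positivity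
      linarith
    have h6 : d ^ 2 ≤ d / h * ((lam - x) ^ 2 + h ^ 2) := by
      rw [div_mul_eq_mul_div, le_div_iff₀ hh]
      nlinarith [mul_nonneg hd (sq_nonneg (lam - x)), mul_nonneg hd hh.le,
        mul_le_mul_of_nonneg_left hdh (mul_nonneg hd hh.le),
        mul_le_mul_of_nonneg_left hdh (mul_nonneg hd hd)]
    nlinarith
  nlinarith

/-- The increment of the primitive of the Poisson kernel over one cell of the grid. -/
lemma exists_arctan_sub_eq {h d x lam : ℝ} (hh : 0 < h) (hd : 0 < d) :
    ∃ y, |x - y| ≤ d ∧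
      Real.arctan ((x + d - lam) / h) - Real.arctan ((x - lam) / h) = d * halfPlaneKernel h y lam := by
  have hderiv : ∀ y : ℝ, HasDerivAt (fun y => Real.arctan ((y - lam) / h))
      (halfPlaneKernel h y lam) y := fun y => by
    have h1 : HasDerivAt (fun y => (y - lam) / h) (1 / h) y :=
      ((hasDerivAt_id y).sub_const lam).div_const h
    have h2 := h1.arctan
    convert h2 using 1
    unfold halfPlaneKernel
    have : (lam - y) ^ 2 = (y - lam) ^ 2 := by ring
    rw [this]
    field_simp
    ring
  obtain ⟨y, hy, he⟩ := exists_hasDerivAt_eq_slope (fun y => Real.arctan ((y - lam) / h))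
    (fun y => halfPlaneKernel h y lam) (by linarith : x < x + d)
    (fun y _ => (hderiv y).continuousAt.continuousWithinAt) (fun y _ => hderiv y)
  refine ⟨y, abs_le.2 ⟨by linarith [hy.2], by linarith [hy.1]⟩, ?_⟩
  rw [he, add_sub_cancel_left, mul_div_cancel₀ _ hd.ne']

/-- A Riemann sum of Poisson kernels is comparable to the integral, which is an increment of the
arctangent. -/
lemma sum_halfPlaneKernel_bounds {h d x lam : ℝ} (hh : 0 < h) (hd : 0 < d) (hdh : d ≤ h) (J : ℕ) :
    ∑ j ∈ Finset.range J, d * halfPlaneKernel h (x + j * d) lam ≤ (1 + 2 * (d / h)) *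
        (Real.arctan ((x + J * d - lam) / h) - Real.arctan ((x - lam) / h)) ∧
      Real.arctan ((x + J * d - lam) / h) - Real.arctan ((x - lam) / h) ≤
        (1 + 2 * (d / h)) * ∑ j ∈ Finset.range J, d * halfPlaneKernel h (x + j * d) lam := by
  have htel : Real.arctan ((x + J * d - lam) / h) - Real.arctan ((x - lam) / h) =
      ∑ j ∈ Finset.range J, (Real.arctan ((x + j * d + d - lam) / h) -
        Real.arctan ((x + j * d - lam) / h)) := by
    have := Finset.sum_range_sub (fun j : ℕ => Real.arctan ((x + j * d - lam) / h)) J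
    simp only [Nat.cast_zero, zero_mul, add_zero] at this
    rw [← this]
    refine Finset.sum_congr rfl fun j _ => ?_
    push_cast
    ring_nf
  rw [htel, Finset.mul_sum, Finset.mul_sum]
  constructor <;> refine Finset.sum_le_sum fun j _ => ?_ <;>
    obtain ⟨y, hy, he⟩ := exists_arctan_sub_eq (x := x + j * d) (lam := lam) hh hd <;> rw [he]
  · have := mul_le_mul_of_nonneg_left
      (halfPlaneKernel_le_of_abs_sub_le (lam := lam) hh hdh hy) hd.le
    linarith
  · rw [abs_sub_comm] at hy
    have := mul_le_mul_of_nonneg_left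
      (halfPlaneKernel_le_of_abs_sub_le (lam := lam) hh hdh hy) hd.le
    linarith

lemma pi_div_two_sub_inv_le_arctan {u : ℝ} (hu : 0 < u) :
    Real.pi / 2 - 1 / u ≤ Real.arctan u := by
  have h1 := Real.arctan_inv_of_pos hu
  have h2 : Real.arctan u⁻¹ ≤ u⁻¹ := by
    have h3 : 0 < Real.arctan u⁻¹ := Real.arctan_pos.2 (by positivity)
    have := (Real.lt_tan h3 (Real.arctan_lt_pi_div_two _)).le
    rwa [Real.tan_arctan] at this
  rw [one_div]; linarith

lemma pi_mul_semicircleDensity_le_one (E : ℝ) : Real.pi * semicircleDensity E ≤ 1 := by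
  unfold semicircleDensity
  have h1 : Real.sqrt (max (4 - E ^ 2) 0) ≤ 2 := by
    rw [Real.sqrt_le_left (by norm_num)]
    exact max_le (by nlinarith [sq_nonneg E]) (by norm_num)
  have h2 : Real.pi * (1 / (2 * Real.pi) * Real.sqrt (max (4 - E ^ 2) 0)) =
      Real.sqrt (max (4 - E ^ 2) 0) / 2 := by field_simp
  rw [h2]; linarith

lemma semicircleDensity_nonneg (E : ℝ) : 0 ≤ semicircleDensity E := by
  unfold semicircleDensity; positivity

/-- A Riemann sum of Poisson kernels over a slightly larger interval bounds the number of points in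
an interval from above. -/
lemma card_mul_le_of_halfPlaneKernel {N : ℕ} (hN : 0 < N) (lam : Fin N → ℝ) {E η p S X : ℝ} {J : ℕ}
    (hη : 0 < η) (hp0 : 0 < p) (hp4 : p ≤ 1 / 4) (hJ : J * (p ^ 4 * η) = (1 + p) * η)
    (hX : ∑ α, (if lam α ∈ Set.Icc (E - η / 2) (E + η / 2) then (1:ℝ) else 0) = X * (N * η))
    (hgrid : ∀ j < J, ∑ α, halfPlaneKernel (p ^ 3 * η)
      (E - (1 / 2 + p / 2) * η + j * (p ^ 4 * η)) (lam α) ≤ N * S) :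
    X * (Real.pi - 4 * p ^ 2) ≤ (1 + 2 * p) * (1 + p) * S := by
  have hpi := Real.pi_gt_three
  set h := p ^ 3 * η with hh
  set d := p ^ 4 * η with hd
  have hh0 : 0 < h := by positivity
  have hd0 : 0 < d := by positivity
  have hdh : d / h = p := by rw [hd, hh]; field_simp
  have hdh1 : d ≤ h := by
    have : d = h * p := by rw [hd, hh]; ring
    rw [this]
    exact mul_le_of_le_one_right hh0.le (by linarith)
  set x0 := E - (1 / 2 + p / 2) * η with hx0
  set ind : Fin N → ℝ := fun α => if lam α ∈ Set.Icc (E - η / 2) (E + η / 2) then (1:ℝ) else 0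
    with hind
  set u : ℝ := 1 / (2 * p ^ 2) with hu
  have hu0 : 0 < u := by positivity
  have hr : u * h = p / 2 * η := by rw [hh, hu]; field_simp
  have hpt : ∀ α, ind α * (Real.pi - 4 * p ^ 2) ≤ (1 + 2 * p) *
      ∑ j ∈ Finset.range J, d * halfPlaneKernel h (x0 + j * d) (lam α) := by
    intro α
    have hs : 0 ≤ ∑ j ∈ Finset.range J,
        d * halfPlaneKernel h (x0 + j * d) (lam α) := Finset.sum_nonneg fun j _ =>
      mul_nonneg hd0.le (halfPlaneKernel_pos hh0 _ _).le
    by_cases hα : lam α ∈ Set.Icc (E - η / 2) (E + η / 2)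
    · have hb := (sum_halfPlaneKernel_bounds (x := x0) (lam := lam α) hh0 hd0 hdh1 J).2
      rw [hdh, hJ] at hb
      have h1 : Real.arctan u ≤ Real.arctan ((x0 + (1 + p) * η - lam α) / h) := by
        refine Real.arctan_strictMono.monotone ?_
        rw [le_div_iff₀ hh0, hr, hx0]
        linarith [hα.2]
      have h2 : Real.arctan ((x0 - lam α) / h) ≤ -Real.arctan u := by
        rw [← Real.arctan_neg]
        refine Real.arctan_strictMono.monotone ?_
        rw [div_le_iff₀ hh0, neg_mul, hr, hx0]
        linarith [hα.1]
      have h3 := pi_div_two_sub_inv_le_arctan hu0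
      have h4 : 1 / u = 2 * p ^ 2 := by rw [hu]; field_simp
      rw [h4] at h3
      simp only [hind, if_pos hα, one_mul]
      linarith
    · simp only [hind, if_neg hα, zero_mul]; positivity
  have hsum := Finset.sum_le_sum fun α (_ : α ∈ Finset.univ) => hpt α
  rw [← Finset.sum_mul, hX, ← Finset.mul_sum, Finset.sum_comm] at hsum
  have hj : ∀ j ∈ Finset.range J,
      ∑ α, d * halfPlaneKernel h (x0 + j * d) (lam α) ≤ d * (N * S) := by
    intro j hj
    rw [← Finset.mul_sum]
    exact mul_le_mul_of_nonneg_left (hgrid j (Finset.mem_range.1 hj)) hd0.le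
  have hsum2 := Finset.sum_le_sum hj
  rw [Finset.sum_const, Finset.card_range, nsmul_eq_mul, ← mul_assoc, hJ] at hsum2
  have hN0 : (0:ℝ) < N := by exact_mod_cast hN
  have h6 : 0 < N * η := by positivity
  refine le_of_mul_le_mul_right ?_ h6
  have h7 := mul_le_mul_of_nonneg_left hsum2 (by positivity : 0 ≤ 1 + 2 * p)
  linarith

/-- Outside of the interval of length `η` around `E`, a Poisson kernel at a small height centered
well inside of the interval is dominated by the Poisson kernel at height `η` centered at `E`. -/
lemma halfPlaneKernel_le_of_notMem {E η p y lam : ℝ} (hη : 0 < η) (hp0 : 0 < p) (hp4 : p ≤ 1 / 4)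
    (hy1 : E - (1 / 2 - p / 2) * η ≤ y) (hy2 : y ≤ E + (1 / 2 - p / 2) * η)
    (hlam : lam ∉ Set.Icc (E - η / 2) (E + η / 2)) :
    halfPlaneKernel (p ^ 3 * η) y lam ≤ 8 * p * halfPlaneKernel η E lam := by
  have hdist : p / 2 * η ≤ |lam - y| := by
    rw [Set.mem_Icc, not_and_or, not_le, not_le] at hlam
    rcases hlam with h | h
    · rw [abs_sub_comm]
      exact le_trans (by linarith) (le_abs_self _)
    · exact le_trans (by linarith) (le_abs_self _)
  have hdE : |lam - E| ≤ |lam - y| + η / 2 := by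
    have h1 := abs_add_le (lam - y) (y - E)
    rw [sub_add_sub_cancel] at h1
    have h2 : |y - E| ≤ η / 2 := abs_le.2 ⟨by nlinarith, by nlinarith⟩
    linarith
  set u := |lam - y| with hu
  have hu2 : (lam - y) ^ 2 = u ^ 2 := (sq_abs _).symm
  have hE2 : (lam - E) ^ 2 ≤ (u + η / 2) ^ 2 := by
    rw [← sq_abs (lam - E)]; exact pow_le_pow_left₀ (abs_nonneg _) hdE 2
  have hu0 : 0 ≤ u := abs_nonneg _
  have hpη : p * η ≤ 2 * u := by linarith
  have hfin : p ^ 2 * ((lam - E) ^ 2 + η ^ 2) ≤ 8 * u ^ 2 := by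
    have e1 : p * (u + η / 2) ≤ 2 * u := by nlinarith
    have e2 : (p * (u + η / 2)) ^ 2 ≤ (2 * u) ^ 2 := pow_le_pow_left₀ (by positivity) e1 2
    have e3 : (p * η) ^ 2 ≤ (2 * u) ^ 2 := pow_le_pow_left₀ (by positivity) hpη 2
    nlinarith [mul_le_mul_of_nonneg_left hE2 (sq_nonneg p)]
  unfold halfPlaneKernel
  rw [mul_div_assoc', div_le_div_iff₀ (by positivity) (by positivity), hu2]
  calc p ^ 3 * η * ((lam - E) ^ 2 + η ^ 2) = p * η * (p ^ 2 * ((lam - E) ^ 2 + η ^ 2)) := by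
        ring
    _ ≤ p * η * (8 * u ^ 2) := by gcongr
    _ = 8 * p * η * u ^ 2 := by ring
    _ ≤ 8 * p * η * (u ^ 2 + (p ^ 3 * η) ^ 2) := by
        gcongr; nlinarith [sq_nonneg (p ^ 3 * η)]

/-- A Riemann sum of Poisson kernels over a slightly smaller interval bounds the number of points in
an interval from below. -/
lemma le_card_mul_of_halfPlaneKernel {N : ℕ} (hN : 0 < N) (lam : Fin N → ℝ) {E η p R S X : ℝ}
    {J : ℕ} (hη : 0 < η) (hp0 : 0 < p) (hp4 : p ≤ 1 / 4) (hJ : J * (p ^ 4 * η) = (1 - p) * η)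
    (hX : ∑ α, (if lam α ∈ Set.Icc (E - η / 2) (E + η / 2) then (1:ℝ) else 0) = X * (N * η))
    (hgrid : ∀ j < J, N * R ≤ ∑ α, halfPlaneKernel (p ^ 3 * η)
      (E - (1 / 2 - p / 2) * η + j * (p ^ 4 * η)) (lam α))
    (hmain : ∑ α, halfPlaneKernel η E (lam α) ≤ N * S) :
    (1 - p) * R ≤ (1 + 2 * p) * Real.pi * X + 8 * p * S := by
  set h := p ^ 3 * η with hh
  set d := p ^ 4 * η with hd
  have hh0 : 0 < h := by positivity
  have hd0 : 0 < d := by positivity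
  have hdh : d / h = p := by rw [hd, hh]; field_simp
  have hdh1 : d ≤ h := by
    have : d = h * p := by rw [hd, hh]; ring
    rw [this]
    exact mul_le_of_le_one_right hh0.le (by linarith)
  set x1 := E - (1 / 2 - p / 2) * η with hx1
  set ind : Fin N → ℝ := fun α => if lam α ∈ Set.Icc (E - η / 2) (E + η / 2) then (1:ℝ) else 0
    with hind
  have hpt : ∀ α, ∑ j ∈ Finset.range J, d * halfPlaneKernel h (x1 + j * d) (lam α) ≤
      ind α * ((1 + 2 * p) * Real.pi) + 8 * p * (η * halfPlaneKernel η E (lam α)) := by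
    intro α
    have hP := halfPlaneKernel_pos hη E (lam α)
    by_cases hα : lam α ∈ Set.Icc (E - η / 2) (E + η / 2)
    · have hb := (sum_halfPlaneKernel_bounds (x := x1) (lam := lam α) hh0 hd0 hdh1 J).1
      rw [hdh] at hb
      have h1 := Real.arctan_lt_pi_div_two ((x1 + J * d - lam α) / h)
      have h2 := Real.neg_pi_div_two_lt_arctan ((x1 - lam α) / h)
      have h3 : 0 ≤ 8 * p * (η * halfPlaneKernel η E (lam α)) := by positivity
      simp only [hind, if_pos hα, one_mul]
      have h4 : (1 + 2 * p) * (Real.arctan ((x1 + J * d - lam α) / h) -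
          Real.arctan ((x1 - lam α) / h)) ≤ (1 + 2 * p) * Real.pi := by
        gcongr; linarith
      linarith
    · simp only [hind, if_neg hα, zero_mul, zero_add]
      have hterm : ∀ j ∈ Finset.range J, d * halfPlaneKernel h (x1 + j * d) (lam α) ≤
          d * (8 * p * halfPlaneKernel η E (lam α)) := by
        intro j hj
        have hj' : (j:ℝ) * d ≤ (1 - p) * η := by
          rw [← hJ]
          have : (j:ℝ) ≤ J := by exact_mod_cast (Finset.mem_range.1 hj).le
          gcongr
        have hj0 : 0 ≤ (j:ℝ) * d := by positivity
        refine mul_le_mul_of_nonneg_left ?_ hd0.le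
        exact halfPlaneKernel_le_of_notMem hη hp0 hp4 (by linarith) (by linarith) hα
      refine (Finset.sum_le_sum hterm).trans ?_
      rw [Finset.sum_const, Finset.card_range, nsmul_eq_mul, ← mul_assoc, hJ]
      have h3 : 0 ≤ p * η * (8 * p * halfPlaneKernel η E (lam α)) := by positivity
      linarith
  have hsum := Finset.sum_le_sum fun α (_ : α ∈ Finset.univ) => hpt α
  rw [Finset.sum_comm, Finset.sum_add_distrib, ← Finset.sum_mul, hX, ← Finset.mul_sum,
    ← Finset.mul_sum] at hsum
  have hj : ∀ j ∈ Finset.range J, d * (N * R) ≤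
      ∑ α, d * halfPlaneKernel h (x1 + j * d) (lam α) := by
    intro j hj
    rw [← Finset.mul_sum]
    exact mul_le_mul_of_nonneg_left (hgrid j (Finset.mem_range.1 hj)) hd0.le
  have hsum2 := Finset.sum_le_sum hj
  rw [Finset.sum_const, Finset.card_range, nsmul_eq_mul, ← mul_assoc, hJ] at hsum2
  have hN0 : (0:ℝ) < N := by exact_mod_cast hN
  have h6 : 0 < N * η := by positivity
  refine le_of_mul_le_mul_right ?_ h6
  have h7 : 8 * p * (η * ∑ α, halfPlaneKernel η E (lam α)) ≤ 8 * p * (η * (N * S)) := by gcongr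
  linarith

/-- The number of points of a finite family in an interval is determined, up to a small error, by
the averages over the family of finitely many Poisson kernels at a smaller height, and of one
Poisson kernel at the height `η`, which controls the tails. -/
lemma abs_card_div_sub_le_of_halfPlaneKernel {N : ℕ} (hN : 0 < N) (lam : Fin N → ℝ) {E η : ℝ}
    (hη : 0 < η) {n : ℕ} (hn : 4 ≤ n)
    (hgrid : ∀ j < (n + 1) * n ^ 3, |(∑ α, halfPlaneKernel ((1 / n : ℝ) ^ 3 * η)
      (E - (1 / 2 + 1 / n / 2) * η + j * ((1 / n : ℝ) ^ 4 * η)) (lam α)) / N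
        - Real.pi * semicircleDensity E| ≤ 1 / n)
    (hmain : |(∑ α, halfPlaneKernel η E (lam α)) / N - Real.pi * semicircleDensity E| ≤ 1 / n) :
    |(∑ α, if lam α ∈ Set.Icc (E - η / 2) (E + η / 2) then (1:ℝ) else 0) / (N * η) -
      semicircleDensity E| ≤ 5 / n := by
  set ϱ := semicircleDensity E with hϱ
  have hϱ0 : 0 ≤ ϱ := semicircleDensity_nonneg E
  have hϱ1 : Real.pi * ϱ ≤ 1 := pi_mul_semicircleDensity_le_one E
  have hpi := Real.pi_gt_three
  have hN0 : (0:ℝ) < N := by exact_mod_cast hN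
  have hn4 : (4:ℝ) ≤ n := by exact_mod_cast hn
  have hn0 : (0:ℝ) < n := by linarith
  set p : ℝ := 1 / n with hp
  have hp0 : 0 < p := by positivity
  have hp4 : p ≤ 1 / 4 := by rw [hp]; gcongr
  have hpn : p * n = 1 := by rw [hp]; field_simp
  set X := (∑ α, if lam α ∈ Set.Icc (E - η / 2) (E + η / 2) then (1:ℝ) else 0) / (N * η) with hX
  have hcount : (∑ α, if lam α ∈ Set.Icc (E - η / 2) (E + η / 2) then (1:ℝ) else 0) =
      X * (N * η) := by rw [hX]; field_simp
  have hX0 : 0 ≤ X := div_nonneg (Finset.sum_nonneg fun α _ => by split_ifs <;> norm_num)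
    (by positivity)
  have hJ1 : (((n + 1) * n ^ 3 : ℕ) : ℝ) * (p ^ 4 * η) = (1 + p) * η := by
    push_cast
    calc ((n:ℝ) + 1) * n ^ 3 * (p ^ 4 * η) = (p * n) ^ 3 * (p * n + p) * η := by ring
      _ = _ := by rw [hpn]; ring
  have hJ2 : (((n - 1) * n ^ 3 : ℕ) : ℝ) * (p ^ 4 * η) = (1 - p) * η := by
    push_cast [Nat.cast_sub (by omega : 1 ≤ n)]
    calc ((n:ℝ) - 1) * n ^ 3 * (p ^ 4 * η) = (p * n) ^ 3 * (p * n - p) * η := by ring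
      _ = _ := by rw [hpn]; ring
  have hup := card_mul_le_of_halfPlaneKernel hN lam (S := Real.pi * ϱ + p) hη hp0 hp4 hJ1 hcount
    (fun j hj => by
      have h1 := (abs_le.1 (hgrid j hj)).2
      rw [sub_le_iff_le_add, div_le_iff₀ hN0] at h1
      linarith)
  have hlow := le_card_mul_of_halfPlaneKernel hN lam (R := Real.pi * ϱ - p) (S := Real.pi * ϱ + p)
    hη hp0 hp4 hJ2 hcount (fun j hj => by
      -- the grid of the smaller interval is part of the grid of the larger one
      have hlt : j + n ^ 3 < (n + 1) * n ^ 3 := by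
        have h2 : (n - 1) * n ^ 3 ≤ n * n ^ 3 := Nat.mul_le_mul_right _ (Nat.sub_le _ _)
        rw [add_mul, one_mul]
        omega
      have h1 := (abs_le.1 (hgrid (j + n ^ 3) hlt)).1
      have e : E - (1 / 2 + p / 2) * η + ((j + n ^ 3 : ℕ) : ℝ) * (p ^ 4 * η) =
          E - (1 / 2 - p / 2) * η + j * (p ^ 4 * η) := by
        push_cast
        linear_combination (p * η * ((p * n) ^ 2 + p * n + 1)) * hpn
      rw [e] at h1
      have h2 : Real.pi * ϱ - p ≤ (∑ α, halfPlaneKernel (p ^ 3 * η)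
          (E - (1 / 2 - p / 2) * η + j * (p ^ 4 * η)) (lam α)) / N := by linarith
      rw [le_div_iff₀ hN0] at h2
      linarith) (by
      have h1 := (abs_le.1 hmain).2
      rw [sub_le_iff_le_add, div_le_iff₀ hN0] at h1
      linarith)
  clear_value X p ϱ
  clear hgrid hmain hJ1 hJ2 hcount
  have hpn5 : (5:ℝ) / n = 5 * p := by rw [div_eq_mul_one_div, ← hp]
  rw [hpn5, abs_le]
  have hϱ3 : ϱ ≤ 1 / 3 := by nlinarith
  constructor
  · by_contra! hc
    have h1 : X < ϱ - 5 * p := by linarith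
    have h2 : (1 + 2 * p) * Real.pi * X ≤ (1 + 2 * p) * Real.pi * (ϱ - 5 * p) := by
      gcongr
    have h3 : (1 + 2 * p) * (ϱ - 5 * p) ≤ ϱ - 4 * p := by nlinarith
    have h4 : (1 + 2 * p) * Real.pi * (ϱ - 5 * p) ≤ Real.pi * ϱ - 4 * (Real.pi * p) := by
      nlinarith
    nlinarith
  · by_contra! hc
    have h1 : ϱ + 5 * p < X := by linarith
    have h2 : 0 < Real.pi - 4 * p ^ 2 := by nlinarith
    have h3 : (ϱ + 5 * p) * (Real.pi - 4 * p ^ 2) < X * (Real.pi - 4 * p ^ 2) := by gcongr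
    have h4 : (1 + 2 * p) * (1 + p) ≤ 1 + 5 * p := by nlinarith
    have h5 : (1 + 2 * p) * (1 + p) * (Real.pi * ϱ + p) ≤ (1 + 5 * p) * (Real.pi * ϱ + p) := by
      gcongr
    have h6 : (1 + 5 * p) * (Real.pi * ϱ + p) ≤ Real.pi * ϱ + 8 * p := by nlinarith
    have h7 : Real.pi * ϱ + 8 * p ≤ (ϱ + 5 * p) * (Real.pi - 4 * p ^ 2) := by
      have e : (ϱ + 5 * p) * (Real.pi - 4 * p ^ 2) =
          Real.pi * ϱ + 5 * p * Real.pi - 4 * p ^ 2 * ϱ - 20 * p ^ 3 := by ring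
      rw [e]
      have e2 : p ^ 2 ≤ p / 4 := by nlinarith
      have e3 : p ^ 3 ≤ p / 16 := by nlinarith [mul_nonneg hp0.le hp0.le]
      nlinarith [mul_nonneg (sq_nonneg p) hϱ0]
    linarith

end Counting

/-! ### Spectral form of the Stieltjes transform -/

section Spectral

variable {n : Type*} [Fintype n] [DecidableEq n]

lemma trace_resolv {A : Matrix n n ℂ} (hA : A.IsHermitian) {z : ℂ} (hz : 0 < z.im) :
    ∑ k, resolv A z k k = ∑ α, ((hA.eigenvalues α : ℂ) - z)⁻¹ := by
  set U := hA.eigenvectorUnitary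
  have hUU : (U : Matrix n n ℂ) * star (U : Matrix n n ℂ) = 1 := Unitary.coe_mul_star_self U
  have hUU' : star (U : Matrix n n ℂ) * (U : Matrix n n ℂ) = 1 := Unitary.coe_star_mul_self U
  have hne : ∀ α, (hA.eigenvalues α : ℂ) - z ≠ 0 := fun α h => by
    have := congrArg Complex.im h
    simp at this
    exact hz.ne' this
  set D : Matrix n n ℂ := Matrix.diagonal fun α => ((hA.eigenvalues α : ℂ) - z)⁻¹
  have hspec : A = U * Matrix.diagonal (fun α => (hA.eigenvalues α : ℂ)) *
      star (U : Matrix n n ℂ) := by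
    have := hA.spectral_theorem
    rw [Unitary.conjStarAlgAut_apply] at this
    exact this
  have hsub : A - z • 1 = U * Matrix.diagonal (fun α => (hA.eigenvalues α : ℂ) - z)
      * star (U : Matrix n n ℂ) := by
    have : Matrix.diagonal (fun α => (hA.eigenvalues α : ℂ) - z)
        = Matrix.diagonal (fun α => (hA.eigenvalues α : ℂ)) - z • (1 : Matrix n n ℂ) := by
      rw [Matrix.smul_one_eq_diagonal, Matrix.diagonal_sub]
    rw [this, mul_sub, sub_mul, ← hspec, mul_smul_comm, smul_mul_assoc, mul_one, hUU]
  have hinv : resolv A z = U * D * star (U : Matrix n n ℂ) := by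
    refine resolv_eq_of_sub_mul_eq_one ?_
    rw [hsub]
    calc _ = (U : Matrix n n ℂ) * Matrix.diagonal (fun α => (hA.eigenvalues α : ℂ) - z)
          * (star (U : Matrix n n ℂ) * U) * D * star (U : Matrix n n ℂ) := by
            simp only [mul_assoc]
      _ = 1 := by
        rw [hUU', mul_one, mul_assoc (U : Matrix n n ℂ), Matrix.diagonal_mul_diagonal]
        simp only [mul_inv_cancel₀ (hne _)]
        rw [Matrix.diagonal_one, mul_one, hUU]
  calc _ = (resolv A z).trace := rfl
    _ = D.trace := by rw [hinv, Matrix.trace_mul_cycle, hUU', one_mul]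
    _ = _ := by simp [D]

/-- The imaginary part of the Stieltjes transform of the empirical spectral measure averages Poisson
kernels over the eigenvalues. -/
lemma im_trace_resolv_div {N : ℕ} {A : Matrix (Fin N) (Fin N) ℂ} (hA : A.IsHermitian)
    (x : ℝ) {h : ℝ} (hh : 0 < h) :
    ((∑ k, resolv A ⟨x, h⟩ k k) / N).im = (∑ α, halfPlaneKernel h x (hA.eigenvalues α)) / N := by
  rw [trace_resolv hA (by exact hh), Complex.div_natCast_im, Complex.im_sum]
  refine congrArg (· / (N : ℝ)) (Finset.sum_congr rfl fun α _ => ?_)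
  rw [Complex.inv_im, Complex.normSq_apply, halfPlaneKernel]
  simp
  ring

lemma im_trace_resolv_div_nonneg {N : ℕ} {A : Matrix (Fin N) (Fin N) ℂ} (hA : A.IsHermitian)
    (x : ℝ) {h : ℝ} (hh : 0 < h) : 0 ≤ ((∑ k, resolv A ⟨x, h⟩ k k) / N).im := by
  rw [im_trace_resolv_div hA x hh]
  exact div_nonneg (Finset.sum_nonneg fun α _ => (halfPlaneKernel_pos hh _ _).le) N.cast_nonneg

lemma eigenvalueCount_eq_sum {𝕜 : Type*} [RCLike 𝕜] {N : ℕ} {A : Matrix (Fin N) (Fin N) 𝕜}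
    (hA : A.IsHermitian) (I : Set ℝ) [DecidablePred (· ∈ I)] :
    (eigenvalueCount hA I : ℝ) = ∑ α, if hA.eigenvalues α ∈ I then (1 : ℝ) else 0 := by
  rw [eigenvalueCount, Finset.sum_boole, Set.ncard_eq_toFinset_card']
  congr 2
  ext; simp

/-- A real symmetric matrix and its complexification have the same characteristic polynomial, hence
the same eigenvalue counts. -/
lemma eigenvalueCount_map_ofReal {N : ℕ} {A : Matrix (Fin N) (Fin N) ℝ} (hA : A.IsHermitian)
    {B : Matrix (Fin N) (Fin N) ℂ} (hB : B.IsHermitian) (h : A.map Complex.ofReal = B)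
    (I : Set ℝ) : eigenvalueCount hA I = eigenvalueCount hB I := by
  classical
  have hch : B.charpoly = A.charpoly.map Complex.ofRealHom := by
    rw [← h]; exact Matrix.charpoly_map A Complex.ofRealHom
  have hm : Multiset.map hA.eigenvalues Finset.univ.val
      = Multiset.map hB.eigenvalues Finset.univ.val := by
    have h1 := hA.roots_charpoly_eq_eigenvalues
    have h2 := hB.roots_charpoly_eq_eigenvalues
    have hs : A.charpoly.Splits := hA.splits_charpoly
    rw [hch, hs.roots_map, h1] at h2
    simp only [Multiset.map_map] at h2
    refine Multiset.map_injective Complex.ofReal_injective ?_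
    simpa [Function.comp_def] using h2
  have h3 : ∑ α, (if hA.eigenvalues α ∈ I then (1 : ℝ) else 0)
      = ∑ α, if hB.eigenvalues α ∈ I then (1 : ℝ) else 0 := by
    have := congrArg (fun s : Multiset ℝ => (s.map fun t => if t ∈ I then (1 : ℝ) else 0).sum) hm
    simp only [Multiset.map_map] at this
    exact this
  rw [← eigenvalueCount_eq_sum, ← eigenvalueCount_eq_sum] at h3
  exact_mod_cast h3

end Spectral

/-! ### Eigenvalue counting in the coordinate model -/

section Count

/-- For a spectral parameter `y + i h` close to the point `E` of the bulk, the average of the Poisson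
kernels over the eigenvalues is close to `π` times the semicircle density at `E`, outside of an
unlikely event. -/
lemma exists_abs_im_trace_resolv_sub_le {L κ ε vd vr vi : ℝ} (hL : 0 < L) (hκ : 0 < κ) (hε : 0 < ε)
    (hv : vr + vi = 1) {νd νr νi : Measure ℝ} [IsProbabilityMeasure νd]
    [IsProbabilityMeasure νr] [IsProbabilityMeasure νi]
    (hd : SubGaussian L νd) (hr : SubGaussian L νr) (hi : SubGaussian L νi)
    (hd2 : SubExpSquare L νd vd) (hr2 : SubExpSquare L νr vr) (hi2 : SubExpSquare L νi vi) :
    ∃ K θ : ℝ, 0 < K ∧ 0 < θ ∧ ∀ (N : ℕ) (E y h : ℝ), 0 < N → |E| ≤ 2 - κ → |y - E| ≤ 1 / K →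
      0 < h → h ≤ 1 / K → K ≤ N * h → ∃ B : Set (Fin N × Fin N → ℝ), MeasurableSet B ∧
        Measure.pi (wignerLaw N νd νr νi) B ≤ ENNReal.ofReal K * expE (-(θ * (N * h))) ∧
        ∀ x, x ∉ B → |(∑ α, halfPlaneKernel h y ((isHermitian_wignerMatrix x).eigenvalues α)) / N -
          Real.pi * semicircleDensity E| ≤ ε := by
  obtain ⟨ρ, hρ, hρ1, hρ2⟩ : ∃ ρ, 0 < ρ ∧ ρ ≤ κ / 2 / 40 ∧ ρ ≤ ε * κ / 4 :=
    ⟨min (κ / 2 / 40) (ε * κ / 4), by positivity, min_le_left _ _, min_le_right _ _⟩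
  obtain ⟨K₀, θ, hK₀, hθ, hloc⟩ := exists_local_law hL (half_pos hκ) hρ hv hd hr hi hd2 hr2 hi2
  set K := K₀ + 2 / κ + 1 + 40 / (ε * κ) with hKdef
  have ha : 0 < 2 / κ := by positivity
  have hb : 0 < 40 / (ε * κ) := by positivity
  have hK : 0 < K := by positivity
  refine ⟨K, θ, hK, hθ, fun N E y h hN hE hy hh hhK hNh => ?_⟩
  have hKκ : 1 / K ≤ κ / 2 := by
    rw [div_le_iff₀ hK]
    calc 1 = κ / 2 * (2 / κ) := by field_simp
      _ ≤ _ := by gcongr; linarith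
  have hKε : 1 / K ≤ ε * κ / 40 := by
    rw [div_le_iff₀ hK]
    calc 1 = ε * κ / 40 * (40 / (ε * κ)) := by field_simp
      _ ≤ _ := by gcongr; linarith
  have hK1 : 1 / K ≤ 1 := by
    rw [div_le_one hK]; linarith
  have hyE : |y| ≤ 2 - κ / 2 := by
    have := abs_add_le (y - E) E
    rw [sub_add_cancel] at this
    linarith
  obtain ⟨B, hB, hPB, hgood⟩ := hloc N y h hN hyE hh (hhK.trans hK1) (by linarith)
  refine ⟨B, hB, hPB.trans ?_, fun x hx => ?_⟩
  · gcongr; linarith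
  set m := (∑ k, resolv (wignerMatrix x) ⟨y, h⟩ k k) / N with hm
  have hm0 : 0 ≤ m.im := im_trace_resolv_div_nonneg (isHermitian_wignerMatrix x) y hh
  have hR := hgood x hx
  have hm5 : ‖m‖ ≤ 5 := (bounds_of_approx_selfConsistent (z := ⟨y, h⟩) (half_pos hκ) hyE hh
    (by show h ≤ 2; linarith) hm0 (hR.trans hρ1)).2
  rw [← im_trace_resolv_div (isHermitian_wignerMatrix x) y hh, ← hm]
  have hdiff : ‖(⟨y, h⟩ : ℂ) - E‖ ≤ 2 * (1 / K) := by
    refine (Complex.norm_le_abs_re_add_abs_im _).trans ?_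
    simp only [Complex.sub_re, Complex.ofReal_re, Complex.sub_im, Complex.ofReal_im, sub_zero,
      abs_of_pos hh]
    linarith
  have hRE : ‖m ^ 2 + E * m + 1‖ ≤ ρ + 2 * (1 / K) * 5 := by
    have : m ^ 2 + E * m + 1 = (m ^ 2 + ⟨y, h⟩ * m + 1) - ((⟨y, h⟩ : ℂ) - E) * m := by ring
    rw [this]
    refine (norm_sub_le _ _).trans (add_le_add hR ?_)
    rw [norm_mul]
    gcongr
  refine (abs_im_sub_pi_mul_semicircleDensity_le hκ hE hm0 hRE).trans ?_
  rw [div_le_iff₀ hκ]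
  linarith

/-- In the coordinate model, the normalized eigenvalue count of an interval in the bulk is close
to the semicircle density outside of an event which is unlikely. The exponential bound in `N * η`
is stated in the weaker form with exponent `δ ^ 2 * √(N * η)`, which absorbs all constants. -/
lemma exists_abs_eigenvalueCount_sub_lt {L κ δ vd vr vi : ℝ} (hL : 0 < L) (hκ : 0 < κ)
    (hδ : 0 < δ) (hv : vr + vi = 1) {νd νr νi : Measure ℝ} [IsProbabilityMeasure νd]
    [IsProbabilityMeasure νr] [IsProbabilityMeasure νi]
    (hd : SubGaussian L νd) (hr : SubGaussian L νr) (hi : SubGaussian L νi)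
    (hd2 : SubExpSquare L νd vd) (hr2 : SubExpSquare L νr vr) (hi2 : SubExpSquare L νi vi) :
    ∃ K : ℝ, 0 < K ∧ ∀ (N : ℕ) (E η : ℝ), 0 < N → |E| ≤ 2 - κ → K / N ≤ η → η ≤ 1 / K →
      ∃ B : Set (Fin N × Fin N → ℝ), MeasurableSet B ∧
        Measure.pi (wignerLaw N νd νr νi) B ≤ expE (-(δ ^ 2 * Real.sqrt (N * η))) ∧
        ∀ x, x ∉ B → |(eigenvalueCount (isHermitian_wignerMatrix x)
          (Set.Icc (E - η / 2) (E + η / 2)) : ℝ) / (N * η) - semicircleDensity E| < δ := by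
  obtain ⟨n, hn4, hnδ⟩ : ∃ n : ℕ, 4 ≤ n ∧ 5 / (n : ℝ) < δ := by
    obtain ⟨n, hn⟩ := exists_nat_gt (5 / δ)
    refine ⟨max n 4, le_max_right _ _, ?_⟩
    have h1 : 5 / δ < (max n 4 : ℕ) := hn.trans_le (by exact_mod_cast le_max_left n 4)
    have h0 : (0:ℝ) < (max n 4 : ℕ) := by positivity
    rw [div_lt_iff₀ hδ] at h1
    rw [div_lt_iff₀ h0]; linarith
  have hn : (4:ℝ) ≤ n := by exact_mod_cast hn4
  have hn0 : (0:ℝ) < n := by linarith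
  obtain ⟨K₀, θ, hK₀, hθ, hloc⟩ := exists_abs_im_trace_resolv_sub_le hL hκ
    (one_div_pos.2 hn0) hv hd hr hi hd2 hr2 hi2
  -- the smallest height of the grid is `q * η`, and the grid has `M` points besides `E + i η`
  set q : ℝ := (1 / n : ℝ) ^ 3 with hq
  have hq0 : 0 < q := by positivity
  have hq1 : q ≤ 1 := pow_le_one₀ (by positivity) (by rw [div_le_one hn0]; linarith)
  set M : ℕ := (n + 1) * n ^ 3 with hM
  set θ' := θ * q with hθ'
  have hθ'0 : 0 < θ' := by positivity
  set K := 2 * K₀ + K₀ / q + 2 * ((M + 1) * K₀) / θ' + 4 * δ ^ 4 / θ' ^ 2 with hKdef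
  have t1 : 0 < K₀ / q := by positivity
  have t2 : 0 < 2 * ((M + 1) * K₀) / θ' := by positivity
  have t3 : 0 < 4 * δ ^ 4 / θ' ^ 2 := by positivity
  have hK : 0 < K := by positivity
  refine ⟨K, hK, fun N E η hN hE hη1 hη2 => ?_⟩
  have hN0 : (0:ℝ) < N := by exact_mod_cast hN
  have hη : 0 < η := (div_pos hK hN0).trans_le hη1
  rw [div_le_iff₀ hN0, mul_comm] at hη1
  set A : ℝ := N * η with hA
  have hA0 : 0 < A := by positivity
  have hηK : 2 * η ≤ 1 / K₀ := by
    rw [le_div_iff₀ hK] at hη2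
    rw [le_div_iff₀ hK₀]
    nlinarith
  have hKA : K₀ ≤ A * q := by
    rw [← div_le_iff₀ hq0]; linarith
  -- each spectral parameter of the grid satisfies the local law outside of a small event
  have key : ∀ y h : ℝ, |y - E| ≤ 2 * η → q * η ≤ h → h ≤ η →
      ∃ B : Set (Fin N × Fin N → ℝ), MeasurableSet B ∧
        Measure.pi (wignerLaw N νd νr νi) B ≤ ENNReal.ofReal K₀ * expE (-(θ' * A)) ∧
        ∀ x, x ∉ B → |(∑ α, halfPlaneKernel h y ((isHermitian_wignerMatrix x).eigenvalues α)) / N -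
          Real.pi * semicircleDensity E| ≤ 1 / n := by
    intro y h hy h1 h2
    have hNh : A * q ≤ N * h := by
      calc A * q = N * (q * η) := by rw [hA]; ring
        _ ≤ N * h := by gcongr
    have hh : 0 < h := (mul_pos hq0 hη).trans_le h1
    obtain ⟨B, hB, hPB, hg⟩ := hloc N E y h hN hE (hy.trans hηK) hh (by linarith)
      (hKA.trans hNh)
    refine ⟨B, hB, hPB.trans ?_, hg⟩
    gcongr
    refine expE_le_expE ?_
    rw [hθ', mul_assoc, mul_comm q A]
    exact neg_le_neg (mul_le_mul_of_nonneg_left hNh hθ.le)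
  have hgrid : ∀ j : Fin M, |(E - (1 / 2 + 1 / n / 2) * η + (j : ℕ) * ((1 / n : ℝ) ^ 4 * η)) - E|
      ≤ 2 * η := by
    intro j
    have hj : ((j : ℕ) : ℝ) * (1 / n : ℝ) ^ 4 ≤ 1 + 1 / (n : ℝ) := by
      have : ((j : ℕ) : ℝ) ≤ (n + 1) * n ^ 3 := by exact_mod_cast j.2.le
      calc ((j : ℕ) : ℝ) * (1 / n : ℝ) ^ 4 ≤ ((n + 1) * n ^ 3) * (1 / n : ℝ) ^ 4 := by gcongr
        _ = 1 + 1 / (n : ℝ) := by field_simp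
    have hj0 : 0 ≤ ((j : ℕ) : ℝ) * (1 / n : ℝ) ^ 4 := by positivity
    have hi0 : (0:ℝ) < 1 / n := by positivity
    have hi1 : (1:ℝ) / n ≤ 1 := by rw [div_le_one hn0]; linarith
    have : (E - (1 / 2 + 1 / n / 2) * η + (j : ℕ) * ((1 / n : ℝ) ^ 4 * η)) - E
        = (((j : ℕ) : ℝ) * (1 / n : ℝ) ^ 4 - (1 / 2 + 1 / n / 2)) * η := by ring
    rw [this, abs_mul, abs_of_pos hη]
    refine mul_le_mul_of_nonneg_right (abs_le.2 ⟨?_, ?_⟩) hη.le <;> linarith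
  choose B hB hPB hg using fun j : Fin M => key _ (q * η) (hgrid j) le_rfl (by nlinarith)
  obtain ⟨B', hB', hPB', hg'⟩ := key E η (by simpa using hη.le) (by nlinarith) le_rfl
  refine ⟨B' ∪ ⋃ j, B j, hB'.union (MeasurableSet.iUnion hB), ?_, fun x hx => ?_⟩
  · calc Measure.pi (wignerLaw N νd νr νi) (B' ∪ ⋃ j, B j)
        ≤ Measure.pi (wignerLaw N νd νr νi) B' + ∑ j, Measure.pi (wignerLaw N νd νr νi) (B j) :=
          (measure_union_le _ _).trans (add_le_add le_rfl (measure_iUnion_fintype_le _ _))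
      _ ≤ ENNReal.ofReal K₀ * expE (-(θ' * A)) +
          ∑ _j : Fin M, ENNReal.ofReal K₀ * expE (-(θ' * A)) :=
          add_le_add hPB' (Finset.sum_le_sum fun j _ => hPB j)
      _ = ENNReal.ofReal ((M + 1) * K₀) * expE (-(θ' * A)) := by
          rw [Finset.sum_const, Finset.card_univ, Fintype.card_fin, nsmul_eq_mul,
            ENNReal.ofReal_mul (by positivity), ENNReal.ofReal_add (by positivity) (by positivity),
            ENNReal.ofReal_natCast, ENNReal.ofReal_one]
          ring
      _ ≤ expE ((M + 1) * K₀) * expE (-(θ' * A)) := by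
          gcongr
          exact ENNReal.ofReal_le_ofReal (by linarith [Real.add_one_le_exp ((M + 1) * K₀)])
      _ = expE ((M + 1) * K₀ + -(θ' * A)) := (expE_add _ _).symm
      _ ≤ expE (-(δ ^ 2 * Real.sqrt A)) := by
          refine expE_le_expE ?_
          have h1 : (M + 1) * K₀ ≤ θ' * A / 2 := by
            have : 2 * ((M + 1) * K₀) / θ' ≤ A := by linarith
            rw [div_le_iff₀ hθ'0] at this
            linarith
          have h2 : δ ^ 2 * Real.sqrt A ≤ θ' * A / 2 := by
            have h3 : 2 * δ ^ 2 / θ' ≤ Real.sqrt A := by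
              refine Real.le_sqrt_of_sq_le ?_
              have : (2 * δ ^ 2 / θ') ^ 2 = 4 * δ ^ 4 / θ' ^ 2 := by
                rw [div_pow]; ring
              linarith
            rw [div_le_iff₀ hθ'0] at h3
            have h4 := mul_le_mul_of_nonneg_right h3 (Real.sqrt_nonneg A)
            nlinarith [Real.mul_self_sqrt hA0.le]
          linarith
  · simp only [Set.mem_union, Set.mem_iUnion, not_or, not_exists] at hx
    classical
    rw [eigenvalueCount_eq_sum]
    refine lt_of_le_of_lt ?_ hnδ
    convert abs_card_div_sub_le_of_halfPlaneKernel hN (isHermitian_wignerMatrix x).eigenvalues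
      hη hn4 (fun j hj => hg ⟨j, hj⟩ x (hx.2 _)) (hg' x hx.1)

end Count

/-! ### From Wigner matrices to the coordinate model -/

section Transfer

lemma IsCenteredWithVariance.exists_subGaussian_subExpSquare {ν : Measure ℝ} {v : ℝ}
    (h : IsCenteredWithVariance ν v) {δ : ℝ} (hδ : 0 < δ)
    (hint : Integrable (fun x : ℝ => Real.exp (δ * x ^ 2)) ν) :
    ∃ L, 0 < L ∧ SubGaussian L ν ∧ SubExpSquare L ν v := by
  have := h.isProbabilityMeasure
  obtain ⟨L₁, h1, hs1⟩ := exists_subGaussian h.mean_eq hδ hint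
  obtain ⟨L₂, h2, hs2⟩ := exists_subExpSquare h.memLp.integrable_sq h.variance_eq hδ hint
  exact ⟨L₁ + L₂, by positivity, hs1.mono (by linarith), hs2.mono (by linarith)⟩

lemma subGaussian_dirac_zero {L : ℝ} (hL : 0 ≤ L) : SubGaussian L (Measure.dirac 0) := fun s => by
  rw [lintegral_dirac]
  exact expE_le_expE (by rw [mul_zero]; positivity)

lemma subExpSquare_dirac_zero {L : ℝ} (hL : 0 ≤ L) : SubExpSquare L (Measure.dirac 0) 0 :=
  fun s _ => by
    rw [lintegral_dirac]
    exact expE_le_expE (by simp only [ne_eq, OfNat.ofNat_ne_zero, not_false_eq_true, zero_pow,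
      sub_zero, mul_zero]; positivity)

variable {Ω : Type*} [MeasurableSpace Ω] {P : Measure Ω}

/-- An independent family stays independent when constants are adjoined to it. -/
lemma iIndepFun_extend_const [IsProbabilityMeasure P] {ι : Type*} {s : ι → Prop} [DecidablePred s]
    {f : {i // s i} → Ω → ℝ} (hf : iIndepFun f P) (c : ℝ) :
    iIndepFun (fun i ω => if h : s i then f ⟨i, h⟩ ω else c) P := by
  classical
  rw [iIndepFun_iff_measure_inter_preimage_eq_mul] at hf ⊢
  intro S sets hsets
  -- if some constraint on a constant coordinate fails, both sides vanish
  by_cases hc : ∀ i ∈ S, ¬ s i → c ∈ sets i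
  · have huniv : ∀ i ∈ S, ¬ s i → (fun ω => if h : s i then f ⟨i, h⟩ ω else c) ⁻¹' sets i
        = Set.univ := fun i hi hsi => by
      ext ω; simp [hsi, hc i hi hsi]
    have h1 := hf (S.subtype s) (sets := fun i => sets i) (fun i hi =>
      hsets i (Finset.mem_subtype.1 hi))
    have h2 : (⋂ i ∈ S, (fun ω => if h : s i then f ⟨i, h⟩ ω else c) ⁻¹' sets i)
        = ⋂ i ∈ S.subtype s, f i ⁻¹' sets i := by
      ext ω
      simp only [Set.mem_iInter, Set.mem_preimage, Finset.mem_subtype, Subtype.forall]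
      refine ⟨fun h i hi hiS => by simpa [hi] using h i hiS, fun h i hiS => ?_⟩
      by_cases hi : s i
      · simpa [hi] using h i hi hiS
      · simpa [hi] using hc i hiS hi
    rw [h2, h1, ← Finset.prod_filter_mul_prod_filter_not S s]
    rw [Finset.prod_eq_one (s := S.filter fun i => ¬ s i) (fun i hi => by
      rw [Finset.mem_filter] at hi
      rw [huniv i hi.1 hi.2, measure_univ]), mul_one, ← Finset.prod_subtype_eq_prod_filter]
    refine Finset.prod_congr rfl fun i _ => ?_
    congr 1
    ext ω
    simp [i.2]
  · push Not at hc
    obtain ⟨i, hiS, hi, hci⟩ := hc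
    have hempty : (fun ω => if h : s i then f ⟨i, h⟩ ω else c) ⁻¹' sets i = ∅ := by
      ext ω; simp [hi, hci]
    rw [Finset.prod_eq_zero hiS (by rw [hempty, measure_empty])]
    refine measure_mono_null (Set.iInter₂_subset i hiS) ?_
    rw [hempty, measure_empty]

/-- An event which forces independent coordinates into `B` is at most as likely as `B` is under
the product measure. The event need not be measurable. -/
lemma measureReal_le_of_iIndepFun [IsProbabilityMeasure P] {ι : Type*} [Fintype ι]
    {X : ι → Ω → ℝ} {ν : ι → Measure ℝ} (hind : iIndepFun X P) (hlaw : ∀ i, HasLaw (X i) (ν i) P)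
    {B : Set (ι → ℝ)} (hB : MeasurableSet B) {r : ℝ} (hPB : Measure.pi ν B ≤ expE r) {S : Set Ω}
    (hS : ∀ ω ∈ S, (fun i => X i ω) ∈ B) : P.real S ≤ Real.exp r := by
  have hm : Measure.map (fun ω i => X i ω) P = Measure.pi ν := by
    rw [hind.map_fun_eq_pi_map fun i => (hlaw i).aemeasurable]
    simp only [(hlaw _).map_eq]
  have hle : P S ≤ expE r := by
    calc P S ≤ P ((fun ω i => X i ω) ⁻¹' B) := measure_mono hS
      _ = Measure.pi ν B := by
        rw [← hm, Measure.map_apply_of_aemeasurable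
          (aemeasurable_pi_lambda _ fun i => (hlaw i).aemeasurable) hB]
      _ ≤ expE r := hPB
  exact ENNReal.toReal_le_of_le_ofReal (Real.exp_pos _).le hle

variable {ν ν' : Measure ℝ} {N : ℕ}

lemma sqrt_cast_ne_zero (hN : 0 < N) : ((Real.sqrt N : ℝ) : ℂ) ≠ 0 := by
  have : (0:ℝ) < N := by exact_mod_cast hN
  exact_mod_cast (Real.sqrt_pos.2 this).ne'

/-- The coordinates of a real symmetric matrix; those below the diagonal vanish. -/
noncomputable def symmetricCoord (A : Matrix (Fin N) (Fin N) ℝ) (p : Fin N × Fin N) : ℝ :=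
  if p.1 ≤ p.2 then Real.sqrt N * A p.1 p.2 else 0

/-- The coordinates of a complex hermitian matrix: real parts on and above the diagonal, and below
the diagonal the imaginary parts of the reflected entries. -/
noncomputable def hermitianCoord (A : Matrix (Fin N) (Fin N) ℂ) (p : Fin N × Fin N) : ℝ :=
  if p.1 ≤ p.2 then Real.sqrt N * (A p.1 p.2).re else Real.sqrt N * (A p.2 p.1).im

lemma map_ofReal_eq_wignerMatrix (hN : 0 < N) {A : Matrix (Fin N) (Fin N) ℝ}
    (hA : A.IsHermitian) : A.map Complex.ofReal = wignerMatrix (symmetricCoord A) := by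
  have h0 := sqrt_cast_ne_zero hN
  ext i j
  simp only [Matrix.map_apply, wignerMatrix, Matrix.of_apply, symmetricCoord]
  rw [eq_div_iff h0]
  rcases lt_trichotomy i j with h | h | h
  · simp [h.ne, h, h.le, h.not_ge, mul_comm]
  · simp [h, mul_comm]
  · have hs : A i j = A j i := by simpa using (hA.apply i j).symm
    simp [h.ne', h.not_gt, h.le, h.not_ge, hs, mul_comm]

lemma eq_wignerMatrix (hN : 0 < N) {A : Matrix (Fin N) (Fin N) ℂ} (hA : A.IsHermitian) :
    A = wignerMatrix (hermitianCoord A) := by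
  have h0 := sqrt_cast_ne_zero hN
  ext i j
  simp only [wignerMatrix, Matrix.of_apply, hermitianCoord]
  rw [eq_div_iff h0]
  rcases lt_trichotomy i j with h | h | h
  · simp only [h.ne, h, h.le, h.not_ge, if_true, if_false]
    nth_rewrite 1 [← Complex.re_add_im (A i j)]
    push_cast
    ring
  · have hs := hA.apply i i
    have him : (A i i).im = 0 := by
      have := congrArg Complex.im hs
      simp at this
      linarith
    subst h
    simp only [le_refl, if_true]
    nth_rewrite 1 [← Complex.re_add_im (A i i)]
    rw [him]
    push_cast
    ring
  · have hs : A i j = star (A j i) := (hA.apply i j).symm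
    simp only [h.ne', h.not_gt, h.le, h.not_ge, if_true, if_false]
    rw [hs]
    apply Complex.ext <;> simp <;> ring

lemma IsSymmetricWigner.iIndepFun_symmetricCoord [IsProbabilityMeasure P]
    {H : Ω → Matrix (Fin N) (Fin N) ℝ} (hH : IsSymmetricWigner P ν ν' H) :
    iIndepFun (fun p ω => symmetricCoord (H ω) p) P := by
  have h := iIndepFun_extend_const
    (hH.indep.comp (fun _ x => Real.sqrt N * x) fun _ => by fun_prop) 0
  convert h using 3 with p ω
  by_cases hp : p.1 ≤ p.2 <;> simp [symmetricCoord, hp]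

lemma IsSymmetricWigner.hasLaw_symmetricCoord [IsProbabilityMeasure P]
    {H : Ω → Matrix (Fin N) (Fin N) ℝ} (hH : IsSymmetricWigner P ν ν' H) (p : Fin N × Fin N) :
    HasLaw (fun ω => symmetricCoord (H ω) p) (wignerLaw N ν' ν (Measure.dirac 0) p) P := by
  obtain ⟨i, j⟩ := p
  simp only [symmetricCoord, wignerLaw]
  rcases lt_trichotomy i j with h | h | h
  · simpa [h.ne, h, h.le] using hH.law_offDiag i j h
  · simpa [h] using hH.law_diag j
  · simp only [h.ne', h.not_gt, h.not_ge, if_false]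
    exact ⟨aemeasurable_const, by simp⟩

/-- The position of a coordinate in the independent family of real and imaginary parts. -/
def hermitianIndex (p : Fin N × Fin N) :
    {p : Fin N × Fin N // p.1 ≤ p.2} ⊕ {p : Fin N × Fin N // p.1 < p.2} :=
  if h : p.1 ≤ p.2 then Sum.inl ⟨p, h⟩ else Sum.inr ⟨(p.2, p.1), not_le.1 h⟩

lemma injective_hermitianIndex :
    Function.Injective (hermitianIndex : Fin N × Fin N → _) := by
  intro p q h
  unfold hermitianIndex at h
  split_ifs at h with h1 h2 h2
  · simpa using h
  · simpa [Prod.ext_iff, and_comm] using h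

lemma IsHermitianWigner.iIndepFun_hermitianCoord
    {H : Ω → Matrix (Fin N) (Fin N) ℂ} (hH : IsHermitianWigner P ν ν' H) :
    iIndepFun (fun p ω => hermitianCoord (H ω) p) P := by
  have h := (hH.indep.precomp injective_hermitianIndex).comp (fun _ x => Real.sqrt N * x)
    fun _ => by fun_prop
  convert h using 3 with p ω
  by_cases hp : p.1 ≤ p.2 <;> simp [hermitianCoord, hermitianIndex, hp]

lemma IsHermitianWigner.hasLaw_hermitianCoord
    {H : Ω → Matrix (Fin N) (Fin N) ℂ} (hH : IsHermitianWigner P ν ν' H) (p : Fin N × Fin N) :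
    HasLaw (fun ω => hermitianCoord (H ω) p) (wignerLaw N ν' ν ν p) P := by
  obtain ⟨i, j⟩ := p
  simp only [hermitianCoord, wignerLaw]
  rcases lt_trichotomy i j with h | h | h
  · simpa [h.ne, h, h.le] using hH.law_re i j h
  · simpa [h] using hH.law_diag j
  · simpa [h.ne', h.not_gt, h.not_ge] using hH.law_im j i h

end Transfer

/-! ### The local semicircle law -/

theorem mainTheorem3 :
    ∃ c₁ : ℝ, 0 < c₁ ∧
      ∀ κ : ℝ, 0 < κ →
        ∃ C c : ℝ, 0 < C ∧ 0 < c ∧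
          -- symmetric case
          (∀ ν ν' : Measure ℝ,
            IsCenteredWithVariance ν 1 → IsCenteredWithVariance ν' 2 →
            HasGaussianDecay ν ν' →
            ∀ δ : ℝ, 0 < δ → δ ≤ c₁ * κ →
              ∃ K : ℝ, 0 < K ∧
                ∀ E : ℝ, E ∈ Set.Icc (-2 + κ) (2 - κ) →
                ∀ (Ω : Type*) [MeasurableSpace Ω] (P : Measure Ω) [IsProbabilityMeasure P]
                  (N : ℕ) (H : Ω → Matrix (Fin N) (Fin N) ℝ)
                  (hH : IsSymmetricWigner P ν ν' H) (η : ℝ),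
                  0 < N → K / N ≤ η → η ≤ 1 / K →
                  P.real {ω | δ ≤ |(eigenvalueCount (hH.isHermitian ω)
                      (Set.Icc (E - η / 2) (E + η / 2)) : ℝ) / (N * η) - semicircleDensity E|}
                    ≤ C * Real.exp (-c * δ ^ 2 * Real.sqrt (N * η))) ∧
          -- hermitian case
          (∀ ν ν' : Measure ℝ,
            IsCenteredWithVariance ν (1 / 2) → IsCenteredWithVariance ν' 1 →
            HasGaussianDecay ν ν' →
            ∀ δ : ℝ, 0 < δ → δ ≤ c₁ * κ →
              ∃ K : ℝ, 0 < K ∧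
                ∀ E : ℝ, E ∈ Set.Icc (-2 + κ) (2 - κ) →
                ∀ (Ω : Type*) [MeasurableSpace Ω] (P : Measure Ω) [IsProbabilityMeasure P]
                  (N : ℕ) (H : Ω → Matrix (Fin N) (Fin N) ℂ)
                  (hH : IsHermitianWigner P ν ν' H) (η : ℝ),
                  0 < N → K / N ≤ η → η ≤ 1 / K →
                  P.real {ω | δ ≤ |(eigenvalueCount (hH.isHermitian ω)
                      (Set.Icc (E - η / 2) (E + η / 2)) : ℝ) / (N * η) - semicircleDensity E|}
                    ≤ C * Real.exp (-c * δ ^ 2 * Real.sqrt (N * η))) := by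
  have habs : ∀ {κ E : ℝ}, E ∈ Set.Icc (-2 + κ) (2 - κ) → |E| ≤ 2 - κ := fun h =>
    abs_le.2 ⟨by linarith [h.1], h.2⟩
  -- the tail is exponential in `N * η`, and `K` may depend on `δ` and on the laws, so that all the
  -- other constants can be taken equal to one and `δ` need not be small
  refine ⟨1, one_pos, fun κ hκ => ⟨1, 1, one_pos, one_pos, ?_, ?_⟩⟩
  · rintro ν ν' hν hν' ⟨δ₀, hδ₀, hint, hint'⟩ δ hδ -
    have := hν.isProbabilityMeasure
    have := hν'.isProbabilityMeasure
    obtain ⟨L, hL, hsg, hse⟩ := hν.exists_subGaussian_subExpSquare hδ₀ hint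
    obtain ⟨L', hL', hsg', hse'⟩ := hν'.exists_subGaussian_subExpSquare hδ₀ hint'
    have hLL : L ≤ L + L' := by linarith
    have hLL' : L' ≤ L + L' := by linarith
    obtain ⟨K, hK, hcount⟩ := exists_abs_eigenvalueCount_sub_lt (add_pos hL hL') hκ hδ
      (add_zero 1) (hsg'.mono hLL') (hsg.mono hLL) (subGaussian_dirac_zero (add_pos hL hL').le)
      (hse'.mono hLL') (hse.mono hLL) (subExpSquare_dirac_zero (add_pos hL hL').le)
    refine ⟨K, hK, fun E hE Ω _ P _ N H hH η hN hη1 hη2 => ?_⟩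
    obtain ⟨B, hB, hPB, hgood⟩ := hcount N E η hN (habs hE) hη1 hη2
    rw [one_mul, neg_mul, one_mul, neg_mul]
    refine measureReal_le_of_iIndepFun hH.iIndepFun_symmetricCoord hH.hasLaw_symmetricCoord hB hPB
      fun ω hω => ?_
    by_contra hx
    have h := hgood _ hx
    rw [← eigenvalueCount_map_ofReal (hH.isHermitian ω) (isHermitian_wignerMatrix _)
      (map_ofReal_eq_wignerMatrix hN (hH.isHermitian ω))] at h
    exact absurd h (not_lt.2 hω)
  · rintro ν ν' hν hν' ⟨δ₀, hδ₀, hint, hint'⟩ δ hδ -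
    have := hν.isProbabilityMeasure
    have := hν'.isProbabilityMeasure
    obtain ⟨L, hL, hsg, hse⟩ := hν.exists_subGaussian_subExpSquare hδ₀ hint
    obtain ⟨L', hL', hsg', hse'⟩ := hν'.exists_subGaussian_subExpSquare hδ₀ hint'
    have hLL : L ≤ L + L' := by linarith
    have hLL' : L' ≤ L + L' := by linarith
    obtain ⟨K, hK, hcount⟩ := exists_abs_eigenvalueCount_sub_lt (add_pos hL hL') hκ hδ
      (add_halves 1) (hsg'.mono hLL') (hsg.mono hLL) (hsg.mono hLL)
      (hse'.mono hLL') (hse.mono hLL) (hse.mono hLL)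
    refine ⟨K, hK, fun E hE Ω _ P _ N H hH η hN hη1 hη2 => ?_⟩
    obtain ⟨B, hB, hPB, hgood⟩ := hcount N E η hN (habs hE) hη1 hη2
    rw [one_mul, neg_mul, one_mul, neg_mul]
    refine measureReal_le_of_iIndepFun hH.iIndepFun_hermitianCoord hH.hasLaw_hermitianCoord hB hPB
      fun ω hω => ?_
    by_contra hx
    have h := hgood _ hx
    have hcongr : ∀ {A A' : Matrix (Fin N) (Fin N) ℂ} (hA : A.IsHermitian) (hA' : A'.IsHermitian)
        (_ : A = A') (I : Set ℝ), eigenvalueCount hA I = eigenvalueCount hA' I := by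
      intro A A' _ _ hAA I
      subst hAA
      rfl
    rw [← hcongr (hH.isHermitian ω) (isHermitian_wignerMatrix _)
      (eq_wignerMatrix hN (hH.isHermitian ω))] at h
    exact absurd h (not_lt.2 hω)
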